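/- Write $\mathbf e(x)=e^{2\pi i x}$, $q=\mathbf e(\tau)$, $\tau\in\mathfrak h$. Let $\theta(\tau,z)=\sum_{\nu\in\mathbb Z+\frac12}(-1)^{\lfloor\nu\rfloor}\mathbf e(\nu z)q^{\nu^2/2}$ and $\theta^{(r)}=(\frac1{2\pi i}\partial_z)^r\theta$. Let $V_0=1$, define meromorphic functions $V_n$ ($n\ge1$) recursively by $$\sum_{m=0}^n\frac{(-1)^{n-m}}{(n-m)!}\,\theta^{(n-m)}(\tau,z_1+\dots+z_m)\,V_m(\tau,z_1,\dots,z_m)=0,$$ and let $F_n(\tau,z_1,\dots,z_n)=\sum_{\sigma\in\mathfrak S_n}V_n(\tau,z_{\sigma(1)},\dots,z_{\sigma(n)})$ be the Bloch–Okounkov $n$-point functions. **Definitions.** For $M\in M_n(\mathbb Q)$, $B(\vec z,\vec w)=\vec zM\vec w^t$, $k\in\mathbb Z$, $\gamma=\begin{pmatrix}a&b\\c&d\end{pmatrix}\in\mathrm{SL}_2(\mathbb Z)$ and $X=(\vec\lambda,\vec\mu)$ put $$(\phi|_{k,M}\gamma)(\tau,\vec z)=(c\tau+d)^{-k}\,\mathbf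 e\Bigl(\tfrac{-cB(\vec z,\vec z)}{c\tau+d}\Bigr)\phi\Bigl(\tfrac{a\tau+b}{c\tau+d},\tfrac{\vec z}{c\tau+d}\Bigr),$$ $$(\phi|_MX)(\tau,\vec z)=\mathbf e(B(\vec\lambda+\vec\mu,\vec\lambda+\vec\mu))\,\mathbf e(B(\vec\lambda,\vec\lambda\tau+2\vec z))\,\phi(\tau,\vec z+\vec\lambda\tau+\vec\mu).$$ Let $\mathrm{Mer}_n$ be the set of meromorphic functions $\phi$ on $\mathfrak h\times\mathbb C^n$ such that for all $\vec\lambda,\vec\mu\in\mathbb R^n$ either $\phi$ has a pole at (i.e. does not extend holomorphically to a neighbourhood of) $(\tau,\vec\lambda\tau+\vec\mu)$ for all $\tau$ outside a closed discrete subset of $\mathfrak h$, or $\phi$ is holomorphic at all these points and $h(\tau)=\phi(\tau,\vec\lambda\tau+\vec\mu)$ is holomorphic with $h(\gamma(x+iy))=O(e^{Cy})$ as $y\to\infty$ for all $C>0$, $\gamma\in\mathrm{SL}_2(\mathbb Z)$, $x\in\mathbb R$. Let $\mathrm{Mer}_n^M$ consist of the $\phi\in\mathrm{Mer}_n$ with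 $\phi|_MX\in\mathrm{Mer}_n$ for all rational $X$. With $\nu(\tau)=\frac1{2i\,\mathrm{Im}\,\tau}$ and $\xi(\tau,z)=\frac{\mathrm{Im}\,z}{\mathrm{Im}\,\tau}$, a (strictly meromorphic) quasi-Jacobi form of weight $k$ and index $M$ is a function $\phi=\phi_{0,\vec0}$ for which there is a finite family $\phi_{i,\vec j}\in\mathrm{Mer}_n^M$ ($i\in\mathbb Z_{\ge0}$, $\vec j\in\mathbb Z_{\ge0}^n$) such that $$\Phi=\sum_{i,\vec j}\phi_{i,\vec j}\,\Bigl(\frac{\nu(\tau)}{2\pi i}\Bigr)^i\,\xi(\tau,z_1)^{j_1}\cdots\xi(\tau,z_n)^{j_n}$$ satisfies $(\Phi|_{k,M}\gamma)|_MX=\Phi$ for all $\gamma\in\mathrm{SL}_2(\mathbb Z)$ and all integral $X$. This family describes the transformation behaviour of $\phi$. Put $\delta_\tau\phi=\phi_{1,\vec0}$ and $\delta_{z_r}\phi=\phi_{0,e_r}$. (All identities are identities of meromorphic functions, or of polynomials in $\nu,\xi$ with meromorphic coefficients.) **Proposition.** For all $n\ge1$, $F_n$ is a quasi-Jacobi form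 of weight $n$ and index $M_n$, where $B_{M_n}(\vec z,\vec z)=-\frac12(z_1+\dots+z_n)^2$, every family as above for $F_n$ has the same $\delta_\tau F_n$ and $\delta_{z_1}F_n$, and $$\delta_\tau F_n(z_1,\dots,z_n)=0,\qquad \delta_{z_1}F_n(z_1,\dots,z_n)=\sum_{i=2}^nF_{n-1}(z_1+z_i,z_2,\dots,z_{i-1},z_{i+1},\dots,z_n).$$ These two properties determine the transformation behaviour of the symmetric function $F_n$: if $\phi$ is any quasi-Jacobi form of weight $n$ and index $M_n$, symmetric in $z_1,\dots,z_n$, with $\delta_\tau\phi=0$ and $\delta_{z_1}\phi=\sum_{i=2}^nF_{n-1}(z_1+z_i,z_2,\dots,z_{i-1},z_{i+1},\dots,z_n)$, then $\phi_{i,\vec j}=(F_n)_{i,\vec j}$ for all $(i,\vec j)\ne(0,\vec0)$ (for every choice of the two families). -/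

import Mathlib

open Filter Topology
open scoped MatrixGroups

namespace BlochOkounkov

/-! ### The domain, generic equality, meromorphic functions -/

/-- The domain `𝔥 × ℂⁿ`. -/
abbrev Dom (n : ℕ) : Type := UpperHalfPlane × (Fin n → ℂ)

/-- The inclusion of `𝔥 × ℂⁿ` as an open subset of `ℂ × ℂⁿ`. -/
def Dom.incl {n : ℕ} (p : Dom n) : ℂ × (Fin n → ℂ) := ((p.1 : ℂ), p.2)

/-- `𝐞(x) = exp(2πix)`. -/
noncomputable def e (x : ℂ) : ℂ := Complex.exp (2 * Real.pi * Complex.I * x)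

/-- Equality as meromorphic (or real-analytic with poles) functions: agreement on a dense open
subset. The values that a representative takes at its poles play no role. -/
def GenEq {n : ℕ} (φ ψ : Dom n → ℂ) : Prop := Dense (interior {p | φ p = ψ p})

/-- `φ` represents a meromorphic function on `𝔥 × ℂⁿ`: locally it is a quotient of two holomorphic
functions of `n + 1` variables, the denominator not vanishing identically. -/
def IsMeromorphic {n : ℕ} (φ : Dom n → ℂ) : Prop :=
  ∀ p : Dom n, ∃ g h : ℂ × (Fin n → ℂ) → ℂ,
    AnalyticAt ℂ g p.incl ∧ AnalyticAt ℂ h p.incl ∧ (¬ ∀ᶠ x in 𝓝 p.incl, h x = 0) ∧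
    ∀ᶠ x in 𝓝 p, h (Dom.incl x) ≠ 0 → φ x = g x.incl / h x.incl

/-- The meromorphic function `φ` is holomorphic at `p` (after removing removable singularities) and
has the value `v` there. -/
def HolomorphicAtWithValue {n : ℕ} (φ : Dom n → ℂ) (p : Dom n) (v : ℂ) : Prop :=
  ∃ f : ℂ × (Fin n → ℂ) → ℂ, AnalyticAt ℂ f p.incl ∧ f p.incl = v ∧
    ∃ G : Set (Dom n), IsOpen G ∧ Dense G ∧ ∀ᶠ x in 𝓝 p, x ∈ G → φ x = f x.incl

/-- `p` is a pole of `φ`, i.e. `φ` does not extend holomorphically to a neighbourhood of `p`. -/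
def IsPole {n : ℕ} (φ : Dom n → ℂ) (p : Dom n) : Prop :=
  ¬ ∃ v, HolomorphicAtWithValue φ p v

/-- `Hol₀(𝔥)`: holomorphic functions of moderate growth on the upper half plane. -/
def Hol0 (h : UpperHalfPlane → ℂ) : Prop :=
  DifferentiableOn ℂ (fun w : ℂ => h (UpperHalfPlane.ofComplex w)) {w | 0 < w.im} ∧
  ∀ C : ℝ, 0 < C → ∀ (γ : SL(2, ℤ)) (x : ℝ),
    (fun y : ℝ => h (γ • UpperHalfPlane.ofComplex ((x : ℂ) + (y : ℂ) * Complex.I)))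
      =O[atTop] fun y : ℝ => Real.exp (C * y)

/-- The point `λτ + μ` of `ℂⁿ`. -/
def torsionPoint {n : ℕ} (lam mu : Fin n → ℝ) (τ : UpperHalfPlane) : Fin n → ℂ :=
  fun r => (lam r : ℂ) * (τ : ℂ) + (mu r : ℂ)

/-- The space `Merₙ`: for all real `λ, μ`, either `λτ + μ` is a pole for all `τ` outside a closed
discrete subset of `𝔥`, or `τ ↦ φ(τ, λτ + μ)` is a function in `Hol₀(𝔥)`. -/
def Mer {n : ℕ} (φ : Dom n → ℂ) : Prop :=
  IsMeromorphic φ ∧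
  ∀ lam mu : Fin n → ℝ,
    (∀ᶠ τ in codiscrete UpperHalfPlane, IsPole φ (τ, torsionPoint lam mu τ)) ∨
    ∃ h : UpperHalfPlane → ℂ, Hol0 h ∧
      ∀ τ, HolomorphicAtWithValue φ (τ, torsionPoint lam mu τ) (h τ)

/-! ### The slash action of the Jacobi group -/

/-- The bilinear form `B_M(z, w) = z M wᵗ`. -/
def bil {n : ℕ} (M : Matrix (Fin n) (Fin n) ℚ) (z w : Fin n → ℂ) : ℂ :=
  ∑ r, ∑ s, z r * (M r s : ℂ) * w s

/-- The automorphy factor `cτ + d`. -/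
def autom (γ : SL(2, ℤ)) (τ : UpperHalfPlane) : ℂ := (γ 1 0 : ℂ) * (τ : ℂ) + (γ 1 1 : ℂ)

/-- The modular slash operator `φ|_{k,M} γ`. -/
noncomputable def slashSL {n : ℕ} (k : ℤ) (M : Matrix (Fin n) (Fin n) ℚ) (φ : Dom n → ℂ)
    (γ : SL(2, ℤ)) : Dom n → ℂ := fun p =>
  (autom γ p.1) ^ (-k) * e (-(γ 1 0 : ℂ) * bil M p.2 p.2 / autom γ p.1) *
    φ (γ • p.1, fun r => p.2 r / autom γ p.1)

/-- The elliptic slash operator `φ|_M X`, where `X` has the rows `λ` and `μ`. -/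
noncomputable def slashEll {n : ℕ} (M : Matrix (Fin n) (Fin n) ℚ) (φ : Dom n → ℂ)
    (lam mu : Fin n → ℝ) : Dom n → ℂ := fun p =>
  e (bil M (fun r => (lam r : ℂ) + (mu r : ℂ)) (fun r => (lam r : ℂ) + (mu r : ℂ))) *
    e (bil M (fun r => (lam r : ℂ)) (fun r => (lam r : ℂ) * (p.1 : ℂ) + 2 * p.2 r)) *
    φ (p.1, p.2 + torsionPoint lam mu p.1)

/-- The space `Merₙ^M` of all `φ ∈ Merₙ` with `φ|_M X ∈ Merₙ` for all rational `X`. -/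
def MerIdx {n : ℕ} (M : Matrix (Fin n) (Fin n) ℚ) (φ : Dom n → ℂ) : Prop :=
  Mer φ ∧ ∀ lam mu : Fin n → ℚ, Mer (slashEll M φ (fun r => (lam r : ℝ)) (fun r => (mu r : ℝ)))

/-! ### Almost Jacobi forms and quasi-Jacobi forms -/

/-- `ν(τ) = 1 / (2i Im τ)`. -/
noncomputable def nu (τ : UpperHalfPlane) : ℂ := 1 / (2 * Complex.I * (τ.im : ℂ))

/-- `ξ(τ, z) = Im z / Im τ`. -/
noncomputable def xi (τ : UpperHalfPlane) (z : ℂ) : ℂ := ((z.im / τ.im : ℝ) : ℂ)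

/-- A finite family of functions `φ_{i,j}`, indexed by `i ∈ ℕ` and `j ∈ ℕⁿ`; the functions outside
the finite support are zero. -/
abbrev Family (n : ℕ) : Type := (ℕ × (Fin n →₀ ℕ)) →₀ (Dom n → ℂ)

/-- The function `∑ φ_{i,j} (ν / 2πi)^i ξ(z₁)^{j₁} ⋯ ξ(zₙ)^{jₙ}`. -/
noncomputable def Family.toFun {n : ℕ} (c : Family n) : Dom n → ℂ := fun p =>
  c.sum fun ij φ =>
    φ p * (nu p.1 / (2 * Real.pi * Complex.I)) ^ ij.1 * ∏ r, xi p.1 (p.2 r) ^ ij.2 r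

/-- The family `c` is the expansion of a strictly meromorphic almost Jacobi form of weight `k` and
index `M`: its coefficients lie in `Merₙ^M` and its sum is invariant under the Jacobi group
`SL₂(ℤ) ⋉ M_{n,2}(ℤ)`. -/
def IsAlmostJacobi {n : ℕ} (k : ℤ) (M : Matrix (Fin n) (Fin n) ℚ) (c : Family n) : Prop :=
  (∀ ij, MerIdx M (c ij)) ∧
  ∀ (γ : SL(2, ℤ)) (lam mu : Fin n → ℤ),
    GenEq (slashEll M (slashSL k M c.toFun γ) (fun r => (lam r : ℝ)) (fun r => (mu r : ℝ)))
      c.toFun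

/-- `c` is the expansion of an almost Jacobi form whose constant term with respect to `ν` and `ξ` is
`φ`; that is, `c` is the family `φ_{i,j}` attached to the quasi-Jacobi form `φ`. -/
def IsExpansionOf {n : ℕ} (k : ℤ) (M : Matrix (Fin n) (Fin n) ℚ) (c : Family n)
    (φ : Dom n → ℂ) : Prop :=
  IsAlmostJacobi k M c ∧ GenEq (c (0, 0)) φ

/-- `φ` is a strictly meromorphic quasi-Jacobi form of weight `k` and index `M`. -/
def IsQuasiJacobi {n : ℕ} (k : ℤ) (M : Matrix (Fin n) (Fin n) ℚ) (φ : Dom n → ℂ) : Prop :=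
  ∃ c, IsExpansionOf k M c φ

/-- `φ` is a quasi-Jacobi form and `δ_τ φ = φ_{1,0}` is equal to `ψ`. -/
def DeltaTauEq {n : ℕ} (k : ℤ) (M : Matrix (Fin n) (Fin n) ℚ) (φ ψ : Dom n → ℂ) : Prop :=
  IsQuasiJacobi k M φ ∧ ∀ c, IsExpansionOf k M c φ → GenEq (c (1, 0)) ψ

/-- `φ` is a quasi-Jacobi form and `δ_{z_r} φ = φ_{0,e_r}` is equal to `ψ`. -/
def DeltaZEq {n : ℕ} (k : ℤ) (M : Matrix (Fin n) (Fin n) ℚ) (r : Fin n) (φ ψ : Dom n → ℂ) : Prop :=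
  IsQuasiJacobi k M φ ∧ ∀ c, IsExpansionOf k M c φ → GenEq (c (0, Finsupp.single r 1)) ψ

/-! ### The Bloch–Okounkov n-point functions -/

/-- The Jacobi theta series `∑_{ν ∈ ℤ + 1/2} (-1)^⌊ν⌋ 𝐞(νz) q^{ν²/2}`, with `ν = l + 1/2`. -/
noncomputable def theta (τ : UpperHalfPlane) (z : ℂ) : ℂ :=
  ∑' l : ℤ, (-1 : ℂ) ^ l * e (((l : ℂ) + 1 / 2) * z) * e ((τ : ℂ) * (((l : ℂ) + 1 / 2) ^ 2 / 2))

/-- `θ^{(r)} = ((1 / 2πi) ∂/∂z)^r θ`. -/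
noncomputable def thetaD (r : ℕ) (τ : UpperHalfPlane) (z : ℂ) : ℂ :=
  (1 / (2 * Real.pi * Complex.I)) ^ r * iteratedDeriv r (theta τ) z

/-- The functions `Vₙ(τ, z₁, …, zₙ)`: the defining recursion solved for its last term, which is
`θ(z₁ + ⋯ + zₙ) Vₙ(z₁, …, zₙ)`. -/
noncomputable def V (τ : UpperHalfPlane) (n : ℕ) (z : Fin n → ℂ) : ℂ :=
  if n = 0 then 1 else
    -(∑ m : Fin n, (-1 : ℂ) ^ (n - (m : ℕ)) / ((n - (m : ℕ)).factorial : ℂ) *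
        thetaD (n - (m : ℕ)) τ (∑ k : Fin (m : ℕ), z (k.castLE m.isLt.le)) *
        V τ (m : ℕ) (fun k => z (k.castLE m.isLt.le))) / theta τ (∑ k, z k)
termination_by n
decreasing_by exact m.isLt

/-- The initial value `V₀ = 1`. -/
theorem V_zero (τ : UpperHalfPlane) (z : Fin 0 → ℂ) : V τ 0 z = 1 := by
  rw [V]; simp

/-- The defining recursion `∑_{m=0}^n (-1)^{n-m}/(n-m)! θ^{(n-m)}(z₁+⋯+z_m) V_m(z₁,…,z_m) = 0`. -/
theorem V_recursion (τ : UpperHalfPlane) (n : ℕ) (hn : n ≠ 0) (z : Fin n → ℂ)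
    (hz : theta τ (∑ k, z k) ≠ 0) :
    ∑ m : Fin (n + 1), (-1 : ℂ) ^ (n - (m : ℕ)) / ((n - (m : ℕ)).factorial : ℂ) *
        thetaD (n - (m : ℕ)) τ (∑ k : Fin (m : ℕ), z (k.castLE (Nat.lt_succ_iff.mp m.isLt))) *
        V τ (m : ℕ) (fun k => z (k.castLE (Nat.lt_succ_iff.mp m.isLt))) = 0 := by
  rw [Fin.sum_univ_castSucc]
  have h : V τ n z * theta τ (∑ k, z k) =
      -(∑ m : Fin n, (-1 : ℂ) ^ (n - (m : ℕ)) / ((n - (m : ℕ)).factorial : ℂ) *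
        thetaD (n - (m : ℕ)) τ (∑ k : Fin (m : ℕ), z (k.castLE m.isLt.le)) *
        V τ (m : ℕ) (fun k => z (k.castLE m.isLt.le))) := by
    rw [V, if_neg hn, div_mul_cancel₀ _ hz]
  have h2 : thetaD 0 τ (∑ k, z k) = theta τ (∑ k, z k) := by simp [thetaD]
  simp only [Fin.val_castSucc, Fin.val_last, Nat.sub_self, pow_zero, Nat.factorial_zero,
    Nat.cast_one, div_one, one_mul, Fin.castLE_rfl, id]
  rw [h2, mul_comm (theta _ _), h, add_neg_cancel]

/-- The Bloch–Okounkov `n`-point function `Fₙ(τ, z₁, …, zₙ)`. -/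
noncomputable def F (n : ℕ) : Dom n → ℂ := fun p =>
  ∑ σ : Equiv.Perm (Fin n), V p.1 n (fun k => p.2 (σ k))

/-- The index of `Fₙ`: the matrix with all entries `-1/2`, so that
`B(z, z) = -(z₁ + ⋯ + zₙ)² / 2`. -/
def indexF (n : ℕ) : Matrix (Fin n) (Fin n) ℚ := Matrix.of fun _ _ => -1 / 2

/-- From the vector `(z₀, z₁, …, z_m)` and `i ∈ {0, …, m - 1}`, the vector
`(z₀ + z_{i+1}, z₁, …, z_i, z_{i+2}, …, z_m)` of length `m`. -/
def mergeFirst {m : ℕ} (z : Fin (m + 1) → ℂ) (i : Fin m) : Fin m → ℂ := fun k =>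
  if (k : ℕ) = 0 then z 0 + z i.succ else z (i.succ.succAbove k)

/-- `∑_{i ≥ 2} F_{n-1}(z₁ + z_i, z₂, …, z_{i-1}, z_{i+1}, …, zₙ)` for `n = m + 1`. -/
noncomputable def mergedSum (m : ℕ) : Dom (m + 1) → ℂ := fun p =>
  ∑ i : Fin m, F m (p.1, mergeFirst p.2 i)

/-- `φ` is symmetric in its elliptic variables. -/
def IsSymm {n : ℕ} (φ : Dom n → ℂ) : Prop :=
  ∀ σ : Equiv.Perm (Fin n), GenEq (fun p => φ (p.1, fun k => p.2 (σ k))) φ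

end BlochOkounkov

open BlochOkounkov

/-!
Put `Z m = z₁ + ⋯ + z_m`. The recursion for `Vₙ` consists of the coefficients in `x` of
`∑ θ(Z m - x / 2πi) V_m x ^ m`, and replacing its columns by `exp (L m * x) * θ(Z m - x / 2πi)`,
with parameters `L m`, gives a deformed recursion (`deformedV`). The transformation laws of `θ`
change a column of the deformed recursion by a scalar, by the substitution of `x`, by a change of
`L m`, and by a power series in `x` that is the same for all columns. This common series drops out:
as `θ(0) = 0`, the relation of the recursion holds for `n = 0` also, so that all coefficients of the
series `∑ exp (L m * x) θ(Z m - x / 2πi) V_m x ^ m` vanish (`recSol_transform`). Hence the deformed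
solution is covariant under `SL₂(ℤ)` (`deformedV_modular`) and under lattice translations
(`deformedV_elliptic`), up to affine changes of the parameters. The choice
`L m = -(ξ(z_{σ(1)}) + ⋯ + ξ(z_{σ(m)}))` makes these changes match the transformation of `ξ`
(`slash_chainV`). Summation over `σ` then gives an invariant polynomial in the `ξ(z_r)`, free of `ν`,
with constant term `Fₙ` (`polyF`, `coeff_zero_polyF`). So `Fₙ` has an expansion with
`δ_τ Fₙ = 0`. Its coefficient of `ξ₁` comes from differentiating the recursion: a derivation acting
on the columns by multiplication with a multiple of `x` acts on the solution by omitting a column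
(`derivation_recSol`), that is, by merging two neighbouring variables (`coeff_single_polyF`).

The coefficients have to belong to `Merₙ^M`. By interpolation they are linear combinations of values
of the polynomials (`exists_coeff_eq_sum_eval`), and those values are quotients of holomorphic
functions by products of theta functions of sums of the variables. Near the points
`(τ, λ τ + μ)` such a theta function is, up to a unit, constant or a linear form, since `θ` has simple
zeros exactly at the lattice points. A product of linear forms either divides the numerator, or fails
to divide it for all `τ` outside a closed discrete set (`formProd_dvd_or_codiscrete_not_dvd`); this
is the alternative in the definition of `Merₙ`. The growth condition in the holomorphic case follows
from the maximum principle on small circles around the points, where the theta functions are bounded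
from below and the deformed recursion can be estimated
(`exists_norm_deformedV_le`, `mer_of_isThetaQuotient`).

For the uniqueness statements, `ν` and the `ξ(z_r)` are algebraically independent over the
holomorphic functions, as one sees by applying `∂/∂z̄_r` and `∂/∂τ̄`
(`coeff_eq_zero_of_eval_nuXi`). Therefore the invariance of `Φ` is an identity of polynomials, with
`ν` and `ξ_r` undergoing affine substitutions (`isInvariant_familyPoly`). An invariant family of
polynomials without constant terms vanishes: at generic `p`, the images of the origin under these
substitutions are zeros of the polynomial, and they are Zariski dense (`IsInvariant.eq_zero`). Thus
the constant term determines the family (`genEq_of_constant_term`). The partial derivatives of the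
difference of two families are again invariant, and by symmetry their constant terms are
determined by the coefficients of `ν` and `ξ₁`, which gives the last claim
(`genEq_of_linear_terms`).
-/

namespace BlochOkounkov

/-! ### Analyticity in several variables -/

lemma torusMap_mem_closedBall {n : ℕ} (c : Fin n → ℂ) {r : ℝ} (hr : 0 ≤ r) (θ : Fin n → ℝ) :
    torusMap c (fun _ => r) θ ∈ Metric.closedBall c r := by
  rw [Metric.mem_closedBall, dist_pi_le_iff hr]
  intro i
  simp [torusMap, dist_eq_norm, Complex.norm_exp_ofReal_mul_I, abs_of_nonneg hr]

lemma continuous_torusMap {n : ℕ} (c : Fin n → ℂ) (R : Fin n → ℝ) : Continuous (torusMap c R) := by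
  unfold torusMap; fun_prop

lemma torusMap_sub_ne_zero {n : ℕ} {c s : Fin n → ℂ} {r : ℝ} (hs : s ∈ Metric.ball c r)
    (θ : Fin n → ℝ) (i : Fin n) : torusMap c (fun _ => r) θ i - s i ≠ 0 := by
  intro h
  have hr : 0 < r := Metric.pos_of_mem_ball hs
  have h1 : dist (s i) (c i) < r := lt_of_le_of_lt (dist_le_pi_dist s c i) hs
  rw [← sub_eq_zero.1 h, dist_eq_norm] at h1
  simp [torusMap, Complex.norm_exp_ofReal_mul_I, abs_of_pos hr] at h1

/-- Cauchy's integral formula on a polydisc, for separately holomorphic functions. -/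
lemma torusIntegral_cauchy {r : ℝ} (hr : 0 < r) : ∀ (n : ℕ) (f : (Fin n → ℂ) → ℂ) (c : Fin n → ℂ),
    ContinuousOn f (Metric.closedBall c r) →
    (∀ x ∈ Metric.closedBall c r, ∀ i,
      DifferentiableAt ℂ (fun t => f (Function.update x i t)) (x i)) →
    ∀ s ∈ Metric.ball c r,
      (∯ x in T(c, fun _ => r), (∏ i, (x i - s i)⁻¹) * f x) =
        (2 * Real.pi * Complex.I) ^ n * f s := by
  intro n
  induction n with
  | zero =>
    intro f c _ _ s _
    rw [torusIntegral_dim0]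
    simp only [Finset.univ_eq_empty, Finset.prod_empty, one_mul, pow_zero]
    congr 1
    exact Subsingleton.elim _ _
  | succ n ih =>
    intro f c hc hd s hs
    have hint : TorusIntegrable (fun x => (∏ i, (x i - s i)⁻¹) * f x) c (fun _ => r) := by
      apply ContinuousOn.integrableOn_compact isCompact_Icc
      apply Continuous.continuousOn
      refine Continuous.mul ?_ ?_
      · refine continuous_finsetProd _ fun i _ => ?_
        refine Continuous.inv₀ ?_ fun θ => torusMap_sub_ne_zero hs θ i
        exact ((continuous_pi_iff.1 (continuous_torusMap c _)) i).sub continuous_const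
      · exact hc.comp_continuous (continuous_torusMap c _)
          fun θ => torusMap_mem_closedBall c hr.le θ
    rw [torusIntegral_succ hint]
    have hs' : (s ∘ Fin.succ) ∈ Metric.ball (c ∘ Fin.succ) r := by
      rw [Metric.mem_ball, dist_pi_lt_iff hr] at hs ⊢
      exact fun i => hs i.succ
    have hmem : ∀ x ∈ Metric.closedBall (c 0) r, ∀ y ∈ Metric.closedBall (c ∘ Fin.succ) r,
        (Fin.cons x y : Fin (n + 1) → ℂ) ∈ Metric.closedBall c r := by
      intro x hx y hy
      rw [Metric.mem_closedBall, dist_pi_le_iff hr.le] at hy ⊢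
      intro i
      refine Fin.cases ?_ (fun i => ?_) i
      · simpa using hx
      · simpa using hy i
    -- the inner integral is known by induction, the outer one is evaluated on a disc
    have inner : ∀ x ∈ Metric.sphere (c 0) r,
        (∯ y in T(c ∘ Fin.succ, (fun _ => r) ∘ Fin.succ),
          (∏ i, ((Fin.cons x y : Fin (n + 1) → ℂ) i - s i)⁻¹) * f (Fin.cons x y)) =
        (x - s 0)⁻¹ * ((2 * Real.pi * Complex.I) ^ n * f (Fin.cons x (s ∘ Fin.succ))) := by
      intro x hx
      have hx' := Metric.sphere_subset_closedBall hx
      rw [← ih (fun y => f (Fin.cons x y)) (c ∘ Fin.succ) ?_ ?_ _ hs', ← torusIntegral_const_mul]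
      · congr 1
        funext y
        rw [Fin.prod_univ_succ]
        simp [mul_assoc]
      · refine hc.comp (Continuous.continuousOn (by fun_prop)) fun y hy => hmem x hx' y hy
      · intro y hy i
        have := hd _ (hmem x hx' y hy) i.succ
        simpa [Fin.cons_update] using this
    rw [circleIntegral.integral_congr hr.le inner]
    have hs0 : s 0 ∈ Metric.ball (c 0) r := by
      rw [Metric.mem_ball, dist_pi_lt_iff hr] at hs
      exact hs 0
    have hcau := Complex.circleIntegral_sub_inv_smul_of_differentiable_on_off_countable
      (f := fun x => (2 * Real.pi * Complex.I) ^ n * f (Fin.cons x (s ∘ Fin.succ)))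
      Set.countable_empty hs0 ?_ ?_
    · simp only [smul_eq_mul] at hcau
      rw [hcau, show (Fin.cons (s 0) (s ∘ Fin.succ) : Fin (n + 1) → ℂ) = s from
        Fin.cons_self_tail s]
      ring
    · refine continuousOn_const.mul (hc.comp (Continuous.continuousOn (by fun_prop)) ?_)
      exact fun x hx => hmem x hx _ (Metric.ball_subset_closedBall hs')
    · intro x hx
      refine DifferentiableAt.const_mul ?_ _
      have := hd _ (hmem x (Metric.ball_subset_closedBall hx.1) _
        (Metric.ball_subset_closedBall hs')) 0
      simpa [Fin.update_cons_zero] using this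

/-- Integration against a continuous function on a compact space of finite measure, as a continuous
linear functional on the Banach algebra of continuous functions. -/
noncomputable def integralAgainst {X : Type*} [TopologicalSpace X] [CompactSpace X]
    [MeasurableSpace X] [BorelSpace X] (μ : MeasureTheory.Measure X)
    [MeasureTheory.IsFiniteMeasure μ] (g : C(X, ℂ)) : C(X, ℂ) →L[ℂ] ℂ :=
  LinearMap.mkContinuous
    { toFun := fun k => ∫ x, k x * g x ∂μ
      map_add' := fun k l => by
        have hint : ∀ k : C(X, ℂ), MeasureTheory.Integrable (fun x => k x * g x) μ := fun k =>
          (k.continuous.mul g.continuous).integrable_of_hasCompactSupport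
            (HasCompactSupport.of_compactSpace _)
        simp only [ContinuousMap.add_apply, add_mul]
        exact MeasureTheory.integral_add (hint k) (hint l)
      map_smul' := fun t k => by
        simp only [ContinuousMap.smul_apply, smul_eq_mul, mul_assoc, RingHom.id_apply]
        exact MeasureTheory.integral_const_mul _ _ }
    (‖g‖ * μ.real Set.univ) fun k => by
      refine (MeasureTheory.norm_integral_le_of_norm_le_const (C := ‖k‖ * ‖g‖)
        (Eventually.of_forall fun θ => ?_)).trans (le_of_eq ?_)
      · rw [norm_mul]
        gcongr
        · exact k.norm_coe_le_norm θ
        · exact g.norm_coe_le_norm θ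
      · ring

/-- Osgood's lemma on `ℂⁿ`: a continuous, separately holomorphic function is analytic. By Cauchy's
formula it is the composition of the analytic map sending `s` to the Cauchy kernel, an element of
the Banach algebra of continuous functions on the torus, with a continuous linear functional. -/
theorem analyticAt_pi_of_separately {n : ℕ} {U : Set (Fin n → ℂ)} (hU : IsOpen U)
    {f : (Fin n → ℂ) → ℂ} (hc : ContinuousOn f U)
    (hd : ∀ x ∈ U, ∀ i, DifferentiableAt ℂ (fun t => f (Function.update x i t)) (x i))
    {c : Fin n → ℂ} (hcU : c ∈ U) : AnalyticAt ℂ f c := by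
  obtain ⟨r, hr, hrU⟩ := Metric.nhds_basis_closedBall.mem_iff.1 (hU.mem_nhds hcU)
  set K := Set.Icc (0 : Fin n → ℝ) (fun _ => 2 * Real.pi)
  let μ : MeasureTheory.Measure K := MeasureTheory.Measure.comap Subtype.val MeasureTheory.volume
  have : MeasureTheory.IsFiniteMeasure μ := ⟨by
    rw [MeasureTheory.Measure.comap_apply _ Subtype.val_injective
      (fun s hs => measurableSet_Icc.subtype_image hs) _ MeasurableSet.univ]
    rw [Set.image_univ, Subtype.range_coe]
    exact isCompact_Icc.measure_lt_top⟩
  -- `a i` is the `i`-th coordinate on the torus, `g` the density of the Cauchy integral, and `κ s`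
  -- the Cauchy kernel at `s`
  let a : Fin n → C(K, ℂ) := fun i =>
    ⟨fun θ => torusMap c (fun _ => r) θ i,
      ((continuous_pi_iff.1 (continuous_torusMap c fun _ => r)) i).comp continuous_subtype_val⟩
  let g : C(K, ℂ) :=
    ⟨fun θ => (∏ i : Fin n, (r : ℂ) * Complex.exp ((θ : Fin n → ℝ) i * Complex.I) * Complex.I) *
      f (torusMap c (fun _ => r) θ), by
      refine Continuous.mul (continuous_finsetProd _ fun i _ => ?_) ?_
      · have h : Continuous fun θ : K => (θ : Fin n → ℝ) i :=
          (continuous_apply i).comp continuous_subtype_val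
        exact (continuous_const.mul (Complex.continuous_exp.comp
          ((Complex.continuous_ofReal.comp h).mul continuous_const))).mul continuous_const
      exact (hc.mono hrU).comp_continuous ((continuous_torusMap c _).comp continuous_subtype_val)
        fun θ => torusMap_mem_closedBall c hr.le θ⟩
  let κ : (Fin n → ℂ) → C(K, ℂ) := fun s =>
    ∏ i, Ring.inverse (a i - algebraMap ℂ C(K, ℂ) (s i))
  have hunit : ∀ s ∈ Metric.ball c r, ∀ i, IsUnit (a i - algebraMap ℂ C(K, ℂ) (s i)) := by
    intro s hs i
    rw [ContinuousMap.isUnit_iff_forall_ne_zero]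
    intro θ
    exact torusMap_sub_ne_zero hs θ i
  have hκ : AnalyticAt ℂ κ c := by
    refine Finset.analyticAt_fun_prod _ fun i _ => ?_
    obtain ⟨u, hu⟩ := hunit c (Metric.mem_ball_self hr) i
    have h1 : AnalyticAt ℂ (fun s : Fin n → ℂ => a i - algebraMap ℂ C(K, ℂ) (s i)) c := by
      refine analyticAt_const.sub ?_
      exact ((Algebra.linearMap ℂ C(K, ℂ)).toContinuousLinearMap.comp
        (ContinuousLinearMap.proj (R := ℂ) (φ := fun _ : Fin n => ℂ) i)).analyticAt c
    exact AnalyticAt.fun_comp (by rw [← hu]; exact analyticAt_inverse u) h1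
  have key : f =ᶠ[𝓝 c] fun s => ((2 * Real.pi * Complex.I) ^ n)⁻¹ * integralAgainst μ g (κ s) := by
    filter_upwards [Metric.ball_mem_nhds c hr] with s hs
    have hne : ((2 * Real.pi * Complex.I : ℂ) ^ n) ≠ 0 :=
      pow_ne_zero _ (by simp [Real.pi_ne_zero])
    rw [eq_inv_mul_iff_mul_eq₀ hne, ← torusIntegral_cauchy hr n f c (hc.mono hrU)
      (fun x hx => hd x (hrU hx)) s hs, torusIntegral,
      ← MeasureTheory.integral_subtype_comap measurableSet_Icc]
    change _ = ∫ θ, κ s θ * g θ ∂μ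
    congr 1
    funext θ
    have hκθ : κ s θ = ∏ i, (torusMap c (fun _ => r) θ i - s i)⁻¹ := by
      simp only [κ, ContinuousMap.prod_apply]
      refine Finset.prod_congr rfl fun i _ => ?_
      have h2 := Ring.mul_inverse_cancel _ (hunit s hs i)
      have h3 := congrArg (fun k : C(K, ℂ) => k θ) h2
      simp only [ContinuousMap.mul_apply, ContinuousMap.one_apply] at h3
      exact eq_inv_of_mul_eq_one_right h3
    rw [hκθ]
    simp only [g, ContinuousMap.coe_mk, smul_eq_mul]
    ring
  refine AnalyticAt.congr ?_ key.symm
  exact analyticAt_const.mul (((integralAgainst μ g).analyticAt _).comp hκ)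

/-- Osgood's lemma on `ℂ × ℂⁿ`: a continuous function that is holomorphic along complex lines is
analytic. -/
theorem analyticAt_of_lines {n : ℕ} {U : Set (ℂ × (Fin n → ℂ))} (hU : IsOpen U)
    {f : ℂ × (Fin n → ℂ) → ℂ} (hc : ContinuousOn f U)
    (hd : ∀ x ∈ U, ∀ v : ℂ × (Fin n → ℂ), DifferentiableAt ℂ (fun t : ℂ => f (x + t • v)) 0)
    {p : ℂ × (Fin n → ℂ)} (hp : p ∈ U) : AnalyticAt ℂ f p := by
  let E := Fin.consLinearEquiv ℂ (fun _ : Fin (n + 1) => ℂ)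
  let T : (ℂ × (Fin n → ℂ)) ≃L[ℂ] (Fin (n + 1) → ℂ) := E.toContinuousLinearEquiv
  have h1 : AnalyticAt ℂ (fun y => f (T.symm y)) (T p) := by
    refine analyticAt_pi_of_separately (U := T.symm ⁻¹' U) (hU.preimage T.symm.continuous) ?_ ?_
      (by simpa using hp)
    · exact hc.comp T.symm.continuous.continuousOn fun y hy => hy
    · intro y hy i
      have h2 := hd _ hy (T.symm (Pi.single i 1))
      have h3 : (fun t => f (T.symm (Function.update y i t))) =
          (fun t : ℂ => f (T.symm y + t • T.symm (Pi.single i 1))) ∘ fun t => t - y i := by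
        funext t
        simp only [Function.comp_apply]
        rw [← map_smul, ← map_add]
        congr 2
        funext k
        by_cases hk : k = i
        · subst hk; simp
        · simp [hk]
      rw [h3]
      refine DifferentiableAt.comp _ ?_ (by fun_prop)
      simpa using h2
  have h4 := h1.comp (T.toContinuousLinearMap.analyticAt p)
  refine h4.congr (Eventually.of_forall fun x => ?_)
  simp

/-- The region `𝔥 × ℂⁿ` as a subset of `ℂ × ℂⁿ`. -/
def upper (n : ℕ) : Set (ℂ × (Fin n → ℂ)) := {x | 0 < x.1.im}

lemma isOpen_upper (n : ℕ) : IsOpen (upper n) :=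
  isOpen_lt continuous_const (Complex.continuous_im.comp continuous_fst)

lemma isPreconnected_upper (n : ℕ) : IsPreconnected (upper n) := by
  have h : upper n = {z : ℂ | 0 < z.im} ×ˢ Set.univ := by
    ext x; simp [upper]
  rw [h]
  exact ((convex_halfSpace_im_gt 0).prod convex_univ).isPreconnected

lemma incl_mem_upper {n : ℕ} (p : Dom n) : p.incl ∈ upper n := p.1.im_pos

lemma isOpenEmbedding_incl {n : ℕ} : IsOpenEmbedding (Dom.incl : Dom n → ℂ × (Fin n → ℂ)) :=
  UpperHalfPlane.isOpenEmbedding_coe.prodMap IsOpenEmbedding.id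

lemma continuous_incl {n : ℕ} : Continuous (Dom.incl : Dom n → ℂ × (Fin n → ℂ)) :=
  isOpenEmbedding_incl.continuous

lemma eventually_nhds_incl {n : ℕ} {p : Dom n} {P : ℂ × (Fin n → ℂ) → Prop} :
    (∀ᶠ x in 𝓝 p, P (Dom.incl x)) ↔ ∀ᶠ x in 𝓝 p.incl, P x := by
  rw [← isOpenEmbedding_incl.map_nhds_eq, eventually_map]

/-- Identity theorem on `𝔥 × ℂⁿ`. -/
lemma eq_zero_of_eventually_zero {n : ℕ} {f : ℂ × (Fin n → ℂ) → ℂ}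
    (hf : AnalyticOnNhd ℂ f (upper n)) {p : ℂ × (Fin n → ℂ)} (hp : p ∈ upper n)
    (h : ∀ᶠ x in 𝓝 p, f x = 0) {x : ℂ × (Fin n → ℂ)} (hx : x ∈ upper n) : f x = 0 :=
  hf.eqOn_zero_of_preconnected_of_eventuallyEq_zero (isPreconnected_upper n) hp h hx

lemma isOpen_ne_zero {n : ℕ} {f : ℂ × (Fin n → ℂ) → ℂ} (hf : AnalyticOnNhd ℂ f (upper n)) :
    IsOpen {p : Dom n | f p.incl ≠ 0} := by
  have h : Continuous fun p : Dom n => f p.incl :=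
    hf.continuousOn.comp_continuous continuous_incl incl_mem_upper
  exact isOpen_ne.preimage h

lemma dense_ne_zero {n : ℕ} {f : ℂ × (Fin n → ℂ) → ℂ} (hf : AnalyticOnNhd ℂ f (upper n))
    (h : ∃ p ∈ upper n, f p ≠ 0) : Dense {p : Dom n | f p.incl ≠ 0} := by
  obtain ⟨q, hq, hq0⟩ := h
  rw [← interior_eq_empty_iff_dense_compl.trans (Iff.of_eq (congrArg Dense (compl_compl _)))]
  by_contra hne
  obtain ⟨p, hp⟩ := Set.nonempty_iff_ne_empty.2 hne
  refine hq0 (eq_zero_of_eventually_zero hf (incl_mem_upper p) ?_ hq)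
  rw [← eventually_nhds_incl]
  filter_upwards [mem_interior_iff_mem_nhds.1 hp] with x hx
  simpa using hx

/-- A function that is analytic on an open set and vanishes on the hyperplane `L = 0` is divisible
by `L`, with analytic quotient. -/
theorem exists_eq_mul_of_vanishing {n : ℕ} {U : Set (ℂ × (Fin n → ℂ))} (hU : IsOpen U)
    {f : ℂ × (Fin n → ℂ) → ℂ} (hf : AnalyticOnNhd ℂ f U) (L : ℂ × (Fin n → ℂ) →L[ℂ] ℂ)
    (hL : L ≠ 0) (h0 : ∀ x ∈ U, L x = 0 → f x = 0) :
    ∃ H : ℂ × (Fin n → ℂ) → ℂ, AnalyticOnNhd ℂ H U ∧ ∀ x ∈ U, f x = L x * H x := by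
  classical
  obtain ⟨v, hv⟩ : ∃ v, L v = 1 := by
    obtain ⟨w, hw⟩ := DFunLike.ne_iff.1 hL
    refine ⟨(L w)⁻¹ • w, ?_⟩
    have hw' : L w ≠ 0 := hw
    simp [hw']
  -- on the hyperplane the quotient is continued by the derivative of `f` in the direction `v`
  let H : ℂ × (Fin n → ℂ) → ℂ := fun x => if L x = 0 then fderiv ℂ f x v else f x / L x
  have hfd : AnalyticOnNhd ℂ (fun x => fderiv ℂ f x v) U := fun x hx =>
    ((ContinuousLinearMap.apply ℂ ℂ v).analyticAt _).comp (hf x hx).fderiv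
  have hopen : ∀ x, L x ≠ 0 → ∀ᶠ y in 𝓝 x, L y ≠ 0 := fun x hx =>
    L.continuous.continuousAt.eventually_ne hx
  have hHne : ∀ x ∈ U, L x ≠ 0 → AnalyticAt ℂ H x := by
    intro x hx hx0
    refine ((hf x hx).div (L.analyticAt x) hx0).congr ?_
    filter_upwards [hopen x hx0] with y hy
    simp [H, hy]
  have hcont : ContinuousOn H U := by
    intro x hx
    refine ContinuousAt.continuousWithinAt ?_
    by_cases hx0 : L x = 0
    · have hHx : H x = fderiv ℂ f x v := by simp [H, hx0]
      -- compare `y` with its projection `y - L y • v` to the hyperplane, where `f` vanishes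
      have hs := (hf x hx).hasStrictFDerivAt
      have hpair : Tendsto (fun y => (y, y - L y • v)) (𝓝 x) (𝓝 (x, x)) := by
        have : Continuous fun y => (y, y - L y • v) := by fun_prop
        simpa [hx0] using this.tendsto x
      rw [Metric.continuousAt_iff']
      intro ε hε
      obtain ⟨δ, hδ, hδε⟩ : ∃ δ > 0, δ * ‖v‖ < ε :=
        ⟨ε / (‖v‖ + 1), by positivity, by
          rw [div_mul_eq_mul_div, div_lt_iff₀ (by positivity)]; nlinarith [norm_nonneg v]⟩
      have h1 := hpair.eventually (hs.isLittleO.def hδ)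
      have h2 : ∀ᶠ y in 𝓝 x, y - L y • v ∈ U := by
        have := (continuous_snd.tendsto (x, x)).comp hpair
        exact this.eventually (hU.mem_nhds hx)
      have h3 : ∀ᶠ y in 𝓝 x, dist (fderiv ℂ f y v) (fderiv ℂ f x v) < ε :=
        Metric.continuousAt_iff'.1 (hfd x hx).continuousAt ε hε
      filter_upwards [h1, h2, h3] with y hy1 hy2 hy3
      rw [hHx]
      by_cases hy : L y = 0
      · simpa [H, hy] using hy3
      · have hz : f (y - L y • v) = 0 := h0 _ hy2 (by simp [hv])
        simp only [hz, sub_zero, sub_sub_cancel, map_smul, smul_eq_mul, norm_smul] at hy1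
        have hLy : 0 < ‖L y‖ := norm_pos_iff.2 hy
        have h4 : H y - fderiv ℂ f x v = (f y - L y * fderiv ℂ f x v) / L y := by
          simp only [H, hy, if_false]; field_simp
        rw [dist_eq_norm, h4, norm_div, div_lt_iff₀ hLy]
        calc _ ≤ δ * (‖L y‖ * ‖v‖) := hy1
          _ = δ * ‖v‖ * ‖L y‖ := by ring
          _ < ε * ‖L y‖ := by gcongr
    · exact (hHne x hx hx0).continuousAt
  refine ⟨H, fun x hx => analyticAt_of_lines hU hcont ?_ hx, ?_⟩
  · intro x hx w
    have hline : Tendsto (fun t : ℂ => x + t • w) (𝓝 0) (𝓝 x) := by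
      have : Continuous fun t : ℂ => x + t • w := by fun_prop
      simpa using this.tendsto 0
    have hlU : ∀ᶠ t in 𝓝 (0 : ℂ), x + t • w ∈ U := hline.eventually (hU.mem_nhds hx)
    have hla : ∀ t : ℂ, DifferentiableAt ℂ (fun t : ℂ => x + t • w) t := by
      intro t; fun_prop
    by_cases hx0 : L x = 0
    · by_cases hw : L w = 0
      -- the line stays in the hyperplane, where `H` is a derivative of `f`
      · have h1 : DifferentiableAt ℂ (fun t : ℂ => fderiv ℂ f (x + t • w) v) 0 := by
          refine DifferentiableAt.comp (g := fun y => fderiv ℂ f y v) 0 ?_ (hla 0)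
          simpa using (hfd x hx).differentiableAt
        refine h1.congr_of_eventuallyEq (Eventually.of_forall fun t => ?_)
        simp [H, hx0, hw]
      -- the line meets the hyperplane only at `x`: a removable singularity
      · obtain ⟨s, hs, hsU⟩ := Filter.eventually_iff_exists_mem.1 hlU
        have hdiff := (Complex.differentiableOn_compl_singleton_and_continuousAt_iff
          (f := fun t : ℂ => H (x + t • w)) hs).1 ⟨?_, ?_⟩
        · exact hdiff.differentiableAt hs
        · intro t ht
          refine DifferentiableAt.differentiableWithinAt ?_
          refine DifferentiableAt.comp t (hHne _ (hsU t ht.1) ?_).differentiableAt (hla t)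
          have ht0 : t ≠ 0 := ht.2
          simp [hx0, hw, ht0]
        · refine ContinuousAt.comp (g := H) ?_ (hla 0).continuousAt
          simpa using hcont.continuousAt (hU.mem_nhds hx)
    · refine DifferentiableAt.comp (g := H) 0 ?_ (hla 0)
      simpa using (hHne x hx hx0).differentiableAt
  · intro x hx
    by_cases hx0 : L x = 0
    · simp [hx0, h0 x hx hx0]
    · simp only [H, hx0, if_false]; field_simp

/-! ### The theta function: analyticity and transformation laws -/

lemma e_add (x y : ℂ) : e (x + y) = e x * e y := by
  simp [e, mul_add, Complex.exp_add]

lemma e_ne_zero (x : ℂ) : e x ≠ 0 := Complex.exp_ne_zero _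

@[simp] lemma e_zero : e 0 = 1 := by simp [e]

lemma e_neg (x : ℂ) : e (-x) = (e x)⁻¹ := by simp [e, Complex.exp_neg]

lemma e_int (k : ℤ) : e k = 1 := by
  rw [e, mul_comm]; exact Complex.exp_int_mul_two_pi_mul_I k

lemma e_half_int (k : ℤ) : e ((k : ℂ) / 2) = (-1) ^ k := by
  have : (2 * Real.pi * Complex.I * ((k : ℂ) / 2)) = k * (Real.pi * Complex.I) := by ring
  rw [e, this, Complex.exp_int_mul, Complex.exp_pi_mul_I]

lemma norm_e (x : ℂ) : ‖e x‖ = Real.exp (-(2 * Real.pi * x.im)) := by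
  rw [e, Complex.norm_exp]
  congr 1
  simp [Complex.mul_re, Complex.mul_im]

lemma analyticAt_e (x : ℂ) : AnalyticAt ℂ e x := by
  unfold e; fun_prop

lemma AnalyticAt.e_comp {E : Type*} [NormedAddCommGroup E] [NormedSpace ℂ E] {f : E → ℂ} {x : E}
    (hf : AnalyticAt ℂ f x) : AnalyticAt ℂ (fun y => e (f y)) x :=
  (analyticAt_e _).comp hf

/-- The theta series as a function of `τ ∈ ℂ`, written through Mathlib's Jacobi theta function. -/
noncomputable def thetaC (τ z : ℂ) : ℂ :=
  e (z / 2 + τ / 8) * jacobiTheta₂ (z + 1 / 2 + τ / 2) τ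

lemma theta_term_eq (τ z : ℂ) (l : ℤ) :
    (-1 : ℂ) ^ l * e (((l : ℂ) + 1 / 2) * z) * e (τ * (((l : ℂ) + 1 / 2) ^ 2 / 2)) =
      e (z / 2 + τ / 8) * jacobiTheta₂_term l (z + 1 / 2 + τ / 2) τ := by
  have h : jacobiTheta₂_term l (z + 1 / 2 + τ / 2) τ =
      e ((l : ℂ) / 2 + (l * z + l * τ / 2 + l ^ 2 * τ / 2)) := by
    rw [jacobiTheta₂_term, e]; congr 1; ring
  rw [h, ← e_half_int, ← e_add, ← e_add, ← e_add]
  congr 1; ring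

lemma theta_eq_thetaC (τ : UpperHalfPlane) (z : ℂ) : theta τ z = thetaC τ z := by
  rw [theta, thetaC, jacobiTheta₂, ← tsum_mul_left]
  exact tsum_congr fun l => theta_term_eq τ z l

lemma hasSum_theta (τ : UpperHalfPlane) (z : ℂ) :
    HasSum (fun l : ℤ => (-1 : ℂ) ^ l * e (((l : ℂ) + 1 / 2) * z) *
      e ((τ : ℂ) * (((l : ℂ) + 1 / 2) ^ 2 / 2))) (theta τ z) := by
  rw [theta_eq_thetaC]
  simp only [theta_term_eq]
  exact (hasSum_jacobiTheta₂_term _ τ.im_pos).mul_left _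

lemma differentiableAt_thetaC {x : ℂ × (Fin 1 → ℂ)} (hx : x ∈ upper 1) :
    DifferentiableAt ℂ (fun x : ℂ × (Fin 1 → ℂ) => thetaC x.1 (x.2 0)) x := by
  have h0 : DifferentiableAt ℂ (fun x : ℂ × (Fin 1 → ℂ) => x.2 0 / 2 + x.1 / 8) x := by fun_prop
  have h1 := (hasFDerivAt_jacobiTheta₂ (x.2 0 + 1 / 2 + x.1 / 2) hx).differentiableAt
  have h2 : DifferentiableAt ℂ
      (fun x : ℂ × (Fin 1 → ℂ) => (x.2 0 + 1 / 2 + x.1 / 2, x.1)) x := by fun_prop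
  have h3 : DifferentiableAt ℂ (fun x : ℂ × (Fin 1 → ℂ) => e (x.2 0 / 2 + x.1 / 8)) x :=
    DifferentiableAt.comp (g := e) x (analyticAt_e _).differentiableAt h0
  have h4 : DifferentiableAt ℂ
      (fun x : ℂ × (Fin 1 → ℂ) => jacobiTheta₂ (x.2 0 + 1 / 2 + x.1 / 2) x.1) x :=
    DifferentiableAt.comp (g := fun p : ℂ × ℂ => jacobiTheta₂ p.1 p.2) x h1 h2
  exact h3.mul h4

/-- Joint analyticity follows from complex differentiability by Osgood's lemma. -/
lemma analyticAt_thetaC {τ : ℂ} (hτ : 0 < τ.im) (z : ℂ) :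
    AnalyticAt ℂ (fun x : ℂ × ℂ => thetaC x.1 x.2) (τ, z) := by
  let F : ℂ × (Fin 1 → ℂ) → ℂ := fun x => thetaC x.1 (x.2 0)
  have hF : ∀ x ∈ upper 1, DifferentiableAt ℂ F x := fun x hx => differentiableAt_thetaC hx
  have hlines : ∀ x ∈ upper 1, ∀ v : ℂ × (Fin 1 → ℂ),
      DifferentiableAt ℂ (fun t : ℂ => F (x + t • v)) 0 := by
    intro x hx v
    have h2 : DifferentiableAt ℂ (fun t : ℂ => x + t • v) 0 := by fun_prop
    have h1 : DifferentiableAt ℂ F (x + (0 : ℂ) • v) := by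
      rw [zero_smul, add_zero]; exact hF x hx
    exact DifferentiableAt.comp (g := F) 0 h1 h2
  have hmem : ((τ, fun _ => z) : ℂ × (Fin 1 → ℂ)) ∈ upper 1 := hτ
  have h : AnalyticAt ℂ F (τ, fun _ => z) := analyticAt_of_lines (isOpen_upper 1)
    (fun x hx => (hF x hx).continuousAt.continuousWithinAt) hlines hmem
  let S : ℂ × ℂ →L[ℂ] ℂ × (Fin 1 → ℂ) := (ContinuousLinearMap.fst ℂ ℂ ℂ).prod
      (ContinuousLinearMap.pi fun _ : Fin 1 => ContinuousLinearMap.snd ℂ ℂ ℂ)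
  have hS : S (τ, z) = (τ, fun _ => z) := rfl
  have h3 : AnalyticAt ℂ S (τ, z) := S.analyticAt (τ, z)
  rw [← hS] at h
  exact h.comp h3

/-- The normalized derivatives of `thetaC` in the elliptic variable. -/
noncomputable def thetaCD (r : ℕ) (τ z : ℂ) : ℂ :=
  (1 / (2 * Real.pi * Complex.I)) ^ r * iteratedDeriv r (thetaC τ) z

lemma thetaD_eq_thetaCD (r : ℕ) (τ : UpperHalfPlane) (z : ℂ) : thetaD r τ z = thetaCD r τ z := by
  have : theta τ = thetaC τ := funext (theta_eq_thetaC τ)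
  rw [thetaD, thetaCD, this]

lemma analyticAt_thetaCD (r : ℕ) {τ : ℂ} (hτ : 0 < τ.im) (z : ℂ) :
    AnalyticAt ℂ (fun x : ℂ × ℂ => thetaCD r x.1 x.2) (τ, z) := by
  refine analyticAt_const.mul ?_
  induction r generalizing τ z with
  | zero => simpa using analyticAt_thetaC hτ z
  | succ r ih =>
    have h1 : AnalyticAt ℂ (fun x : ℂ × ℂ =>
        fderiv ℂ (fun x : ℂ × ℂ => iteratedDeriv r (thetaC x.1) x.2) x (0, 1)) (τ, z) :=
      ((ContinuousLinearMap.apply ℂ ℂ ((0, 1) : ℂ × ℂ)).analyticAt _).comp (ih hτ z).fderiv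
    refine h1.congr ?_
    have hop : ∀ᶠ x : ℂ × ℂ in 𝓝 (τ, z), 0 < x.1.im :=
      (Complex.continuous_im.comp continuous_fst).continuousAt.eventually (lt_mem_nhds hτ)
    filter_upwards [hop] with x hx
    rw [iteratedDeriv_succ]
    have h2 := (ih hx x.2).differentiableAt.hasFDerivAt
    have h3 : HasDerivAt (fun w : ℂ => (x.1, w)) ((0 : ℂ), (1 : ℂ)) x.2 :=
      (hasDerivAt_const _ _).prodMk (hasDerivAt_id _)
    exact (h2.comp_hasDerivAt x.2 h3).deriv.symm

lemma differentiable_theta (τ : UpperHalfPlane) : Differentiable ℂ (theta τ) := by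
  intro z
  have h : theta τ = thetaC τ := funext (theta_eq_thetaC τ)
  rw [h]
  have h3 : DifferentiableAt ℂ (fun w : ℂ => ((τ : ℂ), w)) z := by fun_prop
  exact (analyticAt_thetaC τ.im_pos z).differentiableAt.comp z h3

lemma theta_add_lattice (τ : UpperHalfPlane) (z : ℂ) (m n : ℤ) :
    theta τ (z + (m * τ + n)) = (-1) ^ (m + n) * e (-(m : ℂ) ^ 2 * τ / 2 - m * z) * theta τ z := by
  rw [theta, theta, ← tsum_mul_left]
  conv_rhs => rw [← (Equiv.addRight m).tsum_eq]
  refine tsum_congr fun l => ?_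
  simp only [Equiv.coe_addRight, Int.cast_add]
  have h1 : e (((l : ℂ) + 1 / 2) * (z + (m * τ + n))) =
      e (((l : ℂ) + 1 / 2) * (z + m * τ)) * (-1) ^ n := by
    rw [← e_half_int, show ((l : ℂ) + 1 / 2) * (z + (m * τ + n)) =
      ((l : ℂ) + 1 / 2) * (z + m * τ) + (n : ℂ) / 2 + ((l * n : ℤ) : ℂ) by push_cast; ring, e_add, e_int,
      mul_one, e_add]
  have h2 : (-1 : ℂ) ^ (m + n) * (-1) ^ (l + m) = (-1) ^ l * (-1) ^ n := by
    have h0 : (-1 : ℂ) ^ m * (-1) ^ m = 1 := by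
      rw [← mul_zpow]; norm_num
    rw [zpow_add₀ (by norm_num), zpow_add₀ (by norm_num)]
    linear_combination (-1 : ℂ) ^ n * (-1 : ℂ) ^ l * h0
  have h3 : e (-(m : ℂ) ^ 2 * τ / 2 - m * z) * (e (((l : ℂ) + m + 1 / 2) * z) *
      e (τ * (((l : ℂ) + m + 1 / 2) ^ 2 / 2))) =
      e (((l : ℂ) + 1 / 2) * (z + m * τ)) * e (τ * (((l : ℂ) + 1 / 2) ^ 2 / 2)) := by
    simp only [← e_add]
    congr 1; ring
  rw [h1]
  linear_combination ((-1 : ℂ) ^ (m + n) * (-1) ^ (l + m)) * (-h3) -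
    e (((l : ℂ) + 1 / 2) * (z + m * τ)) * e (τ * (((l : ℂ) + 1 / 2) ^ 2 / 2)) * h2

lemma theta_neg (τ : UpperHalfPlane) (z : ℂ) : theta τ (-z) = -theta τ z := by
  rw [theta, theta, ← tsum_neg, ← ((Equiv.neg ℤ).trans (Equiv.subRight 1)).tsum_eq]
  refine tsum_congr fun l => ?_
  simp only [Equiv.trans_apply, Equiv.neg_apply, Equiv.subRight_apply]
  rw [zpow_sub_one₀ (by norm_num), zpow_neg]
  have : ((-1 : ℂ) ^ l)⁻¹ = (-1) ^ l := by
    rw [← inv_zpow]; norm_num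
  rw [this]
  push_cast
  rw [show (-(l : ℂ) - 1 + 1 / 2) * -z = (l + 1 / 2) * z by ring,
    show (-(l : ℂ) - 1 + 1 / 2) ^ 2 = (l + 1 / 2) ^ 2 by ring]
  ring

@[simp] lemma theta_zero (τ : UpperHalfPlane) : theta τ 0 = 0 := by
  have h := theta_neg τ 0
  rw [neg_zero] at h
  exact self_eq_neg.1 h

lemma coe_smul_eq (γ : SL(2, ℤ)) (τ : UpperHalfPlane) :
    ((γ • τ : UpperHalfPlane) : ℂ) = ((γ 0 0 : ℂ) * τ + (γ 0 1 : ℂ)) / autom γ τ := by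
  rw [UpperHalfPlane.coe_specialLinearGroup_apply]
  simp [autom]

lemma autom_ne_zero (γ : SL(2, ℤ)) (τ : UpperHalfPlane) : autom γ τ ≠ 0 := by
  have h := UpperHalfPlane.denom_ne_zero (γ : GL (Fin 2) ℝ) τ
  rw [ModularGroup.denom_apply] at h
  simpa [autom] using h

lemma det_eq_one (γ : SL(2, ℤ)) :
    (γ 0 0 : ℂ) * (γ 1 1 : ℂ) - (γ 0 1 : ℂ) * (γ 1 0 : ℂ) = 1 := by
  have h := γ.det_coe
  rw [Matrix.det_fin_two] at h
  exact_mod_cast h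

lemma autom_mul (γ γ' : SL(2, ℤ)) (τ : UpperHalfPlane) :
    autom (γ * γ') τ = autom γ (γ' • τ) * autom γ' τ := by
  have h := autom_ne_zero γ' τ
  rw [autom, autom, coe_smul_eq]
  simp only [Matrix.SpecialLinearGroup.coe_mul, Matrix.mul_apply, Fin.sum_univ_two]
  field_simp
  simp only [autom]
  push_cast
  ring

/-- The modular transformation law of the theta function, with an unspecified multiplier that is
independent of the elliptic variable. It is checked on generators; for `S` it is the functional
equation of Mathlib's Jacobi theta function. -/
theorem theta_modular (γ : SL(2, ℤ)) : ∀ τ : UpperHalfPlane, ∃ A : ℂ, A ≠ 0 ∧ ∀ z : ℂ,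
    theta (γ • τ) (z / autom γ τ) =
      A * e ((γ 1 0 : ℂ) * z ^ 2 / (2 * autom γ τ)) * theta τ z := by
  have hmem : γ ∈ Subgroup.closure {ModularGroup.S, ModularGroup.T} := by
    rw [SpecialLinearGroup.SL2Z_generators]; exact Subgroup.mem_top γ
  induction hmem using Subgroup.closure_induction with
  | mem γ hγ =>
    intro τ
    rcases hγ with rfl | rfl
    · have hτ : (τ : ℂ) ≠ 0 := τ.ne_zero
      have hJ : autom ModularGroup.S τ = τ := by simp [autom, ModularGroup.S]
      have hc : (ModularGroup.S 1 0 : ℂ) = 1 := by simp [ModularGroup.S]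
      have hsm : ((ModularGroup.S • τ : UpperHalfPlane) : ℂ) = -1 / τ := by
        rw [UpperHalfPlane.modular_S_smul]
        simp [neg_div, inv_neg]
      have hs : (-Complex.I * (τ : ℂ)) ^ (1 / 2 : ℂ) ≠ 0 := by
        rw [Ne, Complex.cpow_eq_zero_iff]; simp [hτ]
      refine ⟨(-Complex.I * (τ : ℂ)) ^ (1 / 2 : ℂ) * e (-1 / 4), mul_ne_zero hs (e_ne_zero _),
        fun z => ?_⟩
      rw [hJ, hc, theta_eq_thetaC, theta_eq_thetaC, hsm, thetaC, thetaC]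
      have h1 := jacobiTheta₂_functional_equation (z + τ / 2 - 1 / 2) τ
      have h2 := jacobiTheta₂_add_left (z + τ / 2 - 1 / 2) τ
      have h3 : Complex.exp (-Real.pi * Complex.I * (z + τ / 2 - 1 / 2) ^ 2 / τ) =
          (e ((z + τ / 2 - 1 / 2) ^ 2 / (2 * τ)))⁻¹ := by
        rw [← e_neg, e]; congr 1; field_simp
      have h4 : (z + τ / 2 - 1 / 2) / τ = z / τ + 1 / 2 + -1 / τ / 2 := by field_simp; ring
      rw [show z + τ / 2 - 1 / 2 + 1 = z + 1 / 2 + τ / 2 by ring] at h2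
      rw [h2, h1, h3, h4]
      have h5 : e (z / τ / 2 + -1 / τ / 8) * e ((z + τ / 2 - 1 / 2) ^ 2 / (2 * τ)) =
          e (-1 / 4) * e (1 * z ^ 2 / (2 * τ)) * e (z / 2 + τ / 8) := by
        simp only [← e_add]; congr 1; field_simp; ring
      have h6 := e_ne_zero ((z + τ / 2 - 1 / 2) ^ 2 / (2 * τ))
      generalize e ((z + τ / 2 - 1 / 2) ^ 2 / (2 * τ)) = E₁ at h5 h6 ⊢
      generalize e (z / τ / 2 + -1 / τ / 8) = E₂ at h5 ⊢
      generalize e (1 * z ^ 2 / (2 * τ)) = E₃ at h5 ⊢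
      generalize e (z / 2 + τ / 8) = E₄ at h5 ⊢
      generalize e (-1 / 4) = E₅ at h5 ⊢
      generalize (-Complex.I * (τ : ℂ)) ^ (1 / 2 : ℂ) = s at hs ⊢
      generalize jacobiTheta₂ (z / τ + 1 / 2 + -1 / τ / 2) (-1 / τ) = Θ
      field_simp
      linear_combination Θ * h5
    · have hJ : autom ModularGroup.T τ = 1 := by simp [autom, ModularGroup.T]
      have hc : (ModularGroup.T 1 0 : ℂ) = 0 := by simp [ModularGroup.T]
      have hsm : ((ModularGroup.T • τ : UpperHalfPlane) : ℂ) = 1 + τ := by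
        rw [UpperHalfPlane.modular_T_smul]; simp
      refine ⟨e (1 / 8), e_ne_zero _, fun z => ?_⟩
      rw [hJ, hc, theta, theta, hsm, ← tsum_mul_left]
      refine tsum_congr fun l => ?_
      obtain ⟨k, hk⟩ := Int.even_mul_succ_self l
      have hk' : (l : ℂ) * (l + 1) = k + k := by exact_mod_cast hk
      have h1 : e ((1 + (τ : ℂ)) * (((l : ℂ) + 1 / 2) ^ 2 / 2)) =
          e (1 / 8) * e ((τ : ℂ) * (((l : ℂ) + 1 / 2) ^ 2 / 2)) := by
        rw [show (1 + (τ : ℂ)) * (((l : ℂ) + 1 / 2) ^ 2 / 2) =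
          1 / 8 + (τ : ℂ) * (((l : ℂ) + 1 / 2) ^ 2 / 2) + k by linear_combination hk' / 2,
          e_add, e_int, mul_one, e_add]
      rw [h1]
      simp
      ring
  | one =>
    intro τ
    refine ⟨1, one_ne_zero, fun z => ?_⟩
    simp [autom]
  | mul γ γ' _ _ ih ih' =>
    intro τ
    obtain ⟨A, hA, h⟩ := ih (γ' • τ)
    obtain ⟨A', hA', h'⟩ := ih' τ
    refine ⟨A * A', mul_ne_zero hA hA', fun z => ?_⟩
    have hJ := autom_ne_zero γ (γ' • τ)
    have hJ' := autom_ne_zero γ' τ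
    rw [mul_smul, autom_mul, mul_comm (autom γ _), ← div_div, h, h', mul_assoc, mul_assoc,
      mul_left_comm (e _), ← mul_assoc (e _), ← e_add, mul_assoc, mul_assoc]
    congr 4
    have hc : (((γ * γ') 1 0 : ℤ) : ℂ) * autom γ' τ =
        (γ' 1 0 : ℂ) * autom γ (γ' • τ) * autom γ' τ + (γ 1 0 : ℂ) := by
      rw [mul_assoc (γ' 1 0 : ℂ), ← autom_mul]
      have hdet := det_eq_one γ'
      simp only [autom, Matrix.SpecialLinearGroup.coe_mul, Matrix.mul_apply, Fin.sum_univ_two]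
      push_cast
      linear_combination (γ 1 0 : ℂ) * hdet
    field_simp
    linear_combination (-z ^ 2) * hc
  | inv γ _ ih =>
    intro τ
    obtain ⟨A, hA, h⟩ := ih (γ⁻¹ • τ)
    refine ⟨A⁻¹, inv_ne_zero hA, fun z => ?_⟩
    have hJJ : autom γ (γ⁻¹ • τ) * autom γ⁻¹ τ = 1 := by
      rw [← autom_mul, mul_inv_cancel]; simp [autom]
    have hJ := autom_ne_zero γ⁻¹ τ
    have h1 := h (z / autom γ⁻¹ τ)
    rw [smul_inv_smul, div_div, mul_comm (autom γ⁻¹ τ), hJJ, div_one] at h1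
    rw [h1]
    have h2 : e (((γ⁻¹ : SL(2, ℤ)) 1 0 : ℂ) * z ^ 2 / (2 * autom γ⁻¹ τ)) =
        (e ((γ 1 0 : ℂ) * (z / autom γ⁻¹ τ) ^ 2 / (2 * autom γ (γ⁻¹ • τ))))⁻¹ := by
      rw [← e_neg]
      congr 1
      have h3 : (((γ⁻¹ : SL(2, ℤ)) 1 0 : ℤ) : ℂ) = -(γ 1 0 : ℂ) := by
        simp [Matrix.SpecialLinearGroup.SL2_inv_expl]
      have h4 : autom γ (γ⁻¹ • τ) = (autom γ⁻¹ τ)⁻¹ := eq_inv_of_mul_eq_one_left hJJ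
      rw [h3, h4]
      field_simp
    rw [h2]
    have h5 := e_ne_zero ((γ 1 0 : ℂ) * (z / autom γ⁻¹ τ) ^ 2 / (2 * autom γ (γ⁻¹ • τ)))
    generalize e ((γ 1 0 : ℂ) * (z / autom γ⁻¹ τ) ^ 2 / (2 * autom γ (γ⁻¹ • τ))) = E at h5 ⊢
    field_simp

/-! ### Two-sided estimates and the zeros of the theta function -/

/-- `e(z/2) - e(-z/2) = 2i sin(πz)`, the leading factor of the theta function as `q → 0`. -/
noncomputable def sinFactor (z : ℂ) : ℂ := e (z / 2) - e (-z / 2)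

/-- The quotient of `e((l + 1/2)z) - e(-(l + 1/2)z)` by `e(z/2) - e(-z/2)`. -/
noncomputable def sinQuot (l : ℕ) (z : ℂ) : ℂ := ∑ j ∈ Finset.range (2 * l + 1), e ((l - j : ℂ) * z)

lemma sinFactor_mul_sinQuot (l : ℕ) (z : ℂ) :
    sinFactor z * sinQuot l z = e (((l : ℂ) + 1 / 2) * z) - e (-((l : ℂ) + 1 / 2) * z) := by
  rw [sinQuot, Finset.mul_sum]
  have h : ∀ j ∈ Finset.range (2 * l + 1), sinFactor z * e ((l - j : ℂ) * z) =
      e (((l : ℂ) + 1 / 2 - (j : ℕ)) * z) - e (((l : ℂ) + 1 / 2 - ((j + 1 : ℕ) : ℂ)) * z) := by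
    intro j _
    rw [sinFactor, sub_mul, ← e_add, ← e_add]
    congr 2
    · ring
    · push_cast; ring
  rw [Finset.sum_congr rfl h, Finset.sum_range_sub' (fun j : ℕ => e (((l : ℂ) + 1 / 2 - j) * z))]
  congr 2
  · simp
  · push_cast; ring

lemma norm_sinQuot_le (l : ℕ) (z : ℂ) :
    ‖sinQuot l z‖ ≤ (2 * l + 1) * Real.exp (2 * Real.pi * (l * |z.im|)) := by
  refine (norm_sum_le_of_le (f := fun j : ℕ => e ((l - j : ℂ) * z))
    (n := fun _ => Real.exp (2 * Real.pi * (l * |z.im|))) _ fun j hj => ?_).trans (le_of_eq ?_)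
  · rw [norm_e, Real.exp_le_exp]
    have hj' : (j : ℝ) ≤ 2 * l := by exact_mod_cast Nat.lt_succ_iff.1 (Finset.mem_range.1 hj)
    have h1 : ((l - j : ℂ) * z).im = (l - j : ℝ) * z.im := by simp
    rw [h1]
    have h2 : -((l - j : ℝ) * z.im) ≤ l * |z.im| := by
      refine (neg_le_abs _).trans ?_
      rw [abs_mul]
      gcongr
      rw [abs_le]; constructor <;> linarith [(Nat.cast_nonneg j : (0 : ℝ) ≤ j)]
    nlinarith [Real.pi_pos]
  · simp

lemma hasSum_theta_nat (τ : UpperHalfPlane) (z : ℂ) :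
    HasSum (fun l : ℕ => (-1 : ℂ) ^ l * e ((τ : ℂ) * (((l : ℂ) + 1 / 2) ^ 2 / 2)) *
      (sinFactor z * sinQuot l z)) (theta τ z) := by
  convert (hasSum_theta τ z).nat_add_neg_add_one using 1
  funext l
  rw [sinFactor_mul_sinQuot]
  have h1 : (-1 : ℂ) ^ (-((l : ℤ) + 1)) = -(-1) ^ l := by
    rw [zpow_neg, zpow_add_one₀ (by norm_num), mul_inv, zpow_natCast, ← inv_pow]
    norm_num
  rw [h1]
  push_cast
  rw [zpow_natCast, show (-((l : ℂ) + 1) + 1 / 2) = -((l : ℂ) + 1 / 2) by ring, neg_sq]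
  ring

/-- The decay of `q ^ 0.4` in the fundamental domain, which yields the ratio `3 / 8` of the geometric
series that bounds the theta series. -/
lemma exp_neg_le_one_eighth : Real.exp (-(2 * Real.pi * (0.4 * (√3 / 2)))) ≤ 1 / 8 := by
  have h3 : (1.732 : ℝ) ≤ √3 := Real.le_sqrt_of_sq_le (by norm_num)
  have hpi := Real.pi_gt_d2
  have h1 : (2.17 : ℝ) ≤ 2 * Real.pi * (0.4 * (√3 / 2)) := by nlinarith
  have h2 : (8 : ℝ) ≤ Real.exp 2.17 := by
    have he := Real.exp_one_gt_d9
    have h4 : Real.exp 2.17 = Real.exp 1 * Real.exp 1 * Real.exp 0.17 := by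
      rw [← Real.exp_add, ← Real.exp_add]; norm_num
    have h5 := Real.add_one_le_exp (0.17 : ℝ)
    rw [h4]
    nlinarith [mul_pos (Real.exp_pos 1) (Real.exp_pos 1)]
  rw [Real.exp_neg, one_div]
  exact inv_anti₀ (by norm_num) (h2.trans (Real.exp_le_exp.2 h1))

/-- For `Im τ ≥ √3 / 2` and `|Im z| ≤ 0.6 Im τ`, the theta function agrees with its leading term up
to a factor that is close to `1`. -/
theorem theta_factor (τ : UpperHalfPlane) (z : ℂ) (hτ : √3 / 2 ≤ τ.im)
    (hz : |z.im| ≤ 0.6 * τ.im) :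
    ∃ ρ : ℂ, ‖ρ - 1‖ ≤ 3 / 5 ∧ theta τ z = e ((τ : ℂ) / 8) * sinFactor z * ρ := by
  -- `b l` is the sum of the terms with the indices `l` and `-l - 1`, divided by the leading term
  let b : ℕ → ℂ := fun l => (-1 : ℂ) ^ l * e ((τ : ℂ) * ((l * (l + 1) : ℂ) / 2)) * sinQuot l z
  have hr : Real.exp (-(2 * Real.pi * (0.4 * τ.im))) ≤ 1 / 8 := by
    refine (Real.exp_le_exp.2 ?_).trans exp_neg_le_one_eighth
    have := Real.pi_pos
    gcongr
  have hb : ∀ l : ℕ, 1 ≤ l → ‖b l‖ ≤ (3 / 8) ^ l := by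
    intro l hl
    have h1 : ((τ : ℂ) * ((l * (l + 1) : ℂ) / 2)).im = τ.im * (l * (l + 1) / 2) := by
      have : (τ : ℂ) * ((l * (l + 1) : ℂ) / 2) = (((l * (l + 1) / 2 : ℝ)) : ℂ) * τ := by
        push_cast; ring
      rw [this, Complex.im_ofReal_mul]
      exact mul_comm _ _
    have hl' : (1 : ℝ) ≤ l := by exact_mod_cast hl
    have h3 : (2 * l + 1 : ℝ) ≤ 3 ^ l := by
      have := one_add_mul_le_pow (show (-2 : ℝ) ≤ 2 by norm_num) l
      norm_num at this
      linarith
    calc ‖b l‖ = Real.exp (-(2 * Real.pi * (τ.im * (l * (l + 1) / 2)))) * ‖sinQuot l z‖ := by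
          simp only [b, norm_mul, norm_pow, norm_neg, norm_one, one_pow, one_mul, norm_e, h1]
      _ ≤ Real.exp (-(2 * Real.pi * (τ.im * (l * (l + 1) / 2)))) *
          (3 ^ l * Real.exp (2 * Real.pi * (l * (0.6 * τ.im)))) := by
          have hpi := Real.pi_pos
          refine mul_le_mul_of_nonneg_left ((norm_sinQuot_le l z).trans ?_) (Real.exp_pos _).le
          gcongr
      _ = 3 ^ l * Real.exp (-(2 * Real.pi * (τ.im * (l * (l + 1) / 2))) +
          2 * Real.pi * (l * (0.6 * τ.im))) := by rw [Real.exp_add]; ring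
      _ ≤ 3 ^ l * Real.exp (l * -(2 * Real.pi * (0.4 * τ.im))) := by
          refine mul_le_mul_of_nonneg_left (Real.exp_le_exp.2 ?_) (by positivity)
          have h4 : 0 ≤ Real.pi * τ.im * (l * (l - 1)) :=
            mul_nonneg (mul_pos Real.pi_pos τ.im_pos).le (mul_nonneg (by linarith) (by linarith))
          nlinarith
      _ = (3 * Real.exp (-(2 * Real.pi * (0.4 * τ.im)))) ^ l := by
          rw [mul_pow, ← Real.exp_nat_mul]
      _ ≤ (3 / 8) ^ l := by
          refine pow_le_pow_left₀ (by positivity) ?_ l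
          linarith
  have hgeo : HasSum (fun l : ℕ => (3 / 8 : ℝ) ^ (l + 1)) (3 / 5) := by
    have := (hasSum_geometric_of_lt_one (r := (3 / 8 : ℝ)) (by norm_num) (by norm_num)).mul_left
      (3 / 8)
    norm_num at this
    simpa [pow_succ, mul_comm] using this
  have hsum1 : Summable fun l : ℕ => b (l + 1) :=
    Summable.of_norm_bounded hgeo.summable fun l => hb (l + 1) (by omega)
  have hb0 : b 0 = 1 := by simp [b, sinQuot]
  have hsum : HasSum b (1 + ∑' l, b (l + 1)) := by
    have h := (hasSum_nat_add_iff 1).1 hsum1.hasSum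
    rwa [Finset.sum_range_one, hb0, add_comm] at h
  refine ⟨1 + ∑' l, b (l + 1), ?_, ?_⟩
  · rw [add_sub_cancel_left]
    exact (tsum_of_norm_bounded hgeo fun l => hb (l + 1) (by omega))
  · refine (hasSum_theta_nat τ z).unique ?_
    suffices hfun : (fun l : ℕ => (-1 : ℂ) ^ l * e ((τ : ℂ) * (((l : ℂ) + 1 / 2) ^ 2 / 2)) *
        (sinFactor z * sinQuot l z)) = fun l => e ((τ : ℂ) / 8) * sinFactor z * b l by
      rw [hfun]; exact hsum.mul_left _
    funext l
    have h1 : e ((τ : ℂ) * (((l : ℂ) + 1 / 2) ^ 2 / 2)) =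
        e ((τ : ℂ) / 8) * e ((τ : ℂ) * ((l * (l + 1) : ℂ) / 2)) := by
      rw [← e_add]; congr 1; ring
    rw [h1]
    ring

lemma sinFactor_eq_zero {z : ℂ} (h : sinFactor z = 0) : ∃ n : ℤ, z = n := by
  rw [sinFactor, sub_eq_zero, e, e, Complex.exp_eq_exp_iff_exists_int] at h
  obtain ⟨n, hn⟩ := h
  refine ⟨n, ?_⟩
  have hpi : (2 * Real.pi * Complex.I : ℂ) ≠ 0 := by simp [Real.pi_ne_zero]
  apply mul_left_cancel₀ hpi
  linear_combination hn

lemma sinFactor_neg (z : ℂ) : sinFactor (-z) = -sinFactor z := by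
  simp [sinFactor]

lemma norm_sinFactor_le (z : ℂ) : ‖sinFactor z‖ ≤ 2 * Real.exp (Real.pi * |z.im|) := by
  have hpi := Real.pi_pos
  have h : ∀ w : ℂ, |w.im| = |z.im| / 2 → ‖e w‖ ≤ Real.exp (Real.pi * |z.im|) := by
    intro w hw
    rw [norm_e, Real.exp_le_exp]
    nlinarith [neg_le_abs w.im]
  have h2 : |(z / 2).im| = |z.im| / 2 := by
    simp [abs_div]
  have h3 : |(-z / 2).im| = |z.im| / 2 := by
    rw [neg_div, Complex.neg_im, abs_neg, h2]
  calc ‖sinFactor z‖ ≤ ‖e (z / 2)‖ + ‖e (-z / 2)‖ := norm_sub_le _ _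
    _ ≤ _ := by linarith [h _ h2, h _ h3]

lemma le_norm_sinFactor {z : ℂ} (hz : 1 ≤ |z.im|) :
    1 / 2 * Real.exp (Real.pi * |z.im|) ≤ ‖sinFactor z‖ := by
  wlog h : z.im ≤ 0 generalizing z
  · have := this (z := -z) (by simpa using hz) (by simpa using (not_le.1 h).le)
    simpa [sinFactor_neg] using this
  have hpi := Real.pi_gt_three
  rw [abs_of_nonpos h] at hz ⊢
  have h1 : ‖e (z / 2)‖ = Real.exp (Real.pi * -z.im) := by
    rw [norm_e]; congr 1; simp; ring
  have h2 : ‖e (-z / 2)‖ = Real.exp (-(Real.pi * -z.im)) := by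
    rw [norm_e]; congr 1; simp; ring
  have h3 : ‖e (z / 2)‖ - ‖e (-z / 2)‖ ≤ ‖sinFactor z‖ := norm_sub_norm_le _ _
  have h4 : (2 : ℝ) ≤ Real.exp (Real.pi * -z.im) := by
    have := Real.add_one_le_exp (Real.pi * -z.im)
    nlinarith
  have h5 : Real.exp (-(Real.pi * -z.im)) ≤ 1 := by
    rw [Real.exp_le_one_iff]; nlinarith
  rw [h1, h2] at h3
  linarith

/-- The bounds for the correction factor in `theta_factor`. -/
lemma norm_bounds_of_norm_sub_one_le {ρ : ℂ} (h : ‖ρ - 1‖ ≤ 3 / 5) : 2 / 5 ≤ ‖ρ‖ ∧ ‖ρ‖ ≤ 8 / 5 := by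
  have h1 : ‖(1 : ℂ)‖ - ‖ρ‖ ≤ ‖1 - ρ‖ := norm_sub_norm_le _ _
  have h2 : ‖ρ‖ - ‖(1 : ℂ)‖ ≤ ‖ρ - 1‖ := norm_sub_norm_le _ _
  rw [norm_sub_rev, norm_one] at h1
  rw [norm_one] at h2
  constructor <;> linarith

lemma exists_fundamental (τ : UpperHalfPlane) : ∃ γ : SL(2, ℤ), √3 / 2 ≤ (γ • τ).im := by
  obtain ⟨γ, hγ⟩ := ModularGroup.exists_smul_mem_fd τ
  refine ⟨γ, ?_⟩
  have h := ModularGroup.three_le_four_mul_im_sq_of_mem_fd hγ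
  have h1 : √3 ^ 2 = 3 := Real.sq_sqrt (by norm_num)
  have h2 := (γ • τ).im_pos
  by_contra hlt
  push Not at hlt
  nlinarith [Real.sqrt_nonneg 3]

/-- The zeros of the theta function are the lattice points: after moving `τ` to the fundamental
domain and `z` to the central strip, the theta function is a nonzero multiple of its leading
term. -/
theorem theta_eq_zero {τ : UpperHalfPlane} {z : ℂ} (h : theta τ z = 0) :
    ∃ m n : ℤ, z = m * τ + n := by
  obtain ⟨γ, hγ⟩ := exists_fundamental τ
  set τ' := γ • τ
  have hJ := autom_ne_zero γ τ
  obtain ⟨A, hA, hmod⟩ := theta_modular γ τ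
  have h1 : theta τ' (z / autom γ τ) = 0 := by rw [hmod, h, mul_zero]
  set w := z / autom γ τ
  -- translation by `k * τ'` moves the zero into the strip where `theta_factor` applies
  set k : ℤ := round (w.im / τ'.im)
  have hτ' := τ'.im_pos
  have h2 : theta τ' (w - k * τ') = 0 := by
    have := theta_add_lattice τ' (w - k * τ') k 0
    rw [show w - k * τ' + (k * τ' + ((0 : ℤ) : ℂ)) = w by push_cast; ring, h1] at this
    exact (mul_eq_zero.1 this.symm).resolve_left
      (mul_ne_zero (zpow_ne_zero _ (by norm_num)) (e_ne_zero _))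
  have h3 : |(w - k * τ').im| ≤ 0.6 * τ'.im := by
    have h4 : (w - k * τ').im = (w.im / τ'.im - k) * τ'.im := by
      have : ((k : ℂ) * τ').im = k * τ'.im := by
        simp
      rw [Complex.sub_im, this, sub_mul, div_mul_cancel₀ _ hτ'.ne']
    rw [h4, abs_mul, abs_of_pos hτ']
    have := abs_sub_round (w.im / τ'.im)
    gcongr
    exact this.trans (by norm_num)
  obtain ⟨ρ, hρ, hfac⟩ := theta_factor τ' _ hγ h3
  have hρ0 : ρ ≠ 0 := by
    rintro rfl
    have := (norm_bounds_of_norm_sub_one_le hρ).1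
    norm_num at this
  rw [h2] at hfac
  have h5 : sinFactor (w - k * τ') = 0 := by
    simpa [e_ne_zero, hρ0] using hfac.symm
  obtain ⟨n, hn⟩ := sinFactor_eq_zero h5
  refine ⟨k * γ 0 0 + n * γ 1 0, k * γ 0 1 + n * γ 1 1, ?_⟩
  have h6 : z = (k * τ' + n) * autom γ τ := by
    rw [← hn, add_sub_cancel, div_mul_cancel₀ _ hJ]
  rw [h6, add_mul, coe_smul_eq, mul_assoc, div_mul_cancel₀ _ hJ, autom]
  push_cast
  ring

/-- The zero of the theta function at the origin is simple, in the form of a lower bound at nearby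
points. -/
lemma theta_simple_zero (τ : UpperHalfPlane) :
    ∃ C : ℝ, 0 < C ∧ ∀ᶠ z in 𝓝 (0 : ℂ), C * ‖z‖ ≤ ‖theta τ z‖ := by
  obtain ⟨γ, hγ⟩ := exists_fundamental τ
  set τ' := γ • τ
  have hJ := autom_ne_zero γ τ
  obtain ⟨A, hA, hmod⟩ := theta_modular γ τ
  -- the derivative of `sinFactor` at the origin has absolute value `2π ≥ 2`
  have hsin : ∀ᶠ w in 𝓝 (0 : ℂ), ‖w‖ ≤ ‖sinFactor w‖ := by
    have hd : HasDerivAt sinFactor (2 * Real.pi * Complex.I) 0 := by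
      have h1 : HasDerivAt (fun z : ℂ => 2 * Real.pi * Complex.I * (z / 2))
          (2 * Real.pi * Complex.I * (1 / 2)) 0 :=
        ((hasDerivAt_id (0 : ℂ)).div_const 2).const_mul (2 * Real.pi * Complex.I)
      have h2 : HasDerivAt (fun z : ℂ => 2 * Real.pi * Complex.I * (-z / 2))
          (2 * Real.pi * Complex.I * (-1 / 2)) 0 :=
        ((hasDerivAt_neg (0 : ℂ)).div_const 2).const_mul (2 * Real.pi * Complex.I)
      have h3 := h1.cexp.sub h2.cexp
      have h4 : Complex.exp (2 * Real.pi * Complex.I * (0 / 2)) *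
          (2 * Real.pi * Complex.I * (1 / 2)) -
          Complex.exp (2 * Real.pi * Complex.I * (-0 / 2)) *
          (2 * Real.pi * Complex.I * (-1 / 2)) = 2 * Real.pi * Complex.I := by
        rw [neg_zero, zero_div, mul_zero, Complex.exp_zero]; ring
      rw [h4] at h3
      exact h3
    have hl := hd.isLittleO.def (c := 1) one_pos
    filter_upwards [hl] with w hw
    have h0 : sinFactor 0 = 0 := by simp [sinFactor]
    rw [h0, sub_zero, sub_zero, one_mul] at hw
    have h1 : ‖w • (2 * Real.pi * Complex.I : ℂ)‖ - ‖sinFactor w‖ ≤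
        ‖w • (2 * Real.pi * Complex.I : ℂ) - sinFactor w‖ := norm_sub_norm_le _ _
    rw [norm_sub_rev] at h1
    have h2 : ‖w • (2 * Real.pi * Complex.I : ℂ)‖ = ‖w‖ * (2 * Real.pi) := by
      simp [abs_of_pos Real.pi_pos]
    rw [h2] at h1
    nlinarith [norm_nonneg w, Real.pi_gt_three]
  have hdiv : Tendsto (fun z : ℂ => z / autom γ τ) (𝓝 0) (𝓝 0) := by
    have : Continuous fun z : ℂ => z / autom γ τ := by fun_prop
    simpa using this.tendsto 0
  have him : ∀ᶠ w in 𝓝 (0 : ℂ), |w.im| ≤ 0.6 * τ'.im := by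
    have : Continuous fun w : ℂ => |w.im| := by fun_prop
    have h0 : |(0 : ℂ).im| < 0.6 * τ'.im := by
      have := τ'.im_pos
      simp only [Complex.zero_im, abs_zero]; positivity
    filter_upwards [this.continuousAt.eventually (gt_mem_nhds h0)] with w hw using hw.le
  set E : ℂ → ℂ := fun z => A * e ((γ 1 0 : ℂ) * z ^ 2 / (2 * autom γ τ))
  have hE : ∀ᶠ z in 𝓝 (0 : ℂ), ‖E z‖ ≤ ‖A‖ + 1 := by
    have hc : ContinuousAt E 0 := by
      refine continuousAt_const.mul (AnalyticAt.e_comp ?_).continuousAt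
      fun_prop
    have : ‖E 0‖ < ‖A‖ + 1 := by simp [E]
    filter_upwards [hc.norm.eventually (gt_mem_nhds this)] with z hz using hz.le
  refine ⟨(2 / 5 * ‖e ((τ' : ℂ) / 8)‖ / ‖autom γ τ‖) / (‖A‖ + 1), ?_, ?_⟩
  · have h1 := norm_pos_iff.2 (e_ne_zero ((τ' : ℂ) / 8))
    have h2 := norm_pos_iff.2 hJ
    positivity
  · filter_upwards [hE, hdiv.eventually hsin, hdiv.eventually him] with z h1 h2 h3
    obtain ⟨ρ, hρ, hfac⟩ := theta_factor τ' _ hγ h3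
    have h4 : ‖theta τ' (z / autom γ τ)‖ = ‖E z‖ * ‖theta τ z‖ := by
      rw [hmod, ← norm_mul]
    have h5 : 2 / 5 * ‖e ((τ' : ℂ) / 8)‖ * (‖z‖ / ‖autom γ τ‖) ≤ ‖theta τ' (z / autom γ τ)‖ := by
      rw [hfac, norm_mul, norm_mul]
      rw [norm_div] at h2
      calc _ = ‖e ((τ' : ℂ) / 8)‖ * (‖z‖ / ‖autom γ τ‖) * (2 / 5) := by ring
        _ ≤ _ := by
          gcongr
          exact (norm_bounds_of_norm_sub_one_le hρ).1
    have h6 : ‖E z‖ * ‖theta τ z‖ ≤ (‖A‖ + 1) * ‖theta τ z‖ := by gcongr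
    rw [div_mul_eq_mul_div, div_le_iff₀ (by positivity)]
    calc _ = 2 / 5 * ‖e ((τ' : ℂ) / 8)‖ * (‖z‖ / ‖autom γ τ‖) := by ring
      _ ≤ (‖A‖ + 1) * ‖theta τ z‖ := by linarith
      _ = _ := by ring

lemma analyticAt_sinFactor (z : ℂ) : AnalyticAt ℂ sinFactor z := by
  unfold sinFactor e; fun_prop

/-- Near the line `Aτ + B` with `|A| ≤ 1/2`, the function `sinFactor` attains its generic size. -/
lemma exists_sinFactor_bound (A B : ℝ) : ∃ δ₀ : ℝ, 0 < δ₀ ∧ δ₀ ≤ 1 ∧ ∃ Y : ℝ,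
    (∀ τ : UpperHalfPlane, Y ≤ τ.im → ∀ u : ℂ, 0 < ‖u‖ → ‖u‖ ≤ δ₀ →
      sinFactor (A * τ + B + u) ≠ 0) ∧
    ∀ δ : ℝ, 0 < δ → δ ≤ δ₀ → ∃ c : ℝ, 0 < c ∧ ∀ τ : UpperHalfPlane, Y ≤ τ.im → ∀ u : ℂ,
      ‖u‖ = δ → c * Real.exp (Real.pi * |((A : ℂ) * τ + B + u).im|) ≤
        ‖sinFactor (A * τ + B + u)‖ := by
  have him : ∀ (τ : UpperHalfPlane) (u : ℂ), ((A : ℂ) * τ + B + u).im = A * τ.im + u.im := by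
    intro τ u; simp
  by_cases hA : A = 0
  -- for `A = 0` the points `B + u` stay in a compact set, and the zeros of `sinFactor` are isolated
  · have hne : ∀ᶠ z in 𝓝[≠] (B : ℂ), sinFactor z ≠ 0 := by
      refine (analyticAt_sinFactor B).eventually_eq_zero_or_eventually_ne_zero.resolve_left ?_
      intro h
      have hl : Tendsto (fun t : ℝ => (B : ℂ) + t * Complex.I) (𝓝[>] 0) (𝓝 B) := by
        have : Continuous fun t : ℝ => (B : ℂ) + t * Complex.I := by fun_prop
        simpa using (this.tendsto 0).mono_left nhdsWithin_le_nhds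
      obtain ⟨t, ht, ht0⟩ := ((hl.eventually h).and self_mem_nhdsWithin).exists
      obtain ⟨n, hn⟩ := sinFactor_eq_zero ht
      have := congrArg Complex.im hn
      simp only [Complex.add_im, Complex.ofReal_im, Complex.mul_im, Complex.ofReal_re,
        Complex.I_im, Complex.I_re, Complex.intCast_im] at this
      have ht0' : 0 < t := ht0
      linarith
    rw [eventually_nhdsWithin_iff, Metric.eventually_nhds_iff] at hne
    obtain ⟨ε, hε, hball⟩ := hne
    have hnz : ∀ u : ℂ, 0 < ‖u‖ → ‖u‖ < ε → sinFactor (B + u) ≠ 0 := by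
      intro u hu0 hu
      refine hball (by simpa [dist_eq_norm] using hu) ?_
      simpa using norm_pos_iff.1 hu0
    refine ⟨min 1 (ε / 2), by positivity, min_le_left _ _, 0, ?_, ?_⟩
    · intro τ _ u hu0 hu
      simp only [hA, Complex.ofReal_zero, zero_mul, zero_add]
      exact hnz u hu0 (by linarith [hu.trans (min_le_right _ _)])
    · intro δ hδ hδ0
      have hcomp : IsCompact (Metric.sphere (0 : ℂ) δ) := isCompact_sphere _ _
      have hne : (Metric.sphere (0 : ℂ) δ).Nonempty := ⟨(δ : ℂ), by simp [abs_of_pos hδ]⟩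
      have hcont : ContinuousOn (fun u : ℂ => ‖sinFactor (B + u)‖) (Metric.sphere 0 δ) := by
        refine ContinuousOn.norm fun u _ => ContinuousAt.continuousWithinAt ?_
        exact ContinuousAt.comp (g := sinFactor) (analyticAt_sinFactor _).continuousAt
          (by fun_prop)
      obtain ⟨u₀, hu₀, hmin⟩ := hcomp.exists_isMinOn hne hcont
      have hu₀' : ‖u₀‖ = δ := by simpa using hu₀
      have hpos : 0 < ‖sinFactor (B + u₀)‖ := norm_pos_iff.2
        (hnz u₀ (by rw [hu₀']; exact hδ) (by rw [hu₀']; linarith [hδ0.trans (min_le_right _ _)]))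
      refine ⟨‖sinFactor (B + u₀)‖ / Real.exp Real.pi, by positivity, ?_⟩
      intro τ _ u hu
      rw [him, hA]
      simp only [Complex.ofReal_zero, zero_mul, zero_add]
      have h1 : ‖sinFactor (B + u₀)‖ ≤ ‖sinFactor (B + u)‖ := hmin (by simpa using hu)
      have h2 : |u.im| ≤ 1 := (Complex.abs_im_le_norm u).trans
        (by rw [hu]; exact hδ0.trans (min_le_left _ _))
      have h3 : Real.exp (Real.pi * |u.im|) ≤ Real.exp Real.pi := by
        rw [Real.exp_le_exp]; nlinarith [Real.pi_pos]
      rw [div_mul_eq_mul_div, div_le_iff₀ (Real.exp_pos _)]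
      gcongr
  -- for `A ≠ 0` the imaginary part becomes large
  · have hA' : 0 < |A| := abs_pos.2 hA
    have hbig : ∀ τ : UpperHalfPlane, 2 / |A| ≤ τ.im → ∀ u : ℂ, ‖u‖ ≤ 1 →
        1 ≤ |((A : ℂ) * τ + B + u).im| := by
      intro τ hτ u hu
      rw [him]
      rw [div_le_iff₀ hA'] at hτ
      have h1 : |A * τ.im| = τ.im * |A| := by rw [abs_mul, abs_of_pos τ.im_pos, mul_comm]
      have h2 := (Complex.abs_im_le_norm u).trans hu
      have h3 := abs_sub_abs_le_abs_sub (A * τ.im) (-u.im)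
      rw [abs_neg, sub_neg_eq_add] at h3
      linarith
    refine ⟨1, one_pos, le_rfl, 2 / |A|, ?_, ?_⟩
    · intro τ hτ u _ hu h0
      have := le_norm_sinFactor (hbig τ hτ u hu)
      rw [h0, norm_zero] at this
      have h1 := Real.exp_pos (Real.pi * |((A : ℂ) * τ + B + u).im|)
      linarith
    · intro δ _ hδ0
      exact ⟨1 / 2, by norm_num, fun τ hτ u hu => le_norm_sinFactor (hbig τ hτ u (hu ▸ hδ0))⟩

/-- Growth of the theta function along `Aτ + B + u` as `Im τ → ∞`: it does not vanish for small
`u ≠ 0`, and on small circles it is bounded below by its leading exponential and is comparable to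
its values at bounded distance. -/
theorem exists_theta_bound (A B : ℝ) : ∃ δ₀ : ℝ, 0 < δ₀ ∧ ∃ Y : ℝ,
    (∀ τ : UpperHalfPlane, Y ≤ τ.im → ∀ u : ℂ, 0 < ‖u‖ → ‖u‖ ≤ δ₀ →
      theta τ (A * τ + B + u) ≠ 0) ∧
    ∀ δ : ℝ, 0 < δ → δ ≤ δ₀ → ∃ c C : ℝ, 0 < c ∧ 0 < C ∧ ∀ τ : UpperHalfPlane, Y ≤ τ.im →
      ∀ u : ℂ, ‖u‖ = δ →
        c * Real.exp (-(2 * Real.pi * ((1 / 8 - A ^ 2 / 2) * τ.im))) ≤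
          ‖theta τ (A * τ + B + u)‖ ∧
        ∀ t : ℂ, ‖t‖ ≤ 1 →
          ‖theta τ (A * τ + B + u + t)‖ ≤ C * ‖theta τ (A * τ + B + u)‖ := by
  -- translation by a lattice point reduces to the case `|A| ≤ 1/2` of `theta_factor`
  set k : ℤ := round A
  set A' : ℝ := A - k
  have hA' : |A'| ≤ 1 / 2 := abs_sub_round A
  have hpi := Real.pi_pos
  obtain ⟨δ₀, hδ₀, hδ₀1, Y, hne, hbd⟩ := exists_sinFactor_bound A' B
  have hshift : ∀ (τ : UpperHalfPlane) (u : ℂ), theta τ (A * τ + B + u) =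
      (-1) ^ k * e (-(k : ℂ) ^ 2 * τ / 2 - k * (A' * τ + B + u)) * theta τ (A' * τ + B + u) := by
    intro τ u
    have := theta_add_lattice τ (A' * τ + B + u) k 0
    rw [add_zero] at this
    rw [← this]
    congr 1
    simp only [A']
    push_cast
    ring
  have him : ∀ (τ : UpperHalfPlane) (u : ℂ),
      ((A' : ℂ) * τ + B + u).im = A' * τ.im + u.im := by
    intro τ u; simp
  have hstrip : ∀ τ : UpperHalfPlane, max Y 20 ≤ τ.im → ∀ u : ℂ, ‖u‖ ≤ 2 →
      |((A' : ℂ) * τ + B + u).im| ≤ 0.6 * τ.im := by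
    intro τ hτ u hu
    have h20 := (le_max_right _ _).trans hτ
    rw [him]
    refine (abs_add_le _ _).trans ?_
    rw [abs_mul, abs_of_pos τ.im_pos]
    have := (Complex.abs_im_le_norm u).trans hu
    nlinarith
  have hs3 : ∀ τ : UpperHalfPlane, max Y 20 ≤ τ.im → √3 / 2 ≤ τ.im := by
    intro τ hτ
    have h20 := (le_max_right _ _).trans hτ
    have : √3 ≤ 2 := Real.sqrt_le_iff.2 ⟨by norm_num, by norm_num⟩
    linarith
  have hnormE : ∀ (τ : UpperHalfPlane) (u : ℂ),
      ‖(-1 : ℂ) ^ k * e (-(k : ℂ) ^ 2 * τ / 2 - k * (A' * τ + B + u))‖ =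
        Real.exp (2 * Real.pi * ((k ^ 2 / 2 + k * A') * τ.im + k * u.im)) := by
    intro τ u
    rw [norm_mul, norm_zpow, norm_neg, norm_one, one_zpow, one_mul, norm_e]
    congr 1
    have : (-(k : ℂ) ^ 2 * τ / 2 - k * (A' * τ + B + u)).im =
        -(k ^ 2 / 2 * τ.im) - k * (A' * τ.im + u.im) := by
      have h1 : -(k : ℂ) ^ 2 * τ / 2 = ((-((k : ℝ) ^ 2 / 2) : ℝ) : ℂ) * τ := by
        push_cast; ring
      have h2 : (k : ℂ) * (A' * τ + B + u) = ((k : ℝ) : ℂ) * (A' * τ + B + u) := by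
        push_cast; ring
      rw [h1, h2, Complex.sub_im, Complex.im_ofReal_mul, Complex.im_ofReal_mul, him]
      simp
    rw [this]
    ring
  refine ⟨δ₀, hδ₀, max Y 20, ?_, ?_⟩
  · intro τ hτ u hu0 hu h0
    rw [hshift] at h0
    have h1 := (mul_eq_zero.1 h0).resolve_left
      (mul_ne_zero (zpow_ne_zero _ (by norm_num)) (e_ne_zero _))
    obtain ⟨ρ, hρ, hfac⟩ := theta_factor τ _ (hs3 τ hτ) (hstrip τ hτ u (by linarith))
    have hρ0 : ρ ≠ 0 := norm_pos_iff.1 (lt_of_lt_of_le (by norm_num) (norm_bounds_of_norm_sub_one_le hρ).1)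
    rw [hfac] at h1
    exact mul_ne_zero (mul_ne_zero (e_ne_zero _)
      (hne τ ((le_max_left _ _).trans hτ) u hu0 hu)) hρ0 h1
  · intro δ hδ hδ1
    obtain ⟨c, hc, hlow⟩ := hbd δ hδ hδ1
    refine ⟨2 / 5 * c * Real.exp (-(2 * Real.pi * |(k : ℝ)|)) * Real.exp (-Real.pi),
      8 * Real.exp Real.pi * Real.exp (2 * Real.pi * |(k : ℝ)|) / c, by positivity,
      by positivity, ?_⟩
    intro τ hτ u hu
    have hτY := (le_max_left _ _).trans hτ
    have hu1 : ‖u‖ ≤ 1 := by rw [hu]; linarith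
    have huim := (Complex.abs_im_le_norm u).trans hu1
    obtain ⟨ρ, hρ, hfac⟩ := theta_factor τ _ (hs3 τ hτ) (hstrip τ hτ u (by linarith))
    have hsl := hlow τ hτY u hu
    have hρ' := (norm_bounds_of_norm_sub_one_le hρ).1
    have hlower : 2 / 5 * ‖e ((τ : ℂ) / 8)‖ *
        (c * Real.exp (Real.pi * |((A' : ℂ) * τ + B + u).im|)) ≤ ‖theta τ (A' * τ + B + u)‖ := by
      rw [hfac, norm_mul, norm_mul]
      calc _ = ‖e ((τ : ℂ) / 8)‖ *
            (c * Real.exp (Real.pi * |((A' : ℂ) * τ + B + u).im|)) * (2 / 5) := by ring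
        _ ≤ _ := by gcongr
    have hq : ‖e ((τ : ℂ) / 8)‖ = Real.exp (-(2 * Real.pi * (τ.im / 8))) := by
      rw [norm_e]
      congr 3
      simp
    constructor
    · rw [hshift, norm_mul, hnormE]
      refine le_trans ?_ (mul_le_mul_of_nonneg_left hlower (Real.exp_pos _).le)
      have hkA : (k : ℝ) * u.im ≥ -|(k : ℝ)| := by
        have h1 := neg_abs_le ((k : ℝ) * u.im)
        rw [abs_mul] at h1
        nlinarith [abs_nonneg (k : ℝ)]
      -- this uses `A' ^ 2 ≤ |A'|`; the resulting bound is weaker than the truth but sufficient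
      have himA : |((A' : ℂ) * τ + B + u).im| ≥ A' ^ 2 * τ.im - 1 := by
        rw [him]
        have h3 := abs_sub_abs_le_abs_sub (A' * τ.im) (-u.im)
        rw [abs_neg, sub_neg_eq_add, abs_mul, abs_of_pos τ.im_pos] at h3
        have h4 : A' ^ 2 ≤ |A'| := by
          rw [← sq_abs]; nlinarith [abs_nonneg A']
        have := mul_le_mul_of_nonneg_right h4 τ.im_pos.le
        linarith
      have hAA : A ^ 2 = k ^ 2 + 2 * k * A' + A' ^ 2 := by simp only [A']; ring
      rw [hq]
      calc _ = 2 / 5 * c * (Real.exp (-(2 * Real.pi * |(k : ℝ)|)) * Real.exp (-Real.pi) *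
            Real.exp (-(2 * Real.pi * ((1 / 8 - A ^ 2 / 2) * τ.im)))) := by ring
        _ ≤ 2 / 5 * c * (Real.exp (2 * Real.pi * ((k ^ 2 / 2 + k * A') * τ.im + k * u.im)) *
            Real.exp (-(2 * Real.pi * (τ.im / 8))) *
            Real.exp (Real.pi * |((A' : ℂ) * τ + B + u).im|)) := by
          refine mul_le_mul_of_nonneg_left ?_ (by positivity)
          rw [← Real.exp_add, ← Real.exp_add, ← Real.exp_add, ← Real.exp_add, Real.exp_le_exp, hAA]
          nlinarith
        _ = _ := by ring
    · intro t ht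
      have htk : ‖u + t‖ ≤ 2 := (norm_add_le _ _).trans (by linarith)
      obtain ⟨ρ', hρ', hfac'⟩ := theta_factor τ _ (hs3 τ hτ) (hstrip τ hτ (u + t) htk)
      have htim := (Complex.abs_im_le_norm t).trans ht
      rw [add_assoc, hshift, hshift, norm_mul (_ * _), norm_mul (_ * _) (theta τ (A' * τ + B + u)),
        hnormE, hnormE]
      have hupper : ‖theta τ (A' * τ + B + (u + t))‖ ≤ ‖e ((τ : ℂ) / 8)‖ *
          (2 * (Real.exp Real.pi * Real.exp (Real.pi * |((A' : ℂ) * τ + B + u).im|))) *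
          (8 / 5) := by
        rw [hfac', norm_mul, norm_mul]
        have h1 : ‖sinFactor (A' * τ + B + (u + t))‖ ≤
            2 * (Real.exp Real.pi * Real.exp (Real.pi * |((A' : ℂ) * τ + B + u).im|)) := by
          refine (norm_sinFactor_le _).trans ?_
          rw [← Real.exp_add]
          refine mul_le_mul_of_nonneg_left (Real.exp_le_exp.2 ?_) (by norm_num)
          have h2 : |((A' : ℂ) * τ + B + (u + t)).im| ≤ |((A' : ℂ) * τ + B + u).im| + 1 := by
            rw [← add_assoc, Complex.add_im _ t]
            exact (abs_add_le _ _).trans (by linarith)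
          nlinarith
        have h2 := (norm_bounds_of_norm_sub_one_le hρ').2
        gcongr
      have hexp : Real.exp (2 * Real.pi * ((k ^ 2 / 2 + k * A') * τ.im + k * (u + t).im)) ≤
          Real.exp (2 * Real.pi * |(k : ℝ)|) *
          Real.exp (2 * Real.pi * ((k ^ 2 / 2 + k * A') * τ.im + k * u.im)) := by
        rw [← Real.exp_add, Real.exp_le_exp, Complex.add_im]
        have h1 : (k : ℝ) * t.im ≤ |(k : ℝ)| := by
          have h2 := le_abs_self ((k : ℝ) * t.im)
          rw [abs_mul] at h2
          nlinarith [abs_nonneg (k : ℝ)]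
        nlinarith
      have hmain : ‖theta τ (A' * τ + B + (u + t))‖ ≤
          8 * Real.exp Real.pi / c * ‖theta τ (A' * τ + B + u)‖ := by
        refine hupper.trans ?_
        refine le_trans (le_of_eq ?_) (mul_le_mul_of_nonneg_left hlower (by positivity))
        field_simp
      calc _ ≤ (Real.exp (2 * Real.pi * |(k : ℝ)|) *
          Real.exp (2 * Real.pi * ((k ^ 2 / 2 + k * A') * τ.im + k * u.im))) *
          (8 * Real.exp Real.pi / c * ‖theta τ (A' * τ + B + u)‖) := by gcongr
        _ = _ := by ring

/-- Cauchy's estimate for the normalized derivatives of the theta function. -/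
lemma norm_thetaD_le (r : ℕ) (τ : UpperHalfPlane) (z : ℂ) {C : ℝ}
    (h : ∀ t : ℂ, ‖t‖ ≤ 1 → ‖theta τ (z + t)‖ ≤ C) : ‖thetaD r τ z‖ ≤ r.factorial * C := by
  have h1 := Complex.norm_iteratedDeriv_le_of_forall_mem_sphere_norm_le (c := z) (R := 1) (C := C) r
    one_pos (differentiable_theta τ).diffContOnCl (fun w hw => by
      have := h (w - z) (by rw [← dist_eq_norm]; exact (Metric.mem_sphere.1 hw).le)
      simpa using this)
  rw [one_pow, div_one] at h1
  rw [thetaD, norm_mul]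
  refine le_trans (mul_le_of_le_one_left (norm_nonneg _) ?_) h1
  rw [norm_pow]
  refine pow_le_one₀ (norm_nonneg _) ?_
  rw [norm_div, norm_one]
  have : ‖(2 * Real.pi * Complex.I : ℂ)‖ = 2 * Real.pi := by simp [abs_of_pos Real.pi_pos]
  rw [this, div_le_one (by positivity)]
  linarith [Real.pi_gt_three]

/-- The normalized derivatives of the theta function at the origin decay like `q ^ (1 / 8)`. -/
lemma exists_thetaD_zero_bound : ∃ C : ℝ, 0 < C ∧ ∀ τ : UpperHalfPlane, 20 ≤ τ.im → ∀ r : ℕ,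
    ‖thetaD r τ 0‖ ≤ r.factorial * (C * Real.exp (-(2 * Real.pi * (τ.im / 8)))) := by
  refine ⟨16 / 5 * Real.exp Real.pi, by positivity, fun τ hτ r => norm_thetaD_le r τ 0 ?_⟩
  intro t ht
  rw [zero_add]
  have htim := (Complex.abs_im_le_norm t).trans ht
  have : √3 ≤ 2 := Real.sqrt_le_iff.2 ⟨by norm_num, by norm_num⟩
  obtain ⟨ρ, hρ, hfac⟩ := theta_factor τ t (by linarith) (by linarith)
  have hq : ‖e ((τ : ℂ) / 8)‖ = Real.exp (-(2 * Real.pi * (τ.im / 8))) := by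
    rw [norm_e]; congr 3; simp
  have h1 : ‖sinFactor t‖ ≤ 2 * Real.exp Real.pi := by
    refine (norm_sinFactor_le t).trans ?_
    have := Real.pi_pos
    gcongr
    nlinarith
  have h2 := (norm_bounds_of_norm_sub_one_le hρ).2
  rw [hfac, norm_mul, norm_mul, hq]
  calc _ ≤ Real.exp (-(2 * Real.pi * (τ.im / 8))) * (2 * Real.exp Real.pi) * (8 / 5) := by gcongr
    _ = _ := by ring

/-! ### The recursion and its symmetries -/

/-- The solution `v` of the triangular system `v₀ = 1`, `∑_{m ≤ n} g (n - m) m * v m = 0` for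
`n ≥ 1`, where `d n` is the inverse of the diagonal coefficient `g 0 n`. -/
def recSol {R : Type*} [CommRing R] (g : ℕ → ℕ → R) (d : ℕ → R) (n : ℕ) : R :=
  if n = 0 then 1 else -(∑ m : Fin n, g (n - m) m * recSol g d m) * d n
termination_by n
decreasing_by exact m.isLt

section recSol

variable {R : Type*} [CommRing R] {g g' : ℕ → ℕ → R} {d d' : ℕ → R}

@[simp] lemma recSol_zero : recSol g d 0 = 1 := by rw [recSol]; simp

lemma recSol_of_ne_zero {n : ℕ} (hn : n ≠ 0) :
    recSol g d n = -(∑ m ∈ Finset.range n, g (n - m) m * recSol g d m) * d n := by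
  rw [recSol, if_neg hn, Finset.sum_range (fun m => g (n - m) m * recSol g d m)]

lemma recSol_relation {n : ℕ} (hn : n ≠ 0) (h : g 0 n * d n = 1) :
    ∑ m ∈ Finset.range (n + 1), g (n - m) m * recSol g d m = 0 := by
  rw [Finset.sum_range_succ, Nat.sub_self, recSol_of_ne_zero hn]
  linear_combination (-∑ m ∈ Finset.range n, g (n - m) m * recSol g d m) * h

lemma recSol_unique {N : ℕ} (hd : ∀ n, n ≠ 0 → n ≤ N → g 0 n * d n = 1) {v : ℕ → R} (h0 : v 0 = 1)
    (hv : ∀ n, n ≠ 0 → n ≤ N → ∑ m ∈ Finset.range (n + 1), g (n - m) m * v m = 0) {n : ℕ}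
    (hn : n ≤ N) : recSol g d n = v n := by
  induction n using Nat.strong_induction_on with
  | _ n ih =>
    rcases eq_or_ne n 0 with rfl | hn0
    · rw [recSol_zero, h0]
    · have h1 := hv n hn0 hn
      have h2 := hd n hn0 hn
      rw [Finset.sum_range_succ, Nat.sub_self] at h1
      rw [recSol_of_ne_zero hn0, Finset.sum_congr rfl fun m hm => by
        rw [ih m (Finset.mem_range.1 hm) ((Finset.mem_range.1 hm).le.trans hn)]]
      linear_combination v n * h2 - d n * h1

lemma recSol_congr {n : ℕ} (hg : ∀ r, ∀ m < n, g r m = g' r m)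
    (hd : ∀ m, m ≠ 0 → m ≤ n → d m = d' m) : recSol g d n = recSol g' d' n := by
  induction n using Nat.strong_induction_on with
  | _ n ih =>
    rcases eq_or_ne n 0 with rfl | hn0
    · simp
    · rw [recSol_of_ne_zero hn0, recSol_of_ne_zero hn0, hd n hn0 le_rfl]
      congr 2
      refine Finset.sum_congr rfl fun m hm => ?_
      have hm' := Finset.mem_range.1 hm
      rw [hg _ m hm', ih m hm' (fun r k hk => hg r k (hk.trans hm'))
        (fun k hk0 hk => hd k hk0 (hk.trans hm'.le))]

lemma map_recSol {S : Type*} [CommRing S] (f : R →+* S) (n : ℕ) :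
    f (recSol g d n) = recSol (fun r m => f (g r m)) (fun m => f (d m)) n := by
  induction n using Nat.strong_induction_on with
  | _ n ih =>
    rcases eq_or_ne n 0 with rfl | hn0
    · simp
    · rw [recSol_of_ne_zero hn0, recSol_of_ne_zero hn0, map_mul, map_neg, map_sum]
      congr 2
      refine Finset.sum_congr rfl fun m hm => ?_
      rw [map_mul, ih m (Finset.mem_range.1 hm)]

/-- Covariance of the recursion. The generating series `E` multiplying all columns drops out because
the relations also hold for `n = 0`, by `g 0 0 = 0`. -/
lemma recSol_transform {K : Type*} [Field K] {g g' : ℕ → ℕ → K} {d d' : ℕ → K} {N : ℕ}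
    (h00 : g 0 0 = 0)
    (hd : ∀ n, n ≠ 0 → n ≤ N → g 0 n * d n = 1) (hd' : ∀ n, n ≠ 0 → n ≤ N → g' 0 n * d' n = 1)
    (a E : ℕ → K) (J : K) (ha : ∀ n, a n ≠ 0)
    (hg : ∀ r m, m ≤ N → g' r m =
      a m * ∑ i ∈ Finset.range (r + 1), E i * (J ^ (r - i) * g (r - i) m))
    {n : ℕ} (hn : n ≤ N) : recSol g' d' n = a 0 / a n * (J ^ n * recSol g d n) := by
  refine recSol_unique (v := fun n => a 0 / a n * (J ^ n * recSol g d n)) hd' ?_ ?_ hn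
  · simp [ha 0]
  · intro n _ hnN
    -- the relations of the original system, including the one for `k = 0`
    have hA : ∀ k ≤ N, ∑ m ∈ Finset.range (k + 1), g (k - m) m * recSol g d m = 0 := by
      intro k hk
      rcases eq_or_ne k 0 with rfl | hk0
      · simp [h00]
      · exact recSol_relation hk0 (hd k hk0 hk)
    have h1 : ∀ m ∈ Finset.range (n + 1),
        g' (n - m) m * (a 0 / a m * (J ^ m * recSol g d m)) =
        ∑ i ∈ Finset.range (n - m + 1),
          a 0 * (E i * (J ^ (n - i) * (g (n - i - m) m * recSol g d m))) := by
      intro m hm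
      have hmn := Nat.lt_succ_iff.1 (Finset.mem_range.1 hm)
      rw [hg _ _ (hmn.trans hnN), Finset.mul_sum, Finset.sum_mul]
      refine Finset.sum_congr rfl fun i hi => ?_
      have hi' := Nat.lt_succ_iff.1 (Finset.mem_range.1 hi)
      have h2 : J ^ (n - i) = J ^ (n - m - i) * J ^ m := by
        rw [← pow_add]; congr 1; omega
      rw [h2, show n - i - m = n - m - i by omega]
      have := ha m
      field_simp
    -- the terms with a fixed factor `E i` add up to the relation for `n - i`
    rw [Finset.sum_congr rfl h1, Finset.sum_comm' (t' := Finset.range (n + 1))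
      (s' := fun i => Finset.range (n - i + 1))]
    · refine Finset.sum_eq_zero fun i hi => ?_
      rw [← Finset.mul_sum, ← Finset.mul_sum, ← Finset.mul_sum, hA (n - i) (by omega)]
      simp
    · intro x y
      simp only [Finset.mem_range]
      omega

/-- Omission of the `k`-th term of a sequence. -/
def skip (k m : ℕ) : ℕ := if m < k then m else m + 1

/-- A derivation acting on the columns of the recursion by `D (g r m) = χ m * g (r - 1) m` acts on
its solution by omitting one of the columns. Both sides solve the system of the differentiated
relations. -/
lemma derivation_recSol {A : Type*} [CommRing A] [Algebra A R] (D : Derivation A R R) {N : ℕ}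
    (hd : ∀ n, n ≠ 0 → n ≤ N → g 0 n * d n = 1)
    (χ : ℕ → R) (hχ : χ 0 = 0) (hD0 : ∀ m, D (g 0 m) = 0)
    (hD : ∀ r m, D (g (r + 1) m) = χ m * g r m) {n : ℕ} (hn : n ≤ N) :
    D (recSol g d n) = -∑ k ∈ Finset.range (n - 1), (χ (k + 1) - χ k) *
      recSol (fun r m => g r (skip (k + 1) m)) (fun m => d (skip (k + 1) m)) (n - 1) := by
  -- `w k` is the solution with the column `k + 1` omitted, `X n` the claimed value of the derivative
  set w : ℕ → ℕ → R := fun k =>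
    recSol (fun r m => g r (skip (k + 1) m)) (fun m => d (skip (k + 1) m)) with hw
  set X : ℕ → R := fun n => -∑ k ∈ Finset.range (n - 1), (χ (k + 1) - χ k) * w k (n - 1) with hX
  -- the columns up to `k` are not affected by the omission
  have hwlow : ∀ k p, p ≤ k → w k p = recSol g d p := by
    intro k p hp
    refine recSol_congr (fun r m hm => ?_) fun m _ hm => ?_
    · rw [skip, if_pos (by omega)]
    · rw [skip, if_pos (by omega)]
  have hwrel : ∀ k n, k < n → n < N →
      ∑ p ∈ Finset.range (n + 1), g (n - p) (skip (k + 1) p) * w k p = 0 := by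
    intro k n hk hnN
    refine recSol_relation (g := fun r m => g r (skip (k + 1) m)) (by omega) (hd _ ?_ ?_)
    · simp only [skip]; split_ifs <;> omega
    · simp only [skip]; split_ifs <;> omega
  -- inserting `X` into the relations, the sum over `k` telescopes by the relations of the `w k`
  have hXrel : ∀ n, n + 1 ≤ N → ∑ m ∈ Finset.range (n + 2), g (n + 1 - m) m * X m =
      -∑ m ∈ Finset.range (n + 1), χ m * (g (n - m) m * recSol g d m) := by
    intro n hnN
    have hX0 : X 0 = 0 := by simp [hX]
    rw [Finset.sum_range_succ', hX0, mul_zero, add_zero]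
    have h1 : ∀ p ∈ Finset.range (n + 1), g (n + 1 - (p + 1)) (p + 1) * X (p + 1) =
        ∑ k ∈ Finset.range p, -((χ (k + 1) - χ k) * (g (n - p) (p + 1) * w k p)) := by
      intro p _
      simp only [hX, Nat.add_sub_cancel, Nat.add_sub_add_right]
      rw [← Finset.sum_neg_distrib, Finset.mul_sum]
      exact Finset.sum_congr rfl fun k _ => by ring
    rw [Finset.sum_congr rfl h1, Finset.sum_comm' (t' := Finset.range n)
      (s' := fun k => Finset.Ico (k + 1) (n + 1))
      (by intro x y; simp only [Finset.mem_range, Finset.mem_Ico]; omega)]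
    have h2 : ∀ k ∈ Finset.range n, ∑ p ∈ Finset.Ico (k + 1) (n + 1),
        -((χ (k + 1) - χ k) * (g (n - p) (p + 1) * w k p)) =
        ∑ p ∈ Finset.range (k + 1), (χ (k + 1) - χ k) * (g (n - p) p * recSol g d p) := by
      intro k hk
      have hk' := Finset.mem_range.1 hk
      have h3 := hwrel k n hk' (by omega)
      rw [← Finset.sum_range_add_sum_Ico _ (show k + 1 ≤ n + 1 by omega)] at h3
      have h4 : ∑ p ∈ Finset.range (k + 1), g (n - p) (skip (k + 1) p) * w k p =
          ∑ p ∈ Finset.range (k + 1), g (n - p) p * recSol g d p := by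
        refine Finset.sum_congr rfl fun p hp => ?_
        have := Finset.mem_range.1 hp
        rw [hwlow k p (by omega), skip, if_pos this]
      have h5 : ∑ p ∈ Finset.Ico (k + 1) (n + 1), g (n - p) (skip (k + 1) p) * w k p =
          ∑ p ∈ Finset.Ico (k + 1) (n + 1), g (n - p) (p + 1) * w k p := by
        refine Finset.sum_congr rfl fun p hp => ?_
        have := (Finset.mem_Ico.1 hp).1
        rw [skip, if_neg (by omega)]
      rw [h4, h5] at h3
      rw [Finset.sum_neg_distrib, ← Finset.mul_sum, ← Finset.mul_sum]
      linear_combination (-(χ (k + 1) - χ k)) * h3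
    rw [Finset.sum_congr rfl h2, Finset.sum_comm' (t' := Finset.range n)
      (s' := fun p => Finset.Ico p n)
      (by intro x y; simp only [Finset.mem_range, Finset.mem_Ico]; omega)]
    have h6 : ∀ p ∈ Finset.range n, ∑ k ∈ Finset.Ico p n,
        (χ (k + 1) - χ k) * (g (n - p) p * recSol g d p) =
        (χ n - χ p) * (g (n - p) p * recSol g d p) := by
      intro p hp
      rw [← Finset.sum_mul, Finset.sum_Ico_sub χ (Finset.mem_range.1 hp).le]
    have h7 : ∑ p ∈ Finset.range n, (χ n - χ p) * (g (n - p) p * recSol g d p) =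
        ∑ p ∈ Finset.range (n + 1), (χ n - χ p) * (g (n - p) p * recSol g d p) := by
      rw [Finset.sum_range_succ, sub_self, zero_mul, add_zero]
    rw [Finset.sum_congr rfl h6, h7]
    simp only [sub_mul, Finset.sum_sub_distrib, ← Finset.mul_sum]
    rcases eq_or_ne n 0 with rfl | hn0
    · simp [hχ]
    · rw [recSol_relation hn0 (hd n hn0 (by omega))]
      simp
  change D (recSol g d n) = X n
  induction n using Nat.strong_induction_on with
  | _ n ih =>
    rcases n with _ | n
    · simp [hX]
    · have h1 := congrArg D (recSol_relation (g := g) (d := d) (Nat.succ_ne_zero n)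
        (hd _ (Nat.succ_ne_zero n) hn))
      rw [map_sum, map_zero] at h1
      simp only [Derivation.leibniz, smul_eq_mul, Finset.sum_add_distrib] at h1
      have h2 : ∑ m ∈ Finset.range (n + 1 + 1), recSol g d m * D (g (n + 1 - m) m) =
          ∑ m ∈ Finset.range (n + 1), χ m * (g (n - m) m * recSol g d m) := by
        rw [Finset.sum_range_succ, Nat.sub_self, hD0, mul_zero, add_zero]
        refine Finset.sum_congr rfl fun m hm => ?_
        have := Finset.mem_range.1 hm
        rw [show n + 1 - m = n - m + 1 by omega, hD]
        ring
      have h3 := hXrel n hn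
      rw [Finset.sum_range_succ, Nat.sub_self] at h1 h3
      have h4 : ∑ m ∈ Finset.range (n + 1), g (n + 1 - m) m * D (recSol g d m) =
          ∑ m ∈ Finset.range (n + 1), g (n + 1 - m) m * X m :=
        Finset.sum_congr rfl fun m hm => by
          have := Finset.mem_range.1 hm
          rw [ih m this (by omega)]
      rw [h2, h4] at h1
      have h5 := hd (n + 1) (Nat.succ_ne_zero n) hn
      linear_combination d (n + 1) * h1 - d (n + 1) * h3 -
        (D (recSol g d (n + 1)) - X (n + 1)) * h5

end recSol

/-! ### The deformed recursion -/

/-- Taylor coefficients at the origin. -/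
noncomputable def taylorCoef (f : ℂ → ℂ) (r : ℕ) : ℂ := iteratedDeriv r f 0 / r.factorial

lemma taylorCoef_mul {f g : ℂ → ℂ} (hf : Differentiable ℂ f) (hg : Differentiable ℂ g) (r : ℕ) :
    taylorCoef (fun x => f x * g x) r =
      ∑ i ∈ Finset.range (r + 1), taylorCoef f i * taylorCoef g (r - i) := by
  rw [taylorCoef, iteratedDeriv_fun_mul hf.contDiff.contDiffAt hg.contDiff.contDiffAt,
    Finset.sum_div]
  refine Finset.sum_congr rfl fun i hi => ?_
  have hi' := Nat.lt_succ_iff.1 (Finset.mem_range.1 hi)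
  rw [Nat.cast_choose ℂ hi', taylorCoef, taylorCoef]
  have h1 : (i.factorial : ℂ) ≠ 0 := by exact_mod_cast i.factorial_ne_zero
  have h2 : ((r - i).factorial : ℂ) ≠ 0 := by exact_mod_cast (r - i).factorial_ne_zero
  have h3 : (r.factorial : ℂ) ≠ 0 := by exact_mod_cast r.factorial_ne_zero
  field_simp

lemma taylorCoef_const_mul (a : ℂ) (f : ℂ → ℂ) (r : ℕ) :
    taylorCoef (fun x => a * f x) r = a * taylorCoef f r := by
  rw [taylorCoef, taylorCoef, iteratedDeriv_const_mul_field, mul_div_assoc]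

lemma taylorCoef_comp_mul {f : ℂ → ℂ} (hf : Differentiable ℂ f) (J : ℂ) (r : ℕ) :
    taylorCoef (fun x => f (J * x)) r = J ^ r * taylorCoef f r := by
  rw [taylorCoef, taylorCoef, iteratedDeriv_comp_const_mul hf.contDiff]
  simp [mul_div_assoc]

lemma taylorCoef_exp (a : ℂ) (r : ℕ) :
    taylorCoef (fun x => Complex.exp (a * x)) r = a ^ r / r.factorial := by
  have h := taylorCoef_comp_mul Complex.differentiable_exp a r
  rw [h, taylorCoef, iteratedDeriv_eq_iterate, Complex.iter_deriv_exp, Complex.exp_zero,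
    mul_one_div]

/-- The Taylor coefficients of `x ↦ θ(τ, z - x / 2πi)`, which are the coefficients
`(-1)^r θ^{(r)}(z) / r!` of the defining recursion. -/
noncomputable def thetaCoef (τ : UpperHalfPlane) (z : ℂ) (r : ℕ) : ℂ :=
  (-1) ^ r / r.factorial * thetaD r τ z

lemma differentiable_theta_shift (τ : UpperHalfPlane) (z : ℂ) :
    Differentiable ℂ fun x => theta τ (z - x / (2 * Real.pi * Complex.I)) := by
  refine (differentiable_theta τ).comp ?_
  fun_prop

lemma thetaCoef_eq (τ : UpperHalfPlane) (z : ℂ) (r : ℕ) :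
    thetaCoef τ z r = taylorCoef (fun x => theta τ (z - x / (2 * Real.pi * Complex.I))) r := by
  have hf : Differentiable ℂ fun x => theta τ (z + x) :=
    (differentiable_theta τ).comp (by fun_prop)
  have h := taylorCoef_comp_mul hf (-(1 / (2 * Real.pi * Complex.I))) r
  have h1 : (fun x => theta τ (z + -(1 / (2 * Real.pi * Complex.I)) * x)) =
      fun x => theta τ (z - x / (2 * Real.pi * Complex.I)) := by
    funext x; congr 1; ring
  rw [h1] at h
  rw [h, taylorCoef, thetaCoef, thetaD, iteratedDeriv_comp_const_add,
    neg_pow (1 / (2 * Real.pi * Complex.I) : ℂ)]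
  simp only [add_zero]
  ring

/-- The coefficients of the recursion deformed by the parameters `L`: the Taylor coefficients of
`exp(L m * x) θ(τ, Z m - x / 2πi)`, with values in a `ℂ`-algebra. -/
noncomputable def expTheta {R : Type*} [CommRing R] [Algebra ℂ R] (τ : UpperHalfPlane) (Z : ℕ → ℂ)
    (L : ℕ → R) (r m : ℕ) : R :=
  ∑ i ∈ Finset.range (r + 1),
    algebraMap ℂ R (1 / i.factorial * thetaCoef τ (Z m) (r - i)) * L m ^ i

/-- The solution of the deformed recursion. Here `Z m` stands for the partial sum
`z₁ + ⋯ + z_m`. -/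
noncomputable def deformedV {R : Type*} [CommRing R] [Algebra ℂ R] (τ : UpperHalfPlane) (Z : ℕ → ℂ)
    (L : ℕ → R) (n : ℕ) : R :=
  recSol (expTheta τ Z L) (fun m => algebraMap ℂ R (theta τ (Z m))⁻¹) n

lemma expTheta_zero_left {R : Type*} [CommRing R] [Algebra ℂ R] (τ : UpperHalfPlane) (Z : ℕ → ℂ)
    (L : ℕ → R) (m : ℕ) : expTheta τ Z L 0 m = algebraMap ℂ R (theta τ (Z m)) := by
  simp [expTheta, thetaCoef, thetaD]

lemma expTheta_diag {R : Type*} [CommRing R] [Algebra ℂ R] {τ : UpperHalfPlane} {Z : ℕ → ℂ}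
    {L : ℕ → R} {m : ℕ} (h : theta τ (Z m) ≠ 0) :
    expTheta τ Z L 0 m * algebraMap ℂ R (theta τ (Z m))⁻¹ = 1 := by
  rw [expTheta_zero_left, ← map_mul, mul_inv_cancel₀ h, map_one]

lemma expTheta_eq_taylorCoef (τ : UpperHalfPlane) (Z L : ℕ → ℂ) (r m : ℕ) :
    expTheta τ Z L r m = taylorCoef (fun x => Complex.exp (L m * x) *
      theta τ (Z m - x / (2 * Real.pi * Complex.I))) r := by
  rw [taylorCoef_mul (by fun_prop) (differentiable_theta_shift τ _), expTheta]
  refine Finset.sum_congr rfl fun i _ => ?_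
  rw [taylorCoef_exp, thetaCoef_eq]
  simp only [Algebra.algebraMap_self, RingHom.id_apply]
  ring

lemma map_deformedV {R S : Type*} [CommRing R] [Algebra ℂ R] [CommRing S] [Algebra ℂ S]
    (f : R →ₐ[ℂ] S) (τ : UpperHalfPlane) (Z : ℕ → ℂ) (L : ℕ → R) (n : ℕ) :
    f (deformedV τ Z L n) = deformedV τ Z (fun m => f (L m)) n := by
  have h := map_recSol (g := expTheta τ Z L) (d := fun m => algebraMap ℂ R (theta τ (Z m))⁻¹)
    (f : R →+* S) n
  simp only [RingHom.coe_coe] at h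
  rw [deformedV, h, deformedV]
  congr 1
  · funext r m
    simp [expTheta, map_sum]
  · funext m
    simp

/-- Covariance of the deformed recursion under `SL₂(ℤ)`. -/
theorem deformedV_modular (γ : SL(2, ℤ)) (τ : UpperHalfPlane) (Z L : ℕ → ℂ) (hZ : Z 0 = 0) {n : ℕ}
    (hne : ∀ m, m ≠ 0 → m ≤ n → theta τ (Z m) ≠ 0) :
    deformedV (γ • τ) (fun m => Z m / autom γ τ) L n =
      autom γ τ ^ n * (e (-(γ 1 0 : ℂ) * Z n ^ 2 / (2 * autom γ τ)) *
        deformedV τ Z (fun m => (L m - (γ 1 0 : ℂ) * Z m) / autom γ τ) n) := by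
  obtain ⟨A, hA, hmod⟩ := theta_modular γ τ
  have hJ := autom_ne_zero γ τ
  set J := autom γ τ
  set c : ℂ := (γ 1 0 : ℂ)
  set a : ℕ → ℂ := fun m => A * e (c * Z m ^ 2 / (2 * J)) with ha
  have ha0 : ∀ m, a m ≠ 0 := fun m => mul_ne_zero hA (e_ne_zero _)
  -- the part of the exponential factor that is quadratic in `x`; it does not depend on `m`
  let G : ℂ → ℂ := fun x => Complex.exp (c * J / (4 * Real.pi * Complex.I) * x ^ 2)
  have hG : Differentiable ℂ G := by simp only [G]; fun_prop
  have hpi : (Real.pi : ℂ) ≠ 0 := by simp [Real.pi_ne_zero]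
  have hI : Complex.I ≠ 0 := Complex.I_ne_zero
  have key := recSol_transform (N := n) (K := ℂ)
    (g := expTheta τ Z (fun m => (L m - c * Z m) / J))
    (g' := expTheta (γ • τ) (fun m => Z m / J) L)
    (d := fun m => algebraMap ℂ ℂ (theta τ (Z m))⁻¹)
    (d' := fun m => algebraMap ℂ ℂ (theta (γ • τ) (Z m / J))⁻¹)
    (by rw [expTheta_zero_left, hZ, theta_zero, map_zero])
    (fun m hm0 hm => expTheta_diag (hne m hm0 hm))
    (fun m hm0 hm => expTheta_diag (Z := fun m => Z m / J) (by
      rw [hmod]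
      exact mul_ne_zero (mul_ne_zero hA (e_ne_zero _)) (hne m hm0 hm)))
    a (taylorCoef G) J ha0 ?_ le_rfl
  · rw [deformedV, key, deformedV]
    have h0 : a 0 / a n = e (-c * Z n ^ 2 / (2 * J)) := by
      simp only [ha, hZ]
      rw [show -c * Z n ^ 2 / (2 * J) = -(c * Z n ^ 2 / (2 * J)) by ring, e_neg]
      have := e_ne_zero (c * Z n ^ 2 / (2 * J))
      simp only [ne_eq, OfNat.ofNat_ne_zero, not_false_eq_true, zero_pow, mul_zero, zero_div,
        e_zero, mul_one]
      field_simp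
    rw [h0]
    ring
  · intro r m _
    rw [expTheta_eq_taylorCoef]
    let h : ℂ → ℂ := fun x => Complex.exp ((L m - c * Z m) / J * x) *
      theta τ (Z m - x / (2 * Real.pi * Complex.I))
    have hh : Differentiable ℂ h :=
      Differentiable.mul (by fun_prop) (differentiable_theta_shift τ _)
    have hfun : (fun x => Complex.exp (L m * x) *
        theta (γ • τ) (Z m / J - x / (2 * Real.pi * Complex.I))) =
        fun x => a m * (G x * h (J * x)) := by
      funext x
      have h1 : Z m / J - x / (2 * Real.pi * Complex.I) =
          (Z m - J * x / (2 * Real.pi * Complex.I)) / J := by field_simp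
      rw [h1, hmod]
      have h2 : Complex.exp (L m * x) *
          e (c * (Z m - J * x / (2 * Real.pi * Complex.I)) ^ 2 / (2 * J)) =
          e (c * Z m ^ 2 / (2 * J)) * (G x * Complex.exp ((L m - c * Z m) / J * (J * x))) := by
        simp only [e, G, ← Complex.exp_add]
        congr 1
        have hI2 : Complex.I ^ 2 = -1 := Complex.I_sq
        field_simp
        ring
      simp only [h, ha]
      linear_combination A * theta τ (Z m - J * x / (2 * Real.pi * Complex.I)) * h2
    have hhJ : Differentiable ℂ fun x => h (J * x) := hh.comp (by fun_prop)
    rw [hfun, taylorCoef_const_mul, taylorCoef_mul hG hhJ]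
    congr 1
    refine Finset.sum_congr rfl fun i _ => ?_
    rw [taylorCoef_comp_mul hh, expTheta_eq_taylorCoef]

/-- Covariance of the deformed recursion under translation by lattice points. -/
theorem deformedV_elliptic (τ : UpperHalfPlane) (Z L : ℕ → ℂ) (l k : ℕ → ℤ) (hZ : Z 0 = 0)
    (hl : l 0 = 0) (hk : k 0 = 0) {n : ℕ} (hne : ∀ m, m ≠ 0 → m ≤ n → theta τ (Z m) ≠ 0) :
    deformedV τ (fun m => Z m + (l m * τ + k m)) L n =
      (-1) ^ (l n + k n) * (e ((l n : ℂ) ^ 2 * τ / 2 + l n * Z n) *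
        deformedV τ Z (fun m => L m + l m) n) := by
  set a : ℕ → ℂ := fun m => (-1) ^ (l m + k m) * e (-(l m : ℂ) ^ 2 * τ / 2 - l m * Z m) with ha
  have hs : ∀ j : ℤ, ((-1 : ℂ) ^ j) ≠ 0 := fun j => zpow_ne_zero _ (by norm_num)
  have ha0 : ∀ m, a m ≠ 0 := fun m => mul_ne_zero (hs _) (e_ne_zero _)
  have hpi : (Real.pi : ℂ) ≠ 0 := by simp [Real.pi_ne_zero]
  have hI : Complex.I ≠ 0 := Complex.I_ne_zero
  have key := recSol_transform (N := n) (K := ℂ)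
    (g := expTheta τ Z (fun m => L m + l m))
    (g' := expTheta τ (fun m => Z m + (l m * τ + k m)) L)
    (d := fun m => algebraMap ℂ ℂ (theta τ (Z m))⁻¹)
    (d' := fun m => algebraMap ℂ ℂ (theta τ (Z m + (l m * τ + k m)))⁻¹)
    (by rw [expTheta_zero_left, hZ, theta_zero, map_zero])
    (fun m hm0 hm => expTheta_diag (hne m hm0 hm))
    (fun m hm0 hm => expTheta_diag (Z := fun m => Z m + (l m * τ + k m)) (by
      rw [theta_add_lattice]
      exact mul_ne_zero (mul_ne_zero (hs _) (e_ne_zero _)) (hne m hm0 hm)))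
    a (fun i => if i = 0 then 1 else 0) 1 ha0 ?_ le_rfl
  · rw [deformedV, key, deformedV]
    have h0 : a 0 / a n = (-1) ^ (l n + k n) * e ((l n : ℂ) ^ 2 * τ / 2 + l n * Z n) := by
      simp only [ha, hZ, hl, hk]
      rw [show (l n : ℂ) ^ 2 * τ / 2 + l n * Z n = -(-(l n : ℂ) ^ 2 * τ / 2 - l n * Z n) by ring,
        e_neg]
      have h1 := e_ne_zero (-(l n : ℂ) ^ 2 * τ / 2 - l n * Z n)
      have h2 : (-1 : ℂ) ^ (l n + k n) * (-1) ^ (l n + k n) = 1 := by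
        rw [← mul_zpow]; norm_num
      have h3 := hs (l n + k n)
      simp
      field_simp
      rw [sq, h2]
    rw [h0]
    ring
  · intro r m _
    rw [Finset.sum_eq_single 0 (by intro i _ hi; simp [hi]) (by simp)]
    simp only [if_true, one_pow, one_mul, Nat.sub_zero]
    rw [expTheta_eq_taylorCoef, expTheta_eq_taylorCoef, ← taylorCoef_const_mul]
    congr 1
    funext x
    have h1 : Z m + (l m * τ + k m) - x / (2 * Real.pi * Complex.I) =
        Z m - x / (2 * Real.pi * Complex.I) + (l m * τ + k m) := by ring
    rw [h1, theta_add_lattice]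
    have h2 : Complex.exp (L m * x) *
        e (-(l m : ℂ) ^ 2 * τ / 2 - l m * (Z m - x / (2 * Real.pi * Complex.I))) =
        e (-(l m : ℂ) ^ 2 * τ / 2 - l m * Z m) * Complex.exp ((L m + l m) * x) := by
      simp only [e, ← Complex.exp_add]
      congr 1
      field_simp
      ring
    simp only [ha]
    linear_combination (-1 : ℂ) ^ (l m + k m) *
      theta τ (Z m - x / (2 * Real.pi * Complex.I)) * h2

/-! ### Algebraic independence of `ν` and the `ξ(τ, z_r)` -/

/-- The function `f` on `ℂ × ℂⁿ` has real directional derivatives at `x` in the directions `v` and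
`i v`, and the antiholomorphic derivative `2 ∂̄_v f`, which is their combination `a + i b`, is
equal to `d`. -/
def HasDbar {n : ℕ} (f : ℂ × (Fin n → ℂ) → ℂ) (x v : ℂ × (Fin n → ℂ)) (d : ℂ) : Prop :=
  ∃ a b : ℂ, HasDerivAt (fun t : ℝ => f (x + (t : ℂ) • v)) a 0 ∧
    HasDerivAt (fun t : ℝ => f (x + (t : ℂ) • (Complex.I • v))) b 0 ∧ a + Complex.I * b = d

lemma HasDbar.add {n : ℕ} {f g : ℂ × (Fin n → ℂ) → ℂ} {x v : ℂ × (Fin n → ℂ)} {d d' : ℂ}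
    (hf : HasDbar f x v d) (hg : HasDbar g x v d') :
    HasDbar (fun y => f y + g y) x v (d + d') := by
  obtain ⟨a, b, ha, hb, rfl⟩ := hf
  obtain ⟨a', b', ha', hb', rfl⟩ := hg
  exact ⟨_, _, ha.add ha', hb.add hb', by ring⟩

lemma HasDbar.mul {n : ℕ} {f g : ℂ × (Fin n → ℂ) → ℂ} {x v : ℂ × (Fin n → ℂ)} {d d' : ℂ}
    (hf : HasDbar f x v d) (hg : HasDbar g x v d') :
    HasDbar (fun y => f y * g y) x v (d * g x + f x * d') := by
  obtain ⟨a, b, ha, hb, rfl⟩ := hf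
  obtain ⟨a', b', ha', hb', rfl⟩ := hg
  refine ⟨_, _, ha.mul ha', hb.mul hb', ?_⟩
  simp
  ring

lemma HasDbar.unique {n : ℕ} {f : ℂ × (Fin n → ℂ) → ℂ} {x v : ℂ × (Fin n → ℂ)} {d d' : ℂ}
    (hf : HasDbar f x v d) (hg : HasDbar f x v d') : d = d' := by
  obtain ⟨a, b, ha, hb, rfl⟩ := hf
  obtain ⟨a', b', ha', hb', rfl⟩ := hg
  rw [ha.unique ha', hb.unique hb']

lemma hasDbar_of_analyticAt {n : ℕ} {f : ℂ × (Fin n → ℂ) → ℂ} {x : ℂ × (Fin n → ℂ)}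
    (hf : AnalyticAt ℂ f x) (v : ℂ × (Fin n → ℂ)) : HasDbar f x v 0 := by
  have h : ∀ w : ℂ × (Fin n → ℂ),
      HasDerivAt (fun t : ℝ => f (x + (t : ℂ) • w)) (fderiv ℂ f x w) 0 := by
    intro w
    have h1 : HasLineDerivAt ℂ f (fderiv ℂ f x w) x w :=
      hf.differentiableAt.hasFDerivAt.hasLineDerivAt w
    have h2 : HasDerivAt (fun t : ℂ => f (x + t • w)) (fderiv ℂ f x w) ((0 : ℝ) : ℂ) := by
      rw [Complex.ofReal_zero]; exact h1
    exact h2.comp_ofReal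
  refine ⟨_, _, h v, h (Complex.I • v), ?_⟩
  rw [map_smul, smul_eq_mul, ← mul_assoc, Complex.I_mul_I]
  ring

lemma HasDbar.congr {n : ℕ} {f g : ℂ × (Fin n → ℂ) → ℂ} {x v : ℂ × (Fin n → ℂ)} {d : ℂ}
    (hf : HasDbar f x v d) (h : f =ᶠ[𝓝 x] g) : HasDbar g x v d := by
  obtain ⟨a, b, ha, hb, rfl⟩ := hf
  have key : ∀ w : ℂ × (Fin n → ℂ), Tendsto (fun t : ℝ => x + (t : ℂ) • w) (𝓝 0) (𝓝 x) := by
    intro w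
    have : Continuous fun t : ℝ => x + (t : ℂ) • w := by fun_prop
    simpa using this.tendsto 0
  exact ⟨a, b, ha.congr_of_eventuallyEq ((key v).eventually (h.mono fun _ h => h.symm)),
    hb.congr_of_eventuallyEq ((key _).eventually (h.mono fun _ h => h.symm)), rfl⟩

/-- The values of `ν / 2πi` (coordinate `0`) and of `ξ(τ, z_r)` (coordinate `r + 1`), as real
functions on `ℂ × ℂⁿ`. -/
noncomputable def nuXiReal {n : ℕ} (x : ℂ × (Fin n → ℂ)) : Fin (n + 1) → ℝ :=
  Fin.cons (-(4 * Real.pi * x.1.im)⁻¹) fun r => (x.2 r).im / x.1.im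

/-- The values of `ν / 2πi` and of `ξ(τ, z_r)` as complex numbers. -/
noncomputable def nuXi {n : ℕ} (x : ℂ × (Fin n → ℂ)) (i : Fin (n + 1)) : ℂ := (nuXiReal x i : ℂ)

lemma hasDbar_nuXi {n : ℕ} {x : ℂ × (Fin n → ℂ)} (v : ℂ × (Fin n → ℂ))
    (i : Fin (n + 1)) (a b : ℝ)
    (ha : HasDerivAt (fun t : ℝ => nuXiReal (x + (t : ℂ) • v) i) a 0)
    (hb : HasDerivAt (fun t : ℝ => nuXiReal (x + (t : ℂ) • (Complex.I • v)) i) b 0) :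
    HasDbar (fun y => nuXi y i) x v (a + Complex.I * b) :=
  ⟨a, b, ha.ofReal_comp, hb.ofReal_comp, rfl⟩

lemma hasDbar_nuXi_snd {n : ℕ} {x : ℂ × (Fin n → ℂ)} (hx : x ∈ upper n) (r : Fin n)
    (i : Fin (n + 1)) :
    HasDbar (fun y => nuXi y i) x (0, Pi.single r 1)
      (if i = r.succ then Complex.I / x.1.im else 0) := by
  have hy : x.1.im ≠ 0 := ne_of_gt hx
  have h := hasDbar_nuXi (x := x) (0, Pi.single r 1) i 0 (if i = r.succ then 1 / x.1.im else 0) ?_ ?_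
  · convert h using 1
    split_ifs <;> simp [div_eq_mul_inv]
  · refine Fin.cases ?_ (fun s => ?_) i
    · simpa [nuXiReal] using hasDerivAt_const (0 : ℝ) _
    · by_cases hs : s = r
      · subst hs
        simpa [nuXiReal] using hasDerivAt_const (0 : ℝ) _
      · simpa [nuXiReal, hs] using hasDerivAt_const (0 : ℝ) _
  · refine Fin.cases ?_ (fun s => ?_) i
    · simpa [nuXiReal, (Fin.succ_ne_zero r).symm] using hasDerivAt_const (0 : ℝ) _
    · by_cases hs : s = r
      · subst hs
        have h1 : HasDerivAt (fun t : ℝ => ((x.2 s).im + t) / x.1.im) (1 / x.1.im) 0 :=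
          ((hasDerivAt_id (0 : ℝ)).const_add _).div_const _
        simpa [nuXiReal] using h1
      · have : s.succ ≠ r.succ := fun h => hs (Fin.succ_injective _ h)
        simpa [nuXiReal, hs, this] using hasDerivAt_const (0 : ℝ) _

lemma hasDbar_nuXi_fst {n : ℕ} {x : ℂ × (Fin n → ℂ)} (hx : x ∈ upper n) (i : Fin (n + 1)) :
    ∃ d, HasDbar (fun y => nuXi y i) x (1, 0) d ∧ (i = 0 → d ≠ 0) := by
  have hy : x.1.im ≠ 0 := ne_of_gt hx
  have key : HasDerivAt (fun t : ℝ => x.1.im + t) 1 0 := (hasDerivAt_id (0 : ℝ)).const_add _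
  refine Fin.cases ?_ (fun s => ?_) i
  · refine ⟨_, hasDbar_nuXi (1, 0) 0 0 (4 * Real.pi / (4 * Real.pi * x.1.im) ^ 2) ?_ ?_, ?_⟩
    · simpa [nuXiReal] using hasDerivAt_const (0 : ℝ) _
    · have h1 : HasDerivAt (fun t : ℝ => -(4 * Real.pi * (x.1.im + t))⁻¹)
          (-(-(4 * Real.pi * 1) / (4 * Real.pi * (x.1.im + 0)) ^ 2)) 0 :=
        ((key.const_mul (4 * Real.pi)).inv (by simp [hy, Real.pi_ne_zero])).neg
      convert h1 using 1
      · funext t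
        simp [nuXiReal]
      · simp [neg_div]
    · intro _
      have : (4 * Real.pi / (4 * Real.pi * x.1.im) ^ 2 : ℝ) ≠ 0 := by
        have := Real.pi_ne_zero
        positivity
      rw [Complex.ofReal_zero, zero_add]
      exact mul_ne_zero Complex.I_ne_zero (by exact_mod_cast this)
  · refine ⟨_, hasDbar_nuXi (1, 0) s.succ 0 (-((x.2 s).im * 1) / (x.1.im + 0) ^ 2) ?_ ?_,
      fun h => absurd h (Fin.succ_ne_zero s)⟩
    · simpa [nuXiReal] using hasDerivAt_const (0 : ℝ) _
    · have h1 : HasDerivAt (fun t : ℝ => (x.2 s).im / (x.1.im + t))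
          ((0 * (x.1.im + 0) - (x.2 s).im * 1) / (x.1.im + 0) ^ 2) 0 :=
        (hasDerivAt_const (0 : ℝ) _).div key (by simpa using hy)
      rw [zero_mul, zero_sub] at h1
      convert h1 using 1
      funext t
      simp [nuXiReal]

/-- The ring of functions analytic at `x`. -/
def analyticSubring {n : ℕ} (x : ℂ × (Fin n → ℂ)) : Subring (ℂ × (Fin n → ℂ) → ℂ) where
  carrier := {f | AnalyticAt ℂ f x}
  mul_mem' := fun hf hg => AnalyticAt.mul hf hg
  one_mem' := analyticAt_const
  add_mem' := fun hf hg => AnalyticAt.add hf hg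
  zero_mem' := analyticAt_const
  neg_mem' := fun hf => AnalyticAt.neg hf

/-- Evaluation at `y` of functions analytic at `x`. -/
def evalAt {n : ℕ} (x y : ℂ × (Fin n → ℂ)) : analyticSubring x →+* ℂ :=
  (Pi.evalRingHom _ y).comp (analyticSubring x).subtype

/-- The chain rule for the antiholomorphic derivative of a polynomial in `ν` and `ξ` with
holomorphic coefficients. -/
lemma hasDbar_eval {n : ℕ} {x₀ : ℂ × (Fin n → ℂ)} (hx₀ : x₀ ∈ upper n)
    (P : MvPolynomial (Fin (n + 1)) (analyticSubring x₀)) (v : ℂ × (Fin n → ℂ))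
    (δ : ℂ × (Fin n → ℂ) → Fin (n + 1) → ℂ)
    (hδ : ∀ x ∈ upper n, ∀ i, HasDbar (fun y => nuXi y i) x v (δ x i)) :
    ∀ᶠ x in 𝓝 x₀, HasDbar (fun y => MvPolynomial.eval (nuXi y) (MvPolynomial.map (evalAt x₀ y) P)) x v
      (∑ i, δ x i * MvPolynomial.eval (nuXi x)
        (MvPolynomial.map (evalAt x₀ x) (MvPolynomial.pderiv i P))) := by
  induction P using MvPolynomial.induction_on with
  | C a =>
    have ha : AnalyticAt ℂ (a : ℂ × (Fin n → ℂ) → ℂ) x₀ := a.2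
    filter_upwards [ha.eventually_analyticAt] with x hx
    simp only [MvPolynomial.map_C, MvPolynomial.eval_C, MvPolynomial.pderiv_C, map_zero, mul_zero,
      Finset.sum_const_zero]
    exact hasDbar_of_analyticAt hx v
  | add p q hp hq =>
    filter_upwards [hp, hq] with x hxp hxq
    simp only [map_add, mul_add, Finset.sum_add_distrib]
    exact hxp.add hxq
  | mul_X p i hp =>
    filter_upwards [hp, (isOpen_upper n).mem_nhds hx₀] with x hxp hx
    have h := hxp.mul (hδ x hx i)
    simp only [map_mul, MvPolynomial.map_X, MvPolynomial.eval_X]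
    convert h using 1
    simp only [Derivation.leibniz, smul_eq_mul, map_add, map_mul, mul_add, Finset.sum_add_distrib,
      MvPolynomial.map_X, MvPolynomial.eval_X]
    rw [add_comm]
    congr 1
    · rw [Finset.sum_mul]
      exact Finset.sum_congr rfl fun j _ => by ring
    · rw [Finset.sum_eq_single i]
      · simp; ring
      · intro j _ hj
        rw [MvPolynomial.pderiv_X_of_ne hj.symm]
        simp
      · simp

/-- The functions `ν` and `ξ(z_r)` are algebraically independent over the holomorphic functions:
apply antiholomorphic derivatives and induct on the degree. -/
theorem coeff_eq_zero_of_eval_nuXi {n : ℕ} {x₀ : ℂ × (Fin n → ℂ)} (hx₀ : x₀ ∈ upper n) :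
    ∀ (d : ℕ) (P : MvPolynomial (Fin (n + 1)) (analyticSubring x₀)),
    (∀ m ∈ P.support, m.degree ≤ d) →
    (∀ᶠ x in 𝓝 x₀, MvPolynomial.eval (nuXi x) (MvPolynomial.map (evalAt x₀ x) P) = 0) →
    ∀ m, ∀ᶠ x in 𝓝 x₀, evalAt x₀ x (P.coeff m) = 0 := by
  -- it suffices to treat the nonconstant coefficients
  have aux : ∀ P : MvPolynomial (Fin (n + 1)) (analyticSubring x₀),
      (∀ᶠ x in 𝓝 x₀, MvPolynomial.eval (nuXi x) (MvPolynomial.map (evalAt x₀ x) P) = 0) →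
      (∀ m, m ≠ 0 → ∀ᶠ x in 𝓝 x₀, evalAt x₀ x (P.coeff m) = 0) →
      ∀ m, ∀ᶠ x in 𝓝 x₀, evalAt x₀ x (P.coeff m) = 0 := by
    intro P h0 hP m
    by_cases hm : m = 0
    swap
    · exact hP m hm
    subst hm
    have hall : ∀ᶠ x in 𝓝 x₀, ∀ m ∈ P.support, m ≠ 0 →
        evalAt x₀ x (P.coeff m) = 0 := by
      rw [Finset.eventually_all]
      intro m _
      by_cases h : m = 0
      · simp [h]
      · filter_upwards [hP m h] with x hx _ using hx
    filter_upwards [h0, hall] with x hx hx2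
    have h1 : MvPolynomial.map (evalAt x₀ x) P =
        MvPolynomial.C (evalAt x₀ x (P.coeff 0)) := by
      ext m
      rw [MvPolynomial.coeff_map, MvPolynomial.coeff_C]
      split_ifs with h
      · subst h; rfl
      · by_cases hm : m ∈ P.support
        · exact hx2 m hm (Ne.symm h)
        · rw [MvPolynomial.notMem_support_iff.1 hm, map_zero]
    rwa [h1, MvPolynomial.eval_C] at hx
  intro d
  induction d with
  | zero =>
    intro P hd h0
    refine aux P h0 fun m hm => ?_
    have : m ∉ P.support := fun h => hm ((Finsupp.degree_eq_zero_iff m).1 (Nat.le_zero.1 (hd m h)))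
    rw [MvPolynomial.notMem_support_iff.1 this]
    exact Eventually.of_forall fun _ => rfl
  | succ d ih =>
    intro P hd h0
    have hdeg : ∀ i, ∀ m ∈ (MvPolynomial.pderiv i P).support, m.degree ≤ d := by
      intro i m hm
      rw [MvPolynomial.mem_support_iff, MvPolynomial.coeff_pderiv] at hm
      have h1 := hd (m + Finsupp.single i 1)
        (MvPolynomial.mem_support_iff.2 fun h => hm (by rw [h]; simp))
      rw [map_add, Finsupp.degree_single] at h1
      omega
    have hzero : ∀ᶠ x in 𝓝 x₀, ∀ v : ℂ × (Fin n → ℂ), HasDbar (fun y => MvPolynomial.eval (nuXi y)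
        (MvPolynomial.map (evalAt x₀ y) P)) x v 0 := by
      filter_upwards [h0.eventually_nhds] with x hx v
      exact (hasDbar_of_analyticAt (analyticAt_const (v := (0 : ℂ))) v).congr
        (hx.mono fun _ h => h.symm)
    have hu := (isOpen_upper n).mem_nhds hx₀
    -- the antiholomorphic derivative in the direction of `z_r` only sees `ξ(τ, z_r)`
    have hsucc : ∀ r : Fin n, ∀ᶠ x in 𝓝 x₀, MvPolynomial.eval (nuXi x)
        (MvPolynomial.map (evalAt x₀ x) (MvPolynomial.pderiv r.succ P)) = 0 := by
      intro r
      filter_upwards [hzero, hu, hasDbar_eval hx₀ P (0, Pi.single r 1) _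
        (fun x hx i => hasDbar_nuXi_snd hx r i)] with x hx1 hx hx2
      have h := hx2.unique (hx1 _)
      rw [Finset.sum_eq_single r.succ (by intro j _ hj; simp [hj]) (by simp), if_pos rfl] at h
      have hy : (x.1.im : ℂ) ≠ 0 := by exact_mod_cast ne_of_gt hx
      exact (mul_eq_zero.1 h).resolve_left (div_ne_zero Complex.I_ne_zero hy)
    -- in the direction of `τ`, the contributions of the `ξ(τ, z_r)` are already known to vanish
    have hpd : ∀ i, ∀ᶠ x in 𝓝 x₀, MvPolynomial.eval (nuXi x)
        (MvPolynomial.map (evalAt x₀ x) (MvPolynomial.pderiv i P)) = 0 := by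
      intro i
      refine Fin.cases ?_ hsucc i
      choose! δ hδ hδ0 using fun (x : ℂ × (Fin n → ℂ)) (hx : x ∈ upper n) (i : Fin (n + 1)) =>
        hasDbar_nuXi_fst hx i
      filter_upwards [hzero, hu, eventually_all.2 hsucc, hasDbar_eval hx₀ P (1, 0) δ hδ]
        with x hx1 hx hx3 hx2
      have h := hx2.unique (hx1 _)
      rw [Fin.sum_univ_succ, Finset.sum_eq_zero (fun r _ => by rw [hx3 r, mul_zero]),
        add_zero] at h
      exact (mul_eq_zero.1 h).resolve_left (hδ0 x hx 0 rfl)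
    refine aux P h0 fun m hm => ?_
    obtain ⟨i, hi⟩ := DFunLike.ne_iff.1 hm
    have hi' : m i ≠ 0 := hi
    have hm' : m - Finsupp.single i 1 + Finsupp.single i 1 = m := by
      refine tsub_add_cancel_of_le ?_
      rw [Finsupp.single_le_iff]
      omega
    filter_upwards [ih _ (hdeg i) (hpd i) (m - Finsupp.single i 1)] with x hx
    rw [MvPolynomial.coeff_pderiv, hm'] at hx
    have h2 : evalAt x₀ x (P.coeff m) *
        ((((m - Finsupp.single i 1 : Fin (n + 1) →₀ ℕ) i : ℕ) : ℂ) + 1) = 0 := by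
      simpa using hx
    refine (mul_eq_zero.1 h2).resolve_right ?_
    exact Nat.cast_add_one_ne_zero _

/-! ### Uniqueness of the expansion -/

/-- The set of points near which `φ` is given by an analytic function. -/
def analyticLocus {n : ℕ} (φ : Dom n → ℂ) : Set (Dom n) :=
  {p | ∃ f : ℂ × (Fin n → ℂ) → ℂ, AnalyticAt ℂ f p.incl ∧ ∀ᶠ x in 𝓝 p, φ x = f x.incl}

lemma isOpen_analyticLocus {n : ℕ} (φ : Dom n → ℂ) : IsOpen (analyticLocus φ) := by
  rw [isOpen_iff_mem_nhds]
  rintro p ⟨f, hf, h⟩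
  filter_upwards [eventually_nhds_incl.2 hf.eventually_analyticAt, h.eventually_nhds] with q h1 h2
  exact ⟨f, h1, h2⟩

lemma dense_analyticLocus {n : ℕ} {φ : Dom n → ℂ} (hφ : IsMeromorphic φ) :
    Dense (analyticLocus φ) := by
  intro p
  rw [mem_closure_iff_frequently]
  obtain ⟨g, h, hg, hh, hne, heq⟩ := hφ p
  have hfreq : ∃ᶠ x in 𝓝 p, h (Dom.incl x) ≠ 0 := by
    rw [← eventually_nhds_incl] at hne
    exact not_eventually.1 hne
  refine (hfreq.and_eventually ((eventually_nhds_incl.2 hg.eventually_analyticAt).and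
    ((eventually_nhds_incl.2 hh.eventually_analyticAt).and heq.eventually_nhds))).mono ?_
  rintro q ⟨h1, h2, h3, h4⟩
  refine ⟨fun x => g x / h x, h2.div h3 h1, ?_⟩
  have h5 : ∀ᶠ x in 𝓝 q, h (Dom.incl x) ≠ 0 :=
    eventually_nhds_incl.2 (h3.continuousAt.eventually_ne h1)
  filter_upwards [h4, h5] with x hx hx' using hx hx'

lemma analyticLocus_mem_residual {n : ℕ} {φ : Dom n → ℂ} (hφ : IsMeromorphic φ) :
    analyticLocus φ ∈ residual (Dom n) :=
  residual_of_dense_open (isOpen_analyticLocus φ) (dense_analyticLocus hφ)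

/-- Generic identities are manipulated as identities on residual sets, which are stable under
countable intersections and under the action of the Jacobi group. -/
lemma GenEq.residual {n : ℕ} {φ ψ : Dom n → ℂ} (h : GenEq φ ψ) :
    ∀ᶠ p in residual (Dom n), φ p = ψ p :=
  mem_of_superset (residual_of_dense_open isOpen_interior h) interior_subset

instance baireSpace_dom (n : ℕ) : BaireSpace (Dom n) :=
  isOpenEmbedding_incl.baireSpace

lemma eventually_eq_of_dense {n : ℕ} {f g : ℂ × (Fin n → ℂ) → ℂ} {p : Dom n}
    (hf : AnalyticAt ℂ f p.incl) (hg : AnalyticAt ℂ g p.incl) {S : Set (Dom n)} (hS : Dense S)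
    (h : ∀ᶠ x in 𝓝 p, x ∈ S → f x.incl = g x.incl) : ∀ᶠ x in 𝓝 p, f x.incl = g x.incl := by
  filter_upwards [eventually_nhds_incl.2 hf.eventually_analyticAt,
    eventually_nhds_incl.2 hg.eventually_analyticAt, h.eventually_nhds] with q h1 h2 h3
  by_contra hne
  have hc1 : ContinuousAt (fun x : Dom n => f x.incl) q :=
    ContinuousAt.comp (g := f) h1.continuousAt continuous_incl.continuousAt
  have hc2 : ContinuousAt (fun x : Dom n => g x.incl) q :=
    ContinuousAt.comp (g := g) h2.continuousAt continuous_incl.continuousAt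
  have h5 : ∀ᶠ x in 𝓝 q, f x.incl ≠ g x.incl := (hc1.ne_iff_eventually_ne hc2).1 hne
  have h6 := hS q
  rw [mem_closure_iff_frequently] at h6
  obtain ⟨x, hx1, hx2, hx3⟩ := (h6.and_eventually (h5.and h3)).exists
  exact hx2 (hx3 hx1)

/-- Meromorphic functions that agree on a residual set are equal. -/
lemma genEq_of_residual {n : ℕ} {φ ψ : Dom n → ℂ} (hφ : IsMeromorphic φ) (hψ : IsMeromorphic ψ)
    (h : ∀ᶠ p in residual (Dom n), φ p = ψ p) : GenEq φ ψ := by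
  have hd : Dense (analyticLocus φ ∩ analyticLocus ψ) :=
    (dense_analyticLocus hφ).inter_of_isOpen_left (dense_analyticLocus hψ)
      (isOpen_analyticLocus φ)
  refine hd.mono fun p hp => ?_
  obtain ⟨⟨f, hf, hf'⟩, ⟨g, hg, hg'⟩⟩ := hp
  rw [mem_interior_iff_mem_nhds]
  have hcl : ∀ᶠ q in 𝓝 p, f q.incl = g q.incl := by
    refine eventually_eq_of_dense hf hg (dense_of_mem_residual h) ?_
    filter_upwards [hf', hg'] with q h1 h2 h3
    rw [← h1, ← h2]
    exact h3
  filter_upwards [hcl, hf', hg'] with q h1 h2 h3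
  exact (h2.trans h1).trans h3.symm

/-- The automorphy factor as a function on `ℂ × ℂⁿ`. -/
def jac {n : ℕ} (γ : SL(2, ℤ)) (x : ℂ × (Fin n → ℂ)) : ℂ := (γ 1 0 : ℂ) * x.1 + (γ 1 1 : ℂ)

/-- The action of an element of `SL₂(ℤ)` followed by a translation by `μ ∈ ℤⁿ`. -/
noncomputable def act {n : ℕ} (γ : SL(2, ℤ)) (mu : Fin n → ℤ) (p : Dom n) : Dom n :=
  (γ • p.1, fun r => (p.2 r + mu r) / autom γ p.1)

/-- The factor of automorphy belonging to `act γ mu`. -/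
noncomputable def actFactor {n : ℕ} (k : ℤ) (M : Matrix (Fin n) (Fin n) ℚ) (γ : SL(2, ℤ))
    (mu : Fin n → ℤ) (x : ℂ × (Fin n → ℂ)) : ℂ :=
  e (bil M (fun r => (mu r : ℂ)) (fun r => (mu r : ℂ))) *
    ((jac γ x) ^ (-k) * e (-(γ 1 0 : ℂ) * bil M (fun r => x.2 r + mu r) (fun r => x.2 r + mu r) /
      jac γ x))

lemma slash_eq_actFactor_mul {n : ℕ} (k : ℤ) (M : Matrix (Fin n) (Fin n) ℚ) (Φ : Dom n → ℂ)
    (γ : SL(2, ℤ)) (mu : Fin n → ℤ) (p : Dom n) :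
    slashEll M (slashSL k M Φ γ) (fun r => (((0 : Fin n → ℤ) r : ℤ) : ℝ)) (fun r => (mu r : ℝ)) p =
      actFactor k M γ mu p.incl * Φ (act γ mu p) := by
  have h1 : (p.2 + torsionPoint (fun r => (((0 : Fin n → ℤ) r : ℤ) : ℝ)) (fun r => (mu r : ℝ)) p.1)
      = fun r => p.2 r + mu r := by
    funext r; simp [torsionPoint]
  have h2 : ∀ w, bil M (fun r => ((((0 : Fin n → ℤ) r : ℤ) : ℝ) : ℂ)) w = 0 := by
    intro w; simp [bil]
  rw [slashEll, h1, h2, e_zero, mul_one, slashSL, actFactor]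
  simp only [Pi.zero_apply, Int.cast_zero, Complex.ofReal_zero, zero_add, Complex.ofReal_intCast]
  rw [mul_assoc (e _) (_ * _)]
  rfl

/-- The substitution by which `act γ mu` transforms `ν / 2πi` and the `ξ(τ, z_r)`. -/
noncomputable def actSubst {n : ℕ} (γ : SL(2, ℤ)) (mu : Fin n → ℤ) (x : ℂ × (Fin n → ℂ)) :
    Fin (n + 1) → MvPolynomial (Fin (n + 1)) ℂ :=
  Fin.cons
    (MvPolynomial.C (jac γ x ^ 2) * MvPolynomial.X 0 -
      MvPolynomial.C ((γ 1 0 : ℂ) * jac γ x / (2 * Real.pi * Complex.I)))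
    fun r => MvPolynomial.C (jac γ x) * MvPolynomial.X r.succ -
      MvPolynomial.C ((γ 1 0 : ℂ) * (x.2 r + mu r))

lemma im_smul (γ : SL(2, ℤ)) (τ : UpperHalfPlane) :
    (γ • τ).im = τ.im / Complex.normSq (autom γ τ) := by
  rw [ModularGroup.im_smul_eq_div_normSq, ModularGroup.denom_apply]
  rfl

lemma nuXi_incl_zero {n : ℕ} (p : Dom n) :
    nuXi p.incl 0 = nu p.1 / (2 * Real.pi * Complex.I) := by
  have h : (p.1.im : ℂ) ≠ 0 := by exact_mod_cast p.1.im_ne_zero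
  have hpi : (Real.pi : ℂ) ≠ 0 := by exact_mod_cast Real.pi_ne_zero
  simp only [nuXi, nuXiReal, Fin.cons_zero, nu, Dom.incl, UpperHalfPlane.coe_im]
  push_cast
  field_simp
  rw [Complex.I_sq]; ring

lemma nuXi_incl_succ {n : ℕ} (p : Dom n) (r : Fin n) : nuXi p.incl r.succ = xi p.1 (p.2 r) := by
  simp [nuXi, nuXiReal, Dom.incl, xi]

lemma xi_div_autom (γ : SL(2, ℤ)) (τ : UpperHalfPlane) (w : ℂ) :
    xi (γ • τ) (w / autom γ τ) = autom γ τ * xi τ w - (γ 1 0 : ℂ) * w := by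
  have hJ := autom_ne_zero γ τ
  have hy : τ.im ≠ 0 := τ.im_ne_zero
  have hN : Complex.normSq (autom γ τ) ≠ 0 := by simpa using hJ
  have hre : (autom γ τ).re = γ 1 0 * τ.re + γ 1 1 := by simp [autom]
  have him : (autom γ τ).im = γ 1 0 * τ.im := by simp [autom]
  have h1 : (w / autom γ τ).im / (γ • τ).im =
      (w.im * (autom γ τ).re - w.re * (autom γ τ).im) / τ.im := by
    rw [im_smul, Complex.div_im]
    field_simp
  rw [xi, h1, xi]
  apply Complex.ext
  · simp [hre, him]
    field_simp
  · simp [hre, him]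
    field_simp
    ring

lemma nu_smul (γ : SL(2, ℤ)) (τ : UpperHalfPlane) :
    nu (γ • τ) = autom γ τ ^ 2 * nu τ - (γ 1 0 : ℂ) * autom γ τ := by
  have hJ := autom_ne_zero γ τ
  have hy : (τ.im : ℂ) ≠ 0 := by exact_mod_cast τ.im_ne_zero
  have hN : (Complex.normSq (autom γ τ) : ℂ) ≠ 0 := by
    rw [Complex.ofReal_ne_zero]; simpa using hJ
  have h1 : (Complex.normSq (autom γ τ) : ℂ) =
      autom γ τ * (autom γ τ - 2 * Complex.I * (γ 1 0 * τ.im)) := by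
    rw [Complex.normSq_eq_conj_mul_self, mul_comm]
    congr 1
    apply Complex.ext <;> simp [autom]
    ring
  rw [nu, im_smul, nu]
  push_cast
  have hI := Complex.I_ne_zero
  field_simp
  rw [h1]
  ring

lemma nuXi_act {n : ℕ} (γ : SL(2, ℤ)) (mu : Fin n → ℤ) (p : Dom n) (i : Fin (n + 1)) :
    nuXi (act γ mu p).incl i = MvPolynomial.eval (nuXi p.incl) (actSubst γ mu p.incl i) := by
  refine Fin.cases ?_ (fun r => ?_) i
  · rw [nuXi_incl_zero]
    simp only [actSubst, Fin.cons_zero, map_sub, map_mul, MvPolynomial.eval_C, MvPolynomial.eval_X]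
    rw [nuXi_incl_zero, act, nu_smul]
    change _ = autom γ p.1 ^ 2 * _ - _ * autom γ p.1 / _
    ring
  · rw [nuXi_incl_succ]
    simp only [actSubst, Fin.cons_succ, map_sub, map_mul, MvPolynomial.eval_C, MvPolynomial.eval_X]
    rw [nuXi_incl_succ, act, xi_div_autom]
    have : xi p.1 (p.2 r + mu r) = xi p.1 (p.2 r) := by simp [xi]
    rw [this]
    rfl

lemma continuous_smul_upperHalfPlane (γ : SL(2, ℤ)) :
    Continuous fun τ : UpperHalfPlane => γ • τ := by
  rw [UpperHalfPlane.isOpenEmbedding_coe.isInducing.continuous_iff]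
  have : (UpperHalfPlane.coe ∘ fun τ => γ • τ) =
      fun τ : UpperHalfPlane => ((γ 0 0 : ℂ) * τ + (γ 0 1 : ℂ)) / autom γ τ := by
    funext τ; exact coe_smul_eq γ τ
  rw [this]
  refine Continuous.div ?_ ?_ (autom_ne_zero γ)
  · fun_prop
  · unfold autom; fun_prop

lemma continuous_autom (γ : SL(2, ℤ)) : Continuous (autom γ) := by
  unfold autom; fun_prop

/-- `act γ mu` as a homeomorphism. -/
noncomputable def actHomeomorph {n : ℕ} (γ : SL(2, ℤ)) (mu : Fin n → ℤ) : Dom n ≃ₜ Dom n where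
  toFun := act γ mu
  invFun := fun p => (γ⁻¹ • p.1, fun r => p.2 r * autom γ (γ⁻¹ • p.1) - mu r)
  left_inv := fun p => by
    have := autom_ne_zero γ p.1
    refine Prod.ext (by simp [act]) (funext fun r => ?_)
    simp [act, this]
  right_inv := fun p => by
    refine Prod.ext (by simp [act]) (funext fun r => ?_)
    simp only [act, sub_add_cancel]
    rw [mul_div_cancel_right₀ _ (autom_ne_zero γ (γ⁻¹ • p.1))]
  continuous_toFun := by
    refine ((continuous_smul_upperHalfPlane γ).comp continuous_fst).prodMk ?_
    refine continuous_pi fun r => ?_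
    refine Continuous.div (by fun_prop) ((continuous_autom γ).comp continuous_fst)
      fun p => autom_ne_zero γ p.1
  continuous_invFun := by
    have h := (continuous_smul_upperHalfPlane γ⁻¹).comp (continuous_fst (X := UpperHalfPlane) (Y := Fin n → ℂ))
    refine h.prodMk (continuous_pi fun r => ?_)
    have h2 := (continuous_autom γ).comp h
    refine Continuous.sub (Continuous.mul (by fun_prop) h2) continuous_const

lemma tendsto_act_residual {n : ℕ} (γ : SL(2, ℤ)) (mu : Fin n → ℤ) :
    Tendsto (act γ mu) (residual (Dom n)) (residual (Dom n)) :=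
  tendsto_residual_of_isOpenMap (actHomeomorph γ mu).continuous (actHomeomorph γ mu).isOpenMap

/-- The polynomial in `ν / 2πi` (variable `0`) and `ξ(τ, z_r)` (variable `r + 1`) attached to a
family, with its coefficients evaluated at `p`. -/
noncomputable def familyPoly {n : ℕ} (c : Family n) (p : Dom n) : MvPolynomial (Fin (n + 1)) ℂ :=
  ∑ ij ∈ c.support, MvPolynomial.monomial (Finsupp.cons ij.1 ij.2) (c ij p)

lemma coeff_familyPoly {n : ℕ} (c : Family n) (p : Dom n) (i : ℕ) (j : Fin n →₀ ℕ) :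
    (familyPoly c p).coeff (Finsupp.cons i j) = c (i, j) p := by
  rw [familyPoly, MvPolynomial.coeff_sum]
  simp only [MvPolynomial.coeff_monomial]
  rw [Finset.sum_eq_single (i, j)]
  · simp
  · rintro ⟨i', j'⟩ _ hne
    refine if_neg fun h => hne ?_
    obtain ⟨h1, h2⟩ := Finsupp.cons_injective2 h
    exact Prod.ext h1 h2
  · intro h
    rw [Finsupp.notMem_support_iff.1 h]
    simp

lemma toFun_eq_eval {n : ℕ} (c : Family n) (p : Dom n) :
    c.toFun p = MvPolynomial.eval (nuXi p.incl) (familyPoly c p) := by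
  rw [Family.toFun, familyPoly, map_sum, Finsupp.sum]
  refine Finset.sum_congr rfl fun ij _ => ?_
  rw [MvPolynomial.eval_monomial, Finsupp.prod_fintype _ _ (by simp), Fin.prod_univ_succ]
  simp only [Finsupp.cons_zero, Finsupp.cons_succ, nuXi_incl_zero, nuXi_incl_succ, mul_assoc]

lemma analyticAt_jac {n : ℕ} (γ : SL(2, ℤ)) (x : ℂ × (Fin n → ℂ)) : AnalyticAt ℂ (jac γ) x := by
  exact (analyticAt_const.mul analyticAt_fst).add analyticAt_const

lemma analyticAt_coord {n : ℕ} (r : Fin n) (x : ℂ × (Fin n → ℂ)) :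
    AnalyticAt ℂ (fun y : ℂ × (Fin n → ℂ) => y.2 r) x :=
  ((ContinuousLinearMap.proj r).comp (ContinuousLinearMap.snd ℂ ℂ (Fin n → ℂ))).analyticAt x

lemma jac_incl_ne_zero {n : ℕ} (γ : SL(2, ℤ)) (p : Dom n) : jac γ p.incl ≠ 0 :=
  autom_ne_zero γ p.1

lemma analyticAt_bil {n : ℕ} (M : Matrix (Fin n) (Fin n) ℚ) {f g : ℂ × (Fin n → ℂ) → Fin n → ℂ}
    {x : ℂ × (Fin n → ℂ)} (hf : ∀ r, AnalyticAt ℂ (fun y => f y r) x)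
    (hg : ∀ r, AnalyticAt ℂ (fun y => g y r) x) : AnalyticAt ℂ (fun y => bil M (f y) (g y)) x := by
  unfold bil
  exact Finset.analyticAt_fun_sum _ fun r _ => Finset.analyticAt_fun_sum _ fun s _ =>
    ((hf r).mul analyticAt_const).mul (hg s)

lemma analyticAt_actFactor {n : ℕ} (k : ℤ) (M : Matrix (Fin n) (Fin n) ℚ) (γ : SL(2, ℤ))
    (mu : Fin n → ℤ) (p : Dom n) : AnalyticAt ℂ (actFactor k M γ mu) p.incl := by
  have hJ := jac_incl_ne_zero γ p
  unfold actFactor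
  refine analyticAt_const.mul (((analyticAt_jac γ _).zpow hJ).mul (AnalyticAt.e_comp ?_))
  refine AnalyticAt.div (analyticAt_const.mul ?_) (analyticAt_jac γ _) hJ
  exact analyticAt_bil M (fun r => (analyticAt_coord r _).add analyticAt_const)
    fun r => (analyticAt_coord r _).add analyticAt_const

/-- `act γ mu` as a map on `ℂ × ℂⁿ`. -/
noncomputable def actC {n : ℕ} (γ : SL(2, ℤ)) (mu : Fin n → ℤ) (x : ℂ × (Fin n → ℂ)) :
    ℂ × (Fin n → ℂ) :=
  (((γ 0 0 : ℂ) * x.1 + (γ 0 1 : ℂ)) / jac γ x, fun r => (x.2 r + mu r) / jac γ x)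

lemma actC_incl {n : ℕ} (γ : SL(2, ℤ)) (mu : Fin n → ℤ) (p : Dom n) :
    actC γ mu p.incl = (act γ mu p).incl :=
  Prod.ext (coe_smul_eq γ p.1).symm rfl

lemma analyticAt_actC {n : ℕ} (γ : SL(2, ℤ)) (mu : Fin n → ℤ) (p : Dom n) :
    AnalyticAt ℂ (actC γ mu) p.incl := by
  have hJ := jac_incl_ne_zero γ p
  refine AnalyticAt.prod ?_ (AnalyticAt.pi fun r => ?_)
  · exact ((analyticAt_const.mul analyticAt_fst).add analyticAt_const).div (analyticAt_jac γ _) hJ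
  · exact ((analyticAt_coord r _).add analyticAt_const).div (analyticAt_jac γ _) hJ

/-- The polynomials `Q p` are generically invariant under all `act γ mu`, up to the factors
`f γ mu`. -/
def IsInvariant {n : ℕ} (f : SL(2, ℤ) → (Fin n → ℤ) → ℂ × (Fin n → ℂ) → ℂ)
    (Q : Dom n → MvPolynomial (Fin (n + 1)) ℂ) : Prop :=
  ∀ γ mu, ∀ᶠ p in residual (Dom n),
    MvPolynomial.C (f γ mu p.incl) * MvPolynomial.bind₁ (actSubst γ mu p.incl) (Q (act γ mu p)) =
      Q p

lemma exists_lift_const {n : ℕ} {x₀ : ℂ × (Fin n → ℂ)} {f : ℂ × (Fin n → ℂ) → ℂ}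
    (hf : AnalyticAt ℂ f x₀) : ∃ a : analyticSubring x₀, ∀ x, evalAt x₀ x a = f x :=
  ⟨⟨f, hf⟩, fun _ => rfl⟩

lemma exists_lift_sum {n : ℕ} {x₀ : ℂ × (Fin n → ℂ)} {ι : Type*} (S : Finset ι)
    (m : ι → Fin (n + 1) →₀ ℕ) (f : ι → ℂ × (Fin n → ℂ) → ℂ)
    (hf : ∀ i ∈ S, AnalyticAt ℂ (f i) x₀) :
    ∃ P : MvPolynomial (Fin (n + 1)) (analyticSubring x₀), ∀ x,
      MvPolynomial.map (evalAt x₀ x) P = ∑ i ∈ S, MvPolynomial.monomial (m i) (f i x) := by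
  choose! a ha using fun i (hi : i ∈ S) => exists_lift_const (hf i hi)
  refine ⟨∑ i ∈ S, MvPolynomial.monomial (m i) (a i), fun x => ?_⟩
  rw [map_sum]
  refine Finset.sum_congr rfl fun i hi => ?_
  rw [MvPolynomial.map_monomial, ha i hi]

lemma exists_lift_actSubst {n : ℕ} (γ : SL(2, ℤ)) (mu : Fin n → ℤ) (x₀ : ℂ × (Fin n → ℂ)) :
    ∃ T : Fin (n + 1) → MvPolynomial (Fin (n + 1)) (analyticSubring x₀), ∀ x,
      (fun i => MvPolynomial.map (evalAt x₀ x) (T i)) = actSubst γ mu x := by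
  obtain ⟨J, hJ⟩ := exists_lift_const (analyticAt_jac γ x₀)
  obtain ⟨κ, hκ⟩ := exists_lift_const (x₀ := x₀)
    (f := fun x => (γ 1 0 : ℂ) * jac γ x / (2 * Real.pi * Complex.I))
    ((analyticAt_const.mul (analyticAt_jac γ x₀)).div_const)
  choose z hz using fun r : Fin n => exists_lift_const (x₀ := x₀)
    (f := fun x => (γ 1 0 : ℂ) * (x.2 r + mu r))
    (analyticAt_const.mul ((analyticAt_coord r x₀).add analyticAt_const))
  refine ⟨Fin.cons (MvPolynomial.C (J ^ 2) * MvPolynomial.X 0 - MvPolynomial.C κ)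
    fun r => MvPolynomial.C J * MvPolynomial.X r.succ - MvPolynomial.C (z r), fun x => ?_⟩
  funext i
  refine Fin.cases ?_ (fun r => ?_) i
  · simp only [actSubst, Fin.cons_zero, map_sub, map_mul, MvPolynomial.map_C,
      MvPolynomial.map_X, map_pow, hJ, hκ]
  · simp only [actSubst, Fin.cons_succ, map_sub, map_mul, MvPolynomial.map_C,
      MvPolynomial.map_X, hJ, hz]

/-- By algebraic independence of `ν` and the `ξ(τ, z_r)`, the invariance of an almost Jacobi form
holds coefficientwise. -/
theorem isInvariant_familyPoly {n : ℕ} {k : ℤ} {M : Matrix (Fin n) (Fin n) ℚ} {c : Family n}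
    (hc : IsAlmostJacobi k M c) : IsInvariant (actFactor k M) (familyPoly c) := by
  intro γ mu
  have hmer : ∀ᶠ p in residual (Dom n), ∀ ij ∈ c.support, p ∈ analyticLocus (c ij) := by
    rw [Finset.eventually_all]
    exact fun ij _ => analyticLocus_mem_residual (hc.1 ij).1.1
  have hinv : ∀ᶠ p in residual (Dom n), p ∈ interior {p |
      slashEll M (slashSL k M c.toFun γ) (fun r => (((0 : Fin n → ℤ) r : ℤ) : ℝ))
        (fun r => (mu r : ℝ)) p = c.toFun p} :=
    residual_of_dense_open isOpen_interior (hc.2 γ 0 mu)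
  filter_upwards [hmer, (tendsto_act_residual γ mu).eventually hmer, hinv] with p h1 h2 h3
  choose! f hf hf' using h1
  choose! g hg hg' using h2
  -- near `p`, both sides are polynomials with analytic coefficients
  have hgA : ∀ ij ∈ c.support, AnalyticAt ℂ (fun x => g ij (actC γ mu x)) p.incl := by
    intro ij hij
    refine AnalyticAt.comp (g := g ij) ?_ (analyticAt_actC γ mu p)
    rw [actC_incl]; exact hg ij hij
  obtain ⟨T, hT⟩ := exists_lift_actSubst γ mu p.incl
  obtain ⟨Φ, hΦ⟩ := exists_lift_const (analyticAt_actFactor k M γ mu p)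
  obtain ⟨P₁, hP₁⟩ := exists_lift_sum c.support (fun ij => Finsupp.cons ij.1 ij.2) _ hgA
  obtain ⟨P₂, hP₂⟩ := exists_lift_sum c.support (fun ij => Finsupp.cons ij.1 ij.2) _ hf
  obtain ⟨P, hPdef⟩ : ∃ P, P = MvPolynomial.C Φ * MvPolynomial.bind₁ T P₁ - P₂ := ⟨_, rfl⟩
  have hmap : ∀ᶠ q in 𝓝 p, MvPolynomial.map (evalAt p.incl q.incl) P =
      MvPolynomial.C (actFactor k M γ mu q.incl) *
        MvPolynomial.bind₁ (actSubst γ mu q.incl) (familyPoly c (act γ mu q)) -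
        familyPoly c q := by
    have e1 : ∀ᶠ q in 𝓝 p, ∀ ij ∈ c.support, c ij q = f ij q.incl := by
      rw [Finset.eventually_all]; exact hf'
    have e2 : ∀ᶠ q in 𝓝 p, ∀ ij ∈ c.support,
        c ij (act γ mu q) = g ij (act γ mu q).incl := by
      have : ∀ᶠ q in 𝓝 (act γ mu p), ∀ ij ∈ c.support, c ij q = g ij q.incl := by
        rw [Finset.eventually_all]; exact hg'
      exact (actHomeomorph γ mu).continuous.continuousAt.eventually this
    filter_upwards [e1, e2] with q hq1 hq2
    have s1 : ∑ ij ∈ c.support, MvPolynomial.monomial (Finsupp.cons ij.1 ij.2)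
        (g ij (actC γ mu q.incl)) = familyPoly c (act γ mu q) := by
      rw [actC_incl]
      exact Finset.sum_congr rfl fun ij hij => by rw [hq2 ij hij]
    have s2 : ∑ ij ∈ c.support, MvPolynomial.monomial (Finsupp.cons ij.1 ij.2)
        (f ij q.incl) = familyPoly c q :=
      Finset.sum_congr rfl fun ij hij => by rw [hq1 ij hij]
    rw [hPdef, map_sub, map_mul, MvPolynomial.map_C, MvPolynomial.map_bind₁, hT, hΦ, hP₁, hP₂,
      s1, s2]
  have hzero : ∀ᶠ x in 𝓝 p.incl,
      MvPolynomial.eval (nuXi x) (MvPolynomial.map (evalAt p.incl x) P) = 0 := by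
    rw [← eventually_nhds_incl]
    filter_upwards [hmap, mem_interior_iff_mem_nhds.1 h3] with q hq hq2
    rw [hq, map_sub, map_mul, MvPolynomial.eval_C, ← toFun_eq_eval, sub_eq_zero,
      MvPolynomial.eval, MvPolynomial.eval₂Hom_bind₁]
    rw [slash_eq_actFactor_mul, toFun_eq_eval c (act γ mu q)] at hq2
    rw [← hq2]
    congr 2
    congr 1
    funext i
    exact (nuXi_act γ mu q i).symm
  have hcoef := coeff_eq_zero_of_eval_nuXi (incl_mem_upper p) (P.support.sup Finsupp.degree) P
    (fun m hm => Finset.le_sup (f := Finsupp.degree) hm) hzero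
  have hP : MvPolynomial.map (evalAt p.incl p.incl) P = 0 := by
    ext m
    rw [MvPolynomial.coeff_map, MvPolynomial.coeff_zero]
    exact (hcoef m).self_of_nhds
  rw [hmap.self_of_nhds, sub_eq_zero] at hP
  exact hP

lemma IsInvariant.sub {n : ℕ} {f : SL(2, ℤ) → (Fin n → ℤ) → ℂ × (Fin n → ℂ) → ℂ}
    {Q Q' : Dom n → MvPolynomial (Fin (n + 1)) ℂ} (h : IsInvariant f Q) (h' : IsInvariant f Q') :
    IsInvariant f (fun p => Q p - Q' p) := by
  intro γ mu
  filter_upwards [h γ mu, h' γ mu] with p h1 h2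
  rw [map_sub, mul_sub, h1, h2]

lemma pderiv_bind₁_actSubst {n : ℕ} (γ : SL(2, ℤ)) (mu : Fin n → ℤ) (x : ℂ × (Fin n → ℂ))
    (i : Fin (n + 1)) (P : MvPolynomial (Fin (n + 1)) ℂ) :
    MvPolynomial.pderiv i (MvPolynomial.bind₁ (actSubst γ mu x) P) =
      MvPolynomial.C (if i = 0 then jac γ x ^ 2 else jac γ x) *
        MvPolynomial.bind₁ (actSubst γ mu x) (MvPolynomial.pderiv i P) := by
  have hX : ∀ j, MvPolynomial.pderiv i (actSubst γ mu x j) =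
      if j = i then MvPolynomial.C (if i = 0 then jac γ x ^ 2 else jac γ x) else 0 := by
    intro j
    refine Fin.cases ?_ (fun r => ?_) j
    · by_cases h : (0 : Fin (n + 1)) = i
      · subst h
        simp [actSubst]
      · simp [actSubst, MvPolynomial.pderiv_X_of_ne h, h]
    · by_cases h : r.succ = i
      · subst h
        simp [actSubst]
      · simp [actSubst, MvPolynomial.pderiv_X_of_ne h, h]
  induction P using MvPolynomial.induction_on with
  | C a => simp
  | add p q hp hq => simp only [map_add, hp, hq, mul_add]
  | mul_X p j hp =>
    simp only [map_mul, MvPolynomial.bind₁_X_right, Derivation.leibniz, smul_eq_mul, hp, hX,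
      map_add]
    by_cases h : j = i
    · subst h
      simp only [if_true, MvPolynomial.pderiv_X_self, map_one]
      ring
    · simp only [if_neg h, MvPolynomial.pderiv_X_of_ne h, map_zero]
      ring

lemma IsInvariant.pderiv {n : ℕ} {f : SL(2, ℤ) → (Fin n → ℤ) → ℂ × (Fin n → ℂ) → ℂ}
    {Q : Dom n → MvPolynomial (Fin (n + 1)) ℂ} (h : IsInvariant f Q) (i : Fin (n + 1)) :
    IsInvariant (fun γ mu x => f γ mu x * if i = 0 then jac γ x ^ 2 else jac γ x)
      (fun p => MvPolynomial.pderiv i (Q p)) := by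
  intro γ mu
  filter_upwards [h γ mu] with p h1
  rw [← h1, MvPolynomial.pderiv_C_mul, pderiv_bind₁_actSubst, map_mul, mul_assoc]

/-- An invariant family of polynomials without constant terms vanishes: for `γ = (0 -1; 1 d)` the
point where `actSubst γ mu` takes the value `0` is a zero of `Q p`, and as `d` and `mu` vary these
points are Zariski dense. -/
theorem IsInvariant.eq_zero {n : ℕ} {f : SL(2, ℤ) → (Fin n → ℤ) → ℂ × (Fin n → ℂ) → ℂ}
    {Q : Dom n → MvPolynomial (Fin (n + 1)) ℂ} (h : IsInvariant f Q)
    (h0 : ∀ᶠ p in residual (Dom n), (Q p).coeff 0 = 0) :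
    ∀ᶠ p in residual (Dom n), Q p = 0 := by
  let γ : ℤ → SL(2, ℤ) := fun d => ⟨!![0, -1; 1, d], by simp [Matrix.det_fin_two]⟩
  have h1 : ∀ᶠ p in residual (Dom n), ∀ (d : ℤ) (mu : Fin n → ℤ),
      MvPolynomial.eval (Fin.cons (1 / (2 * Real.pi * Complex.I * ((p.1 : ℂ) + d)))
        fun r => (p.2 r + mu r) / ((p.1 : ℂ) + d)) (Q p) = 0 := by
    rw [eventually_countable_forall]
    intro d
    rw [eventually_countable_forall]
    intro mu
    filter_upwards [h (γ d) mu, (tendsto_act_residual (γ d) mu).eventually h0] with p hp hp0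
    have hJ : jac (γ d) p.incl = (p.1 : ℂ) + d := by simp [jac, γ, Dom.incl]
    have hJ0 : (p.1 : ℂ) + d ≠ 0 := hJ ▸ jac_incl_ne_zero (γ d) p
    rw [← hp, map_mul, MvPolynomial.eval, MvPolynomial.eval₂Hom_bind₁]
    have h2 : (fun i => MvPolynomial.eval₂Hom (RingHom.id ℂ)
        (Fin.cons (1 / (2 * Real.pi * Complex.I * ((p.1 : ℂ) + d)))
        fun r => (p.2 r + mu r) / ((p.1 : ℂ) + d)) (actSubst (γ d) mu p.incl i)) =
        fun _ : Fin (n + 1) => (0 : ℂ) := by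
      funext i
      have hpi : (Real.pi : ℂ) ≠ 0 := by exact_mod_cast Real.pi_ne_zero
      have hI := Complex.I_ne_zero
      refine Fin.cases ?_ (fun r => ?_) i
      · simp [actSubst, hJ]
        simp only [γ]
        simp
        field_simp
        ring_nf
        rw [Complex.I_sq]
        ring
      · simp [actSubst, hJ]
        simp only [γ, Dom.incl]
        simp
        field_simp
        ring
    rw [h2]
    have h3 : MvPolynomial.eval₂Hom (RingHom.id ℂ) (fun _ : Fin (n + 1) => (0 : ℂ))
        (Q (act (γ d) mu p)) = (Q (act (γ d) mu p)).coeff 0 := by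
      rw [← MvPolynomial.constantCoeff_eq]
      exact congrFun (congrArg DFunLike.coe MvPolynomial.eval_zero') _
    rw [h3, hp0, mul_zero]
  filter_upwards [h1] with p hp
  have hJ0 : ∀ d : ℤ, (p.1 : ℂ) + d ≠ 0 := by
    intro d hd
    have := congrArg Complex.im hd
    simp at this
    exact p.1.im_ne_zero this
  have hpi : (Real.pi : ℂ) ≠ 0 := by exact_mod_cast Real.pi_ne_zero
  -- the zeros with a fixed value of `d` are Zariski dense in a hyperplane
  have h2 : ∀ (d : ℤ) (X : Fin n → ℂ),
      MvPolynomial.eval (Fin.cons (1 / (2 * Real.pi * Complex.I * ((p.1 : ℂ) + d))) X) (Q p) = 0 := by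
    intro d X
    let T : Fin (n + 1) → MvPolynomial (Fin n) ℂ := Fin.cons
      (MvPolynomial.C (1 / (2 * Real.pi * Complex.I * ((p.1 : ℂ) + d)))) MvPolynomial.X
    have heval : ∀ x : Fin n → ℂ, MvPolynomial.eval x (MvPolynomial.bind₁ T (Q p)) =
        MvPolynomial.eval (Fin.cons (1 / (2 * Real.pi * Complex.I * ((p.1 : ℂ) + d))) x) (Q p) := by
      intro x
      rw [MvPolynomial.eval, MvPolynomial.eval₂Hom_bind₁]
      congr 2
      funext i
      refine Fin.cases ?_ (fun r => ?_) i <;> simp [T]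
    have hz : MvPolynomial.bind₁ T (Q p) = 0 := by
      refine MvPolynomial.funext_set
        (fun r => Set.range fun m : ℤ => (p.2 r + m) / ((p.1 : ℂ) + d)) (fun r => ?_) ?_
      · refine Set.infinite_range_of_injective fun a b hab => ?_
        have := (div_left_inj' (hJ0 d)).1 hab
        exact_mod_cast add_left_cancel this
      · intro x hx
        choose mu hmu using fun r => hx r (Set.mem_univ r)
        rw [heval, map_zero, ← hp d mu]
        congr 2
        funext i
        refine Fin.cases rfl (fun r => ?_) i
        exact (hmu r).symm
    rw [← heval, hz, map_zero]
  refine MvPolynomial.funext_set (Fin.cons (Set.range fun d : ℤ =>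
    1 / (2 * Real.pi * Complex.I * ((p.1 : ℂ) + d))) fun _ => Set.univ) (fun i => ?_) ?_
  · refine Fin.cases ?_ (fun r => ?_) i
    · refine Set.infinite_range_of_injective fun a b hab => ?_
      have h3 : 2 * Real.pi * Complex.I ≠ 0 := by simp [hpi]
      simp only [one_div, inv_inj] at hab
      exact_mod_cast add_left_cancel (mul_left_cancel₀ h3 hab)
    · exact Set.infinite_univ
  · intro x hx
    obtain ⟨d, hd⟩ := hx 0 (Set.mem_univ _)
    rw [map_zero, ← h2 d (Fin.tail x)]
    congr 2
    rw [← Fin.cons_self_tail x]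
    simp only [Fin.tail_cons]
    rw [← hd]

/-- The family of an almost Jacobi form is determined by its constant term. -/
theorem genEq_of_constant_term {n : ℕ} {k : ℤ} {M : Matrix (Fin n) (Fin n) ℚ} {c c' : Family n}
    (hc : IsAlmostJacobi k M c) (hc' : IsAlmostJacobi k M c') (h : GenEq (c (0, 0)) (c' (0, 0)))
    (ij : ℕ × (Fin n →₀ ℕ)) : GenEq (c ij) (c' ij) := by
  refine genEq_of_residual (hc.1 ij).1.1 (hc'.1 ij).1.1 ?_
  have h0 : ∀ᶠ p in residual (Dom n), (familyPoly c p - familyPoly c' p).coeff 0 = 0 := by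
    filter_upwards [h.residual] with p hp
    rw [MvPolynomial.coeff_sub, ← Finsupp.cons_zero_zero, coeff_familyPoly, coeff_familyPoly, hp,
      sub_self]
  filter_upwards [((isInvariant_familyPoly hc).sub (isInvariant_familyPoly hc')).eq_zero h0]
    with p hp
  rw [← Prod.mk.eta (p := ij), ← coeff_familyPoly, ← coeff_familyPoly, sub_eq_zero.1 hp]

/-! ### Symmetric almost Jacobi forms -/

/-- Permutation of the elliptic variables. -/
def permAct {n : ℕ} (σ : Equiv.Perm (Fin n)) (p : Dom n) : Dom n := (p.1, fun k => p.2 (σ k))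

lemma tendsto_permAct_residual {n : ℕ} (σ : Equiv.Perm (Fin n)) :
    Tendsto (permAct σ) (residual (Dom n)) (residual (Dom n)) := by
  have h : ∀ τ : Equiv.Perm (Fin n), Continuous (permAct τ : Dom n → Dom n) := fun τ => by
    unfold permAct; fun_prop
  let H : Dom n ≃ₜ Dom n :=
    { toFun := permAct σ
      invFun := permAct σ⁻¹
      left_inv := fun p => by simp [permAct]
      right_inv := fun p => by simp [permAct]
      continuous_toFun := h σ
      continuous_invFun := h σ⁻¹ }
  exact tendsto_residual_of_isOpenMap (h σ) H.isOpenMap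

/-- The permutation of the variables `ν`, `ξ₁, …, ξₙ` that is induced by a permutation of the
elliptic variables. -/
def permVar {n : ℕ} (σ : Equiv.Perm (Fin n)) : Fin (n + 1) → Fin (n + 1) :=
  Fin.cons 0 fun r => (σ r).succ

lemma permVar_injective {n : ℕ} (σ : Equiv.Perm (Fin n)) : Function.Injective (permVar σ) := by
  rw [permVar, Fin.cons_injective_iff]
  refine ⟨?_, (Fin.succ_injective n).comp σ.injective⟩
  rintro ⟨r, hr⟩
  exact Fin.succ_ne_zero _ hr

lemma bil_perm {n : ℕ} {M : Matrix (Fin n) (Fin n) ℚ} {σ : Equiv.Perm (Fin n)}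
    (hM : ∀ r s, M (σ r) (σ s) = M r s) (z w : Fin n → ℂ) :
    bil M (fun r => z (σ r)) (fun r => w (σ r)) = bil M z w := by
  unfold bil
  rw [← Equiv.sum_comp σ (fun r => ∑ s, z r * (M r s : ℂ) * w s)]
  refine Finset.sum_congr rfl fun r _ => ?_
  symm
  rw [← Equiv.sum_comp σ]
  exact Finset.sum_congr rfl fun s _ => by rw [hM]

lemma IsInvariant.perm {n : ℕ} {k : ℤ} {M : Matrix (Fin n) (Fin n) ℚ} {σ : Equiv.Perm (Fin n)}
    (hM : ∀ r s, M (σ r) (σ s) = M r s) {Q : Dom n → MvPolynomial (Fin (n + 1)) ℂ}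
    (h : IsInvariant (actFactor k M) Q) :
    IsInvariant (actFactor k M) fun p => MvPolynomial.rename (permVar σ) (Q (permAct σ p)) := by
  intro γ mu
  filter_upwards [(tendsto_permAct_residual σ).eventually (h γ fun r => mu (σ r))] with p hp
  have h1 : act γ (fun r => mu (σ r)) (permAct σ p) = permAct σ (act γ mu p) := rfl
  have h2 : actFactor k M γ (fun r => mu (σ r)) (permAct σ p).incl =
      actFactor k M γ mu p.incl := by
    have e1 := bil_perm hM (fun r => (mu r : ℂ)) (fun r => (mu r : ℂ))
    have e2 := bil_perm hM (fun r => p.incl.2 r + mu r) (fun r => p.incl.2 r + mu r)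
    unfold actFactor
    rw [← e1, ← e2]
    rfl
  have h3 : (fun i => MvPolynomial.rename (permVar σ)
      (actSubst γ (fun r => mu (σ r)) (permAct σ p).incl i)) =
      fun i => actSubst γ mu p.incl (permVar σ i) := by
    funext i
    refine Fin.cases ?_ (fun r => ?_) i
    · simp [actSubst, permVar, jac, permAct, Dom.incl]
    · simp [actSubst, permVar, jac, permAct, Dom.incl]
  rw [← hp, h1, h2, map_mul, MvPolynomial.rename_C, MvPolynomial.rename_bind₁, h3,
    MvPolynomial.bind₁_rename]
  rfl

/-- The constant term being symmetric, the coefficients of the linear monomials `ξ_r` are obtained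
from the one of `ξ₁` by permuting the variables. -/
lemma coeff_linear_of_symm {m : ℕ} {k : ℤ} {M : Matrix (Fin (m + 1)) (Fin (m + 1)) ℚ}
    (hM : ∀ (σ : Equiv.Perm (Fin (m + 1))) r s, M (σ r) (σ s) = M r s) {c : Family (m + 1)}
    (hc : IsAlmostJacobi k M c)
    (hsymm : ∀ σ, ∀ᶠ p in residual (Dom (m + 1)), c (0, 0) (permAct σ p) = c (0, 0) p)
    (r : Fin (m + 1)) : ∀ᶠ p in residual (Dom (m + 1)),
      (familyPoly c p).coeff (Finsupp.single r.succ 1) =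
        c (0, Finsupp.single 0 1) (permAct (Equiv.swap 0 r) p) := by
  have hinv := isInvariant_familyPoly hc
  have h0 : ∀ᶠ p in residual (Dom (m + 1)), (MvPolynomial.rename (permVar (Equiv.swap 0 r))
      (familyPoly c (permAct (Equiv.swap 0 r) p)) - familyPoly c p).coeff 0 = 0 := by
    filter_upwards [hsymm (Equiv.swap 0 r)] with p hp
    rw [MvPolynomial.coeff_sub, ← MvPolynomial.constantCoeff_eq, MvPolynomial.constantCoeff_rename,
      MvPolynomial.constantCoeff_eq, ← Finsupp.cons_zero_zero, coeff_familyPoly, coeff_familyPoly,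
      hp, sub_self]
  filter_upwards [((hinv.perm (hM (Equiv.swap 0 r))).sub hinv).eq_zero h0] with p hp
  have h1 : Finsupp.single r.succ 1 = Finsupp.mapDomain (permVar (Equiv.swap 0 r))
      (Finsupp.single (Fin.succ 0) 1) := by
    rw [Finsupp.mapDomain_single]
    simp [permVar]
  rw [← sub_eq_zero.1 hp, ← coeff_familyPoly, Finsupp.cons_zero_single_eq_single_succ, h1,
    MvPolynomial.coeff_rename_mapDomain _ (permVar_injective _)]

/-- Two almost Jacobi forms with symmetric constant terms and the same coefficients of `ν` and of
`ξ₁` differ only in their constant terms. -/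
theorem genEq_of_linear_terms {m : ℕ} {k : ℤ} {M : Matrix (Fin (m + 1)) (Fin (m + 1)) ℚ}
    (hM : ∀ (σ : Equiv.Perm (Fin (m + 1))) r s, M (σ r) (σ s) = M r s) {c c' : Family (m + 1)}
    (hc : IsAlmostJacobi k M c) (hc' : IsAlmostJacobi k M c')
    (hs : ∀ σ, ∀ᶠ p in residual (Dom (m + 1)), c (0, 0) (permAct σ p) = c (0, 0) p)
    (hs' : ∀ σ, ∀ᶠ p in residual (Dom (m + 1)), c' (0, 0) (permAct σ p) = c' (0, 0) p)
    (hτ : ∀ᶠ p in residual (Dom (m + 1)), c (1, 0) p = c' (1, 0) p)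
    (hz : ∀ᶠ p in residual (Dom (m + 1)),
      c (0, Finsupp.single 0 1) p = c' (0, Finsupp.single 0 1) p)
    {ij : ℕ × (Fin (m + 1) →₀ ℕ)} (hij : ij ≠ (0, 0)) : GenEq (c ij) (c' ij) := by
  have hinv := (isInvariant_familyPoly hc).sub (isInvariant_familyPoly hc')
  have hlin : ∀ i, ∀ᶠ p in residual (Dom (m + 1)),
      (familyPoly c p - familyPoly c' p).coeff (Finsupp.single i 1) = 0 := by
    intro i
    refine Fin.cases ?_ (fun r => ?_) i
    · filter_upwards [hτ] with p hp
      rw [MvPolynomial.coeff_sub, ← Finsupp.cons_zero_eq_single_zero, coeff_familyPoly,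
        coeff_familyPoly, hp, sub_self]
    · filter_upwards [coeff_linear_of_symm hM hc hs r, coeff_linear_of_symm hM hc' hs' r,
        (tendsto_permAct_residual (Equiv.swap 0 r)).eventually hz] with p h1 h2 h3
      rw [MvPolynomial.coeff_sub, h1, h2, h3, sub_self]
  -- the partial derivatives of the difference are invariant and have no constant terms
  have hpd : ∀ i, ∀ᶠ p in residual (Dom (m + 1)),
      MvPolynomial.pderiv i (familyPoly c p - familyPoly c' p) = 0 := by
    intro i
    refine (hinv.pderiv i).eq_zero ?_
    filter_upwards [hlin i] with p hp
    rw [MvPolynomial.coeff_pderiv, zero_add, hp, zero_mul]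
  refine genEq_of_residual (hc.1 ij).1.1 (hc'.1 ij).1.1 ?_
  have hne : Finsupp.cons ij.1 ij.2 ≠ 0 := by
    intro h
    rw [← Finsupp.cons_zero_zero] at h
    obtain ⟨h1, h2⟩ := Finsupp.cons_injective2 h
    exact hij (Prod.ext h1 h2)
  obtain ⟨i, hi⟩ := DFunLike.ne_iff.1 hne
  have hi' : (Finsupp.cons ij.1 ij.2 : Fin (m + 2) →₀ ℕ) i ≠ 0 := hi
  have hadd : Finsupp.cons ij.1 ij.2 - Finsupp.single i 1 + Finsupp.single i 1 =
      (Finsupp.cons ij.1 ij.2 : Fin (m + 2) →₀ ℕ) := by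
    refine tsub_add_cancel_of_le ?_
    rw [Finsupp.single_le_iff]
    omega
  filter_upwards [hpd i] with p hp
  have h1 := congrArg (MvPolynomial.coeff (Finsupp.cons ij.1 ij.2 - Finsupp.single i 1)) hp
  rw [MvPolynomial.coeff_pderiv, hadd, MvPolynomial.coeff_zero, MvPolynomial.coeff_sub,
    coeff_familyPoly, coeff_familyPoly] at h1
  exact sub_eq_zero.1 ((mul_eq_zero.1 h1).resolve_right (Nat.cast_add_one_ne_zero _))

/-! ### Poles along the partial sums of the elliptic variables -/

/-- The linear form `(τ, z) ↦ ∑_{r ∈ S} z_r`. -/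
noncomputable def sumForm {n : ℕ} (S : Finset (Fin n)) : ℂ × (Fin n → ℂ) →L[ℂ] ℂ :=
  ∑ r ∈ S, (ContinuousLinearMap.proj r).comp (ContinuousLinearMap.snd ℂ ℂ (Fin n → ℂ))

@[simp] lemma sumForm_apply {n : ℕ} (S : Finset (Fin n)) (x : ℂ × (Fin n → ℂ)) :
    sumForm S x = ∑ r ∈ S, x.2 r := by
  simp [sumForm]

lemma sumForm_single {n : ℕ} {S : Finset (Fin n)} {s : Fin n} (hs : s ∈ S) (τ t : ℂ) :
    sumForm S (τ, Pi.single s t) = t := by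
  simp [Finset.sum_pi_single', hs]

lemma sumForm_ne_zero {n : ℕ} {S : Finset (Fin n)} (hS : S.Nonempty) : sumForm S ≠ 0 := by
  obtain ⟨s, hs⟩ := hS
  intro h
  have := sumForm_single hs 0 1
  rw [h] at this
  simp at this

lemma eventually_eq_zero_of_form_mul {n : ℕ} {L : ℂ × (Fin n → ℂ) →L[ℂ] ℂ} (hL : L ≠ 0)
    {h : ℂ × (Fin n → ℂ) → ℂ} {p : ℂ × (Fin n → ℂ)} (hh : AnalyticAt ℂ h p)
    (h0 : ∀ᶠ x in 𝓝 p, L x * h x = 0) : ∀ᶠ x in 𝓝 p, h x = 0 := by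
  obtain ⟨v, hv⟩ := DFunLike.ne_iff.1 hL
  have hv' : L v ≠ 0 := hv
  filter_upwards [h0.eventually_nhds, hh.eventually_analyticAt] with x hx hx2
  by_contra hne
  have h1 : ∀ᶠ y in 𝓝 x, L y = 0 := by
    filter_upwards [hx, hx2.continuousAt.eventually_ne hne] with y h1 h2
    exact (mul_eq_zero.1 h1).resolve_right h2
  have h2 : Tendsto (fun t : ℂ => x + t • v) (𝓝 0) (𝓝 x) := by
    have : Continuous fun t : ℂ => x + t • v := by fun_prop
    simpa using this.tendsto 0
  have h3 : ∀ᶠ t : ℂ in 𝓝[≠] 0, L (x + t • v) = 0 :=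
    (h2.eventually h1).filter_mono nhdsWithin_le_nhds
  obtain ⟨t, ht, ht0⟩ := (h3.and self_mem_nhdsWithin).exists
  rw [map_add, map_smul, h1.self_of_nhds, zero_add, smul_eq_mul] at ht
  exact (mul_eq_zero.1 ht).elim ht0 hv'

/-- A holomorphic function on the upper half plane that does not vanish identically is nonzero
outside a closed discrete set. -/
lemma codiscrete_ne_zero {f : ℂ → ℂ} (hf : AnalyticOnNhd ℂ f {z | 0 < z.im}) {z₀ : ℂ}
    (hz₀ : 0 < z₀.im) (h0 : f z₀ ≠ 0) :
    ∀ᶠ τ : UpperHalfPlane in codiscrete UpperHalfPlane, f τ ≠ 0 := by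
  rw [Filter.Eventually, mem_codiscrete]
  intro τ
  rw [disjoint_principal_right, compl_compl]
  rcases (hf τ τ.im_pos).eventually_eq_zero_or_eventually_ne_zero with h | h
  · exact absurd (hf.eqOn_zero_of_preconnected_of_eventuallyEq_zero
      (convex_halfSpace_im_gt 0).isPreconnected τ.im_pos h hz₀) h0
  · have ht : Tendsto (fun σ : UpperHalfPlane => (σ : ℂ)) (𝓝[≠] τ) (𝓝[≠] (τ : ℂ)) := by
      refine tendsto_nhdsWithin_iff.2 ⟨?_, ?_⟩
      · exact (UpperHalfPlane.continuous_coe.tendsto τ).mono_left nhdsWithin_le_nhds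
      · filter_upwards [self_mem_nhdsWithin] with σ hσ h
        exact hσ (UpperHalfPlane.ext h)
    exact ht.eventually h

/-- The product of the forms `sumForm S`. -/
noncomputable def formProd {n : ℕ} (Ls : List (Finset (Fin n))) (x : ℂ × (Fin n → ℂ)) : ℂ :=
  (Ls.map fun S => sumForm S x).prod

lemma analyticAt_formProd {n : ℕ} (Ls : List (Finset (Fin n))) (x : ℂ × (Fin n → ℂ)) :
    AnalyticAt ℂ (formProd Ls) x := by
  induction Ls with
  | nil => exact analyticAt_const
  | cons S Ls ih =>
    have : formProd (S :: Ls) = fun x => sumForm S x * formProd Ls x := by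
      funext x; simp [formProd]
    rw [this]
    exact ((sumForm S).analyticAt x).mul ih

/-- A holomorphic function is either divisible by a product of linear forms in the elliptic
variables, or it is not divisible by it at `(τ, 0)` for any `τ` outside a closed discrete set. -/
theorem formProd_dvd_or_codiscrete_not_dvd {n : ℕ} (Ls : List (Finset (Fin n))) (hLs : ∀ S ∈ Ls, S.Nonempty)
    {g : ℂ × (Fin n → ℂ) → ℂ} (hg : AnalyticOnNhd ℂ g (upper n)) :
    (∃ H, AnalyticOnNhd ℂ H (upper n) ∧ ∀ x ∈ upper n, g x = formProd Ls x * H x) ∨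
    ∀ᶠ τ : UpperHalfPlane in codiscrete UpperHalfPlane,
      ¬ ∃ f : ℂ × (Fin n → ℂ) → ℂ, AnalyticAt ℂ f ((τ : ℂ), 0) ∧
        ∀ᶠ x in 𝓝 ((τ : ℂ), (0 : Fin n → ℂ)), g x = formProd Ls x * f x := by
  induction Ls generalizing g with
  | nil => exact Or.inl ⟨g, hg, fun x _ => by simp [formProd]⟩
  | cons S Ls ih =>
    have hcons : ∀ x, formProd (S :: Ls) x = sumForm S x * formProd Ls x := fun x => by
      simp [formProd]
    have hS := sumForm_ne_zero (hLs S (by simp))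
    -- if `g` vanishes on the hyperplane `sumForm S = 0`, then this factor splits off; otherwise there
    -- is an obstruction at a point `x₁` of the hyperplane
    by_cases hv : ∀ x ∈ upper n, sumForm S x = 0 → g x = 0
    · obtain ⟨g₁, hg₁, hgg₁⟩ := exists_eq_mul_of_vanishing (isOpen_upper n) hg _ hS hv
      rcases ih (fun T hT => hLs T (by simp [hT])) hg₁ with ⟨H, hH, hH'⟩ | h
      · refine Or.inl ⟨H, hH, fun x hx => ?_⟩
        rw [hgg₁ x hx, hH' x hx, hcons, mul_assoc]
      · refine Or.inr (h.mono fun τ hτ => ?_)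
        rintro ⟨f, hf, hfg⟩
        refine hτ ⟨f, hf, ?_⟩
        have hmem : ((τ : ℂ), (0 : Fin n → ℂ)) ∈ upper n := τ.im_pos
        have h1 : ∀ᶠ x in 𝓝 ((τ : ℂ), (0 : Fin n → ℂ)),
            sumForm S x * (g₁ x - formProd Ls x * f x) = 0 := by
          filter_upwards [hfg, (isOpen_upper n).mem_nhds hmem] with x hx hxu
          rw [hgg₁ x hxu, hcons] at hx
          linear_combination hx
        have h2 := eventually_eq_zero_of_form_mul hS
          ((hg₁ _ hmem).sub ((analyticAt_formProd Ls _).mul hf)) h1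
        exact h2.mono fun x hx => sub_eq_zero.1 hx
    · push Not at hv
      obtain ⟨x₁, hx₁, hx₁0, hgx₁⟩ := hv
      refine Or.inr ?_
      have hslice : AnalyticOnNhd ℂ (fun t : ℂ => g (t, x₁.2)) {z | 0 < z.im} := by
        intro t ht
        exact AnalyticAt.comp (g := g) (f := fun t : ℂ => (t, x₁.2)) (hg (t, x₁.2) ht)
          (analyticAt_id.prod analyticAt_const)
      refine (codiscrete_ne_zero hslice hx₁ hgx₁).mono fun τ hτ => ?_
      rintro ⟨f, hf, hfg⟩
      -- on the line through `(τ, 0)` and `(τ, x₁)` the function `g` vanishes near the origin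
      have hline : AnalyticOnNhd ℂ (fun t : ℂ => g ((τ : ℂ), t • x₁.2)) Set.univ := by
        intro t _
        refine AnalyticAt.comp (g := g) (hg _ τ.im_pos) (analyticAt_const.prod ?_)
        exact analyticAt_id.smul analyticAt_const
      have hcont : Tendsto (fun t : ℂ => ((τ : ℂ), t • x₁.2)) (𝓝 0)
          (𝓝 ((τ : ℂ), (0 : Fin n → ℂ))) := by
        have : Continuous fun t : ℂ => ((τ : ℂ), t • x₁.2) := by fun_prop
        simpa using this.tendsto 0
      have hz : ∀ᶠ t : ℂ in 𝓝 0, g ((τ : ℂ), t • x₁.2) = 0 := by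
        filter_upwards [hcont.eventually hfg] with t ht
        have h3 : sumForm S ((τ : ℂ), t • x₁.2) = 0 := by
          rw [sumForm_apply] at hx₁0 ⊢
          simp only [Pi.smul_apply, smul_eq_mul, ← Finset.mul_sum, hx₁0, mul_zero]
        rw [ht, hcons, h3, zero_mul, zero_mul]
      have := hline.eqOn_zero_of_preconnected_of_eventuallyEq_zero isPreconnected_univ
        (Set.mem_univ 0) hz (Set.mem_univ 1)
      simp only [one_smul] at this
      exact hτ this

/-- The point `(τ, λτ + μ + w)` of `ℂ × ℂⁿ`. -/
noncomputable def shift {n : ℕ} (lam mu : Fin n → ℝ) (x : ℂ × (Fin n → ℂ)) : ℂ × (Fin n → ℂ) :=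
  (x.1, fun r => x.2 r + ((lam r : ℂ) * x.1 + (mu r : ℂ)))

/-- A product of functions `θ(τ, ∑_{r ∈ S} z_r + ατ + β)`, encoded by the list of the
triples `(S, α, β)`. -/
noncomputable def thetaProd {n : ℕ} (D : List (Finset (Fin n) × ℝ × ℝ)) (x : ℂ × (Fin n → ℂ)) : ℂ :=
  (D.map fun d => thetaC x.1 (sumForm d.1 x + ((d.2.1 : ℂ) * x.1 + (d.2.2 : ℂ)))).prod

lemma analyticAt_shift {n : ℕ} (lam mu : Fin n → ℝ) (x : ℂ × (Fin n → ℂ)) :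
    AnalyticAt ℂ (shift lam mu) x := by
  refine AnalyticAt.prod analyticAt_fst (AnalyticAt.pi fun r => ?_)
  exact (analyticAt_coord r x).add ((analyticAt_const.mul analyticAt_fst).add analyticAt_const)

lemma sumForm_shift {n : ℕ} (S : Finset (Fin n)) (lam mu : Fin n → ℝ) (x : ℂ × (Fin n → ℂ)) :
    sumForm S (shift lam mu x) =
      sumForm S x + (((∑ r ∈ S, lam r : ℝ) : ℂ) * x.1 + ((∑ r ∈ S, mu r : ℝ) : ℂ)) := by
  simp [shift, Finset.sum_add_distrib, Finset.sum_mul]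

lemma analyticAt_thetaC_comp {n : ℕ} {f : ℂ × (Fin n → ℂ) → ℂ} {x : ℂ × (Fin n → ℂ)}
    (hx : x ∈ upper n) (hf : AnalyticAt ℂ f x) : AnalyticAt ℂ (fun y => thetaC y.1 (f y)) x :=
  AnalyticAt.comp (g := fun y : ℂ × ℂ => thetaC y.1 y.2)
    (f := fun y : ℂ × (Fin n → ℂ) => (y.1, f y)) (analyticAt_thetaC hx (f x))
    (analyticAt_fst.prod hf)

lemma analyticOnNhd_thetaProd {n : ℕ} (D : List (Finset (Fin n) × ℝ × ℝ)) :
    AnalyticOnNhd ℂ (thetaProd D) (upper n) := by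
  intro x hx
  induction D with
  | nil => exact analyticAt_const
  | cons d D ih =>
    have : thetaProd (d :: D) = fun x => thetaC x.1 (sumForm d.1 x +
        ((d.2.1 : ℂ) * x.1 + (d.2.2 : ℂ))) * thetaProd D x := by
      funext x; simp [thetaProd]
    rw [this]
    refine (analyticAt_thetaC_comp hx ?_).mul ih
    exact ((sumForm d.1).analyticAt x).add
      ((analyticAt_const.mul analyticAt_fst).add analyticAt_const)

/-- The zero of `θ` at the origin, in the variable `∑_{r ∈ S} z_r`. -/
lemma exists_theta_eq_form_mul {n : ℕ} {S : Finset (Fin n)} (hS : S.Nonempty) :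
    ∃ H, AnalyticOnNhd ℂ H (upper n) ∧ (∀ τ : UpperHalfPlane, H ((τ : ℂ), 0) ≠ 0) ∧
      ∀ x ∈ upper n, thetaC x.1 (sumForm S x) = sumForm S x * H x := by
  obtain ⟨H, hH, hH'⟩ := exists_eq_mul_of_vanishing (isOpen_upper n)
    (f := fun x => thetaC x.1 (sumForm S x))
    (fun x hx => analyticAt_thetaC_comp hx ((sumForm S).analyticAt x)) _ (sumForm_ne_zero hS)
    (fun x hx h => by
      have := theta_zero ⟨x.1, hx⟩
      rw [theta_eq_thetaC] at this
      rw [h]; exact this)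
  refine ⟨H, hH, fun τ h0 => ?_, hH'⟩
  obtain ⟨s, hs⟩ := hS
  obtain ⟨C, hC, hbound⟩ := theta_simple_zero τ
  have hcont : ContinuousAt (fun t : ℂ => H ((τ : ℂ), Pi.single s t)) 0 := by
    refine ContinuousAt.comp (g := H) (f := fun t : ℂ => ((τ : ℂ), Pi.single s t)) ?_
      (continuous_const.prodMk (continuous_single s)).continuousAt
    rw [Pi.single_zero]
    exact (hH _ τ.im_pos).continuousAt
  have hev : ∀ᶠ t : ℂ in 𝓝 0, ‖H ((τ : ℂ), Pi.single s t)‖ < C := by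
    have h1 := hcont.norm
    refine h1.eventually (gt_mem_nhds ?_)
    change ‖H ((τ : ℂ), Pi.single s 0)‖ < C
    rw [Pi.single_zero, h0, norm_zero]
    exact hC
  have hev2 := (hev.and hbound).filter_mono (nhdsWithin_le_nhds (s := {0}ᶜ))
  obtain ⟨t, ⟨h1, h2⟩, ht⟩ := (hev2.and self_mem_nhdsWithin).exists
  have h3 := hH' ((τ : ℂ), Pi.single s t) τ.im_pos
  rw [sumForm_single hs] at h3
  rw [theta_eq_thetaC, h3, norm_mul, mul_comm] at h2
  have ht' : 0 < ‖t‖ := norm_pos_iff.2 ht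
  exact absurd (le_of_mul_le_mul_left h2 ht') (not_le.2 h1)

/-- Near a torsion point, a product of theta functions is the product of some of the linear forms
and of a nonvanishing function. -/
theorem thetaProd_shift {n : ℕ} (D : List (Finset (Fin n) × ℝ × ℝ)) (hD : ∀ d ∈ D, d.1.Nonempty)
    (lam mu : Fin n → ℝ) : ∃ (Ls : List (Finset (Fin n))) (U : ℂ × (Fin n → ℂ) → ℂ),
      (∀ S ∈ Ls, S.Nonempty) ∧ AnalyticOnNhd ℂ U (upper n) ∧
      (∀ τ : UpperHalfPlane, U ((τ : ℂ), 0) ≠ 0) ∧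
      ∀ x ∈ upper n, thetaProd D (shift lam mu x) = formProd Ls x * U x := by
  induction D with
  | nil => exact ⟨[], fun _ => 1, by simp, analyticOnNhd_const, by simp, by simp [thetaProd, formProd]⟩
  | cons d D ih =>
    obtain ⟨Ls, U, hLs, hU, hU0, hfac⟩ := ih fun d hd => hD d (by simp [hd])
    have hd := hD d (by simp)
    set a : ℝ := ∑ r ∈ d.1, lam r + d.2.1 with ha
    set b : ℝ := ∑ r ∈ d.1, mu r + d.2.2 with hb
    have harg : ∀ x, thetaProd (d :: D) (shift lam mu x) =
        thetaC x.1 (sumForm d.1 x + ((a : ℂ) * x.1 + (b : ℂ))) * thetaProd D (shift lam mu x) := by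
      intro x
      have h1 : sumForm d.1 (shift lam mu x) + ((d.2.1 : ℂ) * (shift lam mu x).1 + (d.2.2 : ℂ)) =
          sumForm d.1 x + ((a : ℂ) * x.1 + (b : ℂ)) := by
        rw [sumForm_shift, ha, hb]
        simp only [shift]
        push_cast
        ring
      simp only [thetaProd, List.map_cons, List.prod_cons, h1]
      rfl
    -- a factor vanishes along the torsion points only if its argument is a lattice point there
    by_cases hint : ∃ k l : ℤ, a = k ∧ b = l
    · obtain ⟨k, l, hk, hl⟩ := hint
      obtain ⟨H, hH, hH0, hHfac⟩ := exists_theta_eq_form_mul hd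
      refine ⟨d.1 :: Ls, fun x => ((-1) ^ (k + l) * e (-(k : ℂ) ^ 2 * x.1 / 2 -
        k * sumForm d.1 x)) * H x * U x, ?_, ?_, ?_, ?_⟩
      · intro S hS
        rcases List.mem_cons.1 hS with rfl | h
        exacts [hd, hLs S h]
      · intro x hx
        refine ((analyticAt_const.mul (AnalyticAt.e_comp ?_)).mul (hH x hx)).mul (hU x hx)
        exact ((analyticAt_const.mul analyticAt_fst).div_const).sub
          (analyticAt_const.mul ((sumForm d.1).analyticAt x))
      · intro τ
        refine mul_ne_zero (mul_ne_zero (mul_ne_zero (zpow_ne_zero _ (by norm_num))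
          (e_ne_zero _)) (hH0 τ)) (hU0 τ)
      · intro x hx
        have h2 := theta_add_lattice ⟨x.1, hx⟩ (sumForm d.1 x) k l
        rw [theta_eq_thetaC, theta_eq_thetaC] at h2
        rw [harg, hfac x hx, hk, hl]
        simp only [Complex.ofReal_intCast]
        refine (congrArg (· * _) h2).trans ?_
        change _ * thetaC x.1 _ * _ = _
        rw [hHfac x hx]
        simp only [formProd, List.map_cons, List.prod_cons]
        ring
    · refine ⟨Ls, fun x => thetaC x.1 (sumForm d.1 x + ((a : ℂ) * x.1 + (b : ℂ))) * U x, hLs,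
        ?_, ?_, ?_⟩
      · intro x hx
        refine (analyticAt_thetaC_comp hx ?_).mul (hU x hx)
        exact ((sumForm d.1).analyticAt x).add
          ((analyticAt_const.mul analyticAt_fst).add analyticAt_const)
      · intro τ
        refine mul_ne_zero ?_ (hU0 τ)
        have h1 : sumForm d.1 ((τ : ℂ), (0 : Fin n → ℂ)) = 0 := by simp
        rw [h1, zero_add]
        intro h0
        rw [← theta_eq_thetaC] at h0
        obtain ⟨k, l, hkl⟩ := theta_eq_zero h0
        have him := congrArg Complex.im hkl
        have hre := congrArg Complex.re hkl
        simp at him hre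
        have hak : a = k := him.resolve_right τ.im_ne_zero
        exact hint ⟨k, l, hak, by rw [hak] at hre; linarith⟩
      · intro x hx
        rw [harg, hfac x hx]
        ring

/-! ### Membership in the space `Merₙ` -/

/-- `φ` is the quotient of a holomorphic function by a product of theta functions. -/
def IsThetaQuotient {n : ℕ} (φ : Dom n → ℂ) : Prop :=
  ∃ D : List (Finset (Fin n) × ℝ × ℝ), (∀ d ∈ D, d.1.Nonempty) ∧
    ∃ G : ℂ × (Fin n → ℂ) → ℂ, AnalyticOnNhd ℂ G (upper n) ∧
      ∀ p : Dom n, thetaProd D p.incl ≠ 0 → φ p * thetaProd D p.incl = G p.incl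

/-- The points `(τ', λτ' + μ + (s / J, …, s / J))` with `τ' = γτ` and `J = cτ + d`. For small
`s ≠ 0` and large `Im τ` they lie off the poles of theta quotients. -/
noncomputable def circlePoint {n : ℕ} (lam mu : Fin n → ℝ) (γ : SL(2, ℤ)) (τ : UpperHalfPlane)
    (s : ℂ) : Dom n :=
  (γ • τ, fun r => s / autom γ τ + ((lam r : ℂ) * (γ • τ : UpperHalfPlane) + (mu r : ℂ)))

/-- On small circles around torsion points, `φ` grows at most like the `N`-th power of the
automorphy factor as `Im τ → ∞`. -/
def HasModerateGrowth {n : ℕ} (N : ℕ) (φ : Dom n → ℂ) : Prop :=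
  ∀ (lam mu : Fin n → ℝ) (γ : SL(2, ℤ)), ∃ δ : ℝ, 0 < δ ∧ ∀ ε, 0 < ε → ε ≤ δ →
    ∃ K Y : ℝ, ∀ τ : UpperHalfPlane, Y ≤ τ.im → ∀ s : ℂ, ‖s‖ = ε →
      ‖φ (circlePoint lam mu γ τ s)‖ ≤ K * ‖autom γ τ‖ ^ N

lemma lattice_smul (γ : SL(2, ℤ)) (τ : UpperHalfPlane) (a b : ℝ) :
    (a : ℂ) * (γ • τ : UpperHalfPlane) + b =
      (((a * γ 0 0 + b * γ 1 0 : ℝ) : ℂ) * τ + ((a * γ 0 1 + b * γ 1 1 : ℝ) : ℂ)) /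
        autom γ τ := by
  have hJ := autom_ne_zero γ τ
  rw [coe_smul_eq]
  field_simp
  simp only [autom]
  push_cast
  ring

lemma exists_thetaProd_ne_zero {n : ℕ} (D : List (Finset (Fin n) × ℝ × ℝ))
    (hD : ∀ d ∈ D, d.1.Nonempty) (lam mu : Fin n → ℝ) (γ : SL(2, ℤ)) :
    ∃ δ : ℝ, 0 < δ ∧ ∃ Y : ℝ, ∀ τ : UpperHalfPlane, Y ≤ τ.im → ∀ s : ℂ, 0 < ‖s‖ → ‖s‖ ≤ δ →
      thetaProd D (circlePoint lam mu γ τ s).incl ≠ 0 := by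
  induction D with
  | nil => exact ⟨1, one_pos, 0, fun τ _ s _ _ => by simp [thetaProd]⟩
  | cons d D ih =>
    obtain ⟨δ₁, hδ₁, Y₁, h₁⟩ := ih fun d hd => hD d (by simp [hd])
    have hd := hD d (by simp)
    set a : ℝ := ∑ r ∈ d.1, lam r + d.2.1 with ha
    set b : ℝ := ∑ r ∈ d.1, mu r + d.2.2 with hb
    obtain ⟨δ₂, hδ₂, Y₂, h₂, -⟩ :=
      exists_theta_bound (a * γ 0 0 + b * γ 1 0) (a * γ 0 1 + b * γ 1 1)
    have hcard : (0 : ℝ) < d.1.card := by exact_mod_cast hd.card_pos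
    refine ⟨min δ₁ (δ₂ / d.1.card), lt_min hδ₁ (by positivity), max Y₁ Y₂,
      fun τ hτ s hs hs' => ?_⟩
    have e1 : thetaProd (d :: D) (circlePoint lam mu γ τ s).incl =
        theta (γ • τ) (sumForm d.1 (circlePoint lam mu γ τ s).incl +
          ((d.2.1 : ℂ) * (γ • τ : UpperHalfPlane) + (d.2.2 : ℂ))) *
          thetaProd D (circlePoint lam mu γ τ s).incl := by
      rw [theta_eq_thetaC]
      simp only [thetaProd, List.map_cons, List.prod_cons]
      rfl
    have e2 : sumForm d.1 (circlePoint lam mu γ τ s).incl +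
        ((d.2.1 : ℂ) * (γ • τ : UpperHalfPlane) + (d.2.2 : ℂ)) =
        ((((a * γ 0 0 + b * γ 1 0 : ℝ) : ℂ) * τ + ((a * γ 0 1 + b * γ 1 1 : ℝ) : ℂ)) +
          d.1.card * s) / autom γ τ := by
      rw [add_div, ← lattice_smul, sumForm_apply]
      simp only [circlePoint, Dom.incl, Finset.sum_add_distrib, Finset.sum_const, nsmul_eq_mul,
        ← Finset.sum_mul, ha, hb]
      push_cast
      ring
    obtain ⟨A, hA, hmod⟩ := theta_modular γ τ
    rw [e1, e2, hmod]
    refine mul_ne_zero (mul_ne_zero (mul_ne_zero hA (e_ne_zero _))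
      (h₂ τ ((le_max_right _ _).trans hτ) _ ?_ ?_))
      (h₁ τ ((le_max_left _ _).trans hτ) s hs (hs'.trans (min_le_left _ _)))
    · rw [norm_mul, Complex.norm_natCast]; positivity
    · rw [norm_mul, Complex.norm_natCast]
      have := hs'.trans (min_le_right _ _)
      rw [le_div_iff₀ hcard] at this
      linarith

lemma exists_mem_upper_thetaProd_ne_zero {n : ℕ} (D : List (Finset (Fin n) × ℝ × ℝ))
    (hD : ∀ d ∈ D, d.1.Nonempty) : ∃ p ∈ upper n, thetaProd D p ≠ 0 := by
  obtain ⟨δ, hδ, Y, h⟩ := exists_thetaProd_ne_zero D hD 0 0 1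
  let τ : UpperHalfPlane := ⟨(max Y 1 : ℝ) * Complex.I, by simp⟩
  refine ⟨_, incl_mem_upper _, h τ (by simp [τ, UpperHalfPlane.im]) (δ : ℂ) ?_ ?_⟩
  · simpa using hδ.ne'
  · simp [abs_of_pos hδ]

lemma shift_neg_shift {n : ℕ} (lam mu : Fin n → ℝ) (x : ℂ × (Fin n → ℂ)) :
    shift (-lam) (-mu) (shift lam mu x) = x := by
  refine Prod.ext rfl (funext fun r => ?_)
  simp only [shift, Pi.neg_apply, Complex.ofReal_neg]
  ring

lemma shift_shift_neg {n : ℕ} (lam mu : Fin n → ℝ) (x : ℂ × (Fin n → ℂ)) :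
    shift lam mu (shift (-lam) (-mu) x) = x := by
  refine Prod.ext rfl (funext fun r => ?_)
  simp only [shift, Pi.neg_apply, Complex.ofReal_neg]
  ring

lemma autom_isBigO (γ : SL(2, ℤ)) (x : ℝ) :
    (fun y : ℝ => autom γ (UpperHalfPlane.ofComplex ((x : ℂ) + (y : ℂ) * Complex.I)))
      =O[atTop] fun y : ℝ => y := by
  refine Asymptotics.IsBigO.of_bound (|(γ 1 0 : ℝ)| * (|x| + 1) + |(γ 1 1 : ℝ)|) ?_
  filter_upwards [eventually_ge_atTop 1] with y hy
  have hpos : 0 < ((x : ℂ) + (y : ℂ) * Complex.I).im := by simp; linarith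
  rw [autom, UpperHalfPlane.ofComplex_apply_of_im_pos hpos]
  refine (norm_add_le _ _).trans ?_
  rw [norm_mul, Complex.norm_intCast, Complex.norm_intCast, Real.norm_of_nonneg (by linarith)]
  have h1 : ‖(x : ℂ) + (y : ℂ) * Complex.I‖ ≤ |x| + y := by
    refine (norm_add_le _ _).trans ?_
    simp [abs_of_nonneg (by linarith : 0 ≤ y)]
  change |(γ 1 0 : ℝ)| * ‖(x : ℂ) + (y : ℂ) * Complex.I‖ + _ ≤ _
  have h2 : |x| + y ≤ (|x| + 1) * y := by nlinarith [abs_nonneg x]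
  have h3 := mul_le_mul_of_nonneg_left (h1.trans h2) (abs_nonneg (γ 1 0 : ℝ))
  nlinarith [abs_nonneg (γ 1 1 : ℝ)]

/-- A theta quotient of moderate growth lies in `Merₙ`. At the torsion points where it is
holomorphic, its value is bounded by the maximum principle on small circles. -/
theorem mer_of_isThetaQuotient {n N : ℕ} {φ : Dom n → ℂ} (hφ : IsThetaQuotient φ)
    (hgrowth : HasModerateGrowth N φ) : Mer φ := by
  obtain ⟨D, hD, G, hG, hφG⟩ := hφ
  have hDan := analyticOnNhd_thetaProd D
  have hDne := exists_mem_upper_thetaProd_ne_zero D hD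
  have hdense := dense_ne_zero hDan hDne
  refine ⟨fun p => ⟨G, thetaProd D, hG _ (incl_mem_upper p), hDan _ (incl_mem_upper p), ?_, ?_⟩,
    fun lam mu => ?_⟩
  · intro h
    obtain ⟨q, hq, hq0⟩ := hDne
    exact hq0 (eq_zero_of_eventually_zero hDan (incl_mem_upper p) h hq)
  · exact Eventually.of_forall fun x hx => by rw [eq_div_iff hx, hφG x hx]
  obtain ⟨Ls, U, hLs, hU, hU0, hfac⟩ := thetaProd_shift D hD lam mu
  have hg : AnalyticOnNhd ℂ (fun x => G (shift lam mu x)) (upper n) := fun x hx =>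
    AnalyticAt.comp (g := G) (hG _ hx) (analyticAt_shift lam mu x)
  have hp : ∀ τ : UpperHalfPlane, shift lam mu ((τ : ℂ), (0 : Fin n → ℂ)) =
      Dom.incl (τ, torsionPoint lam mu τ) := by
    intro τ
    refine Prod.ext rfl (funext fun r => ?_)
    simp [shift, torsionPoint, Dom.incl]
  have hp' : ∀ τ : UpperHalfPlane, shift (-lam) (-mu) (Dom.incl (τ, torsionPoint lam mu τ)) =
      ((τ : ℂ), (0 : Fin n → ℂ)) := fun τ => by rw [← hp, shift_neg_shift]
  -- `φ` is holomorphic at the torsion points or has poles there, according to whether the vanishing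
  -- factors of the denominator divide the numerator
  rcases formProd_dvd_or_codiscrete_not_dvd Ls hLs hg with ⟨H, hH, hH'⟩ | hnot
  · right
    have hquot : ∀ x : Dom n, thetaProd D x.incl ≠ 0 → φ x =
        H (shift (-lam) (-mu) x.incl) / U (shift (-lam) (-mu) x.incl) := by
      intro x hx
      have hmem : shift (-lam) (-mu) x.incl ∈ upper n := incl_mem_upper x
      have h1 := hφG x hx
      have h2 := hH' _ hmem
      have h3 := hfac _ hmem
      rw [shift_shift_neg] at h2 h3
      rw [h3] at hx h1
      have hf0 := left_ne_zero_of_mul hx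
      have hu0 := right_ne_zero_of_mul hx
      rw [eq_div_iff hu0]
      refine mul_left_cancel₀ hf0 ?_
      rw [← h2, ← h1]
      ring
    refine ⟨fun τ => H ((τ : ℂ), 0) / U ((τ : ℂ), 0), ⟨?_, ?_⟩, fun τ => ?_⟩
    · have hd : ∀ f : ℂ × (Fin n → ℂ) → ℂ, AnalyticOnNhd ℂ f (upper n) →
          DifferentiableOn ℂ (fun w : ℂ => f (w, 0)) {w | 0 < w.im} := by
        intro f hf w hw
        exact (AnalyticAt.comp (g := f) (f := fun w : ℂ => (w, (0 : Fin n → ℂ))) (hf (w, 0) hw)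
          (analyticAt_id.prod analyticAt_const)).differentiableAt.differentiableWithinAt
      refine ((hd H hH).div (hd U hU) fun w hw => hU0 ⟨w, hw⟩).congr fun w hw => ?_
      rw [UpperHalfPlane.ofComplex_apply_of_im_pos hw]
      rfl
    · intro C hC γ x
      obtain ⟨δ₁, hδ₁, Y₁, h₁⟩ := exists_thetaProd_ne_zero D hD lam mu γ
      obtain ⟨δ₂, hδ₂, h₂⟩ := hgrowth lam mu γ
      have hε : 0 < min δ₁ δ₂ := lt_min hδ₁ hδ₂
      obtain ⟨K, Y₂, h₃⟩ := h₂ _ hε (min_le_right _ _)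
      have key : ∀ τ : UpperHalfPlane, max Y₁ Y₂ ≤ τ.im →
          ‖H (((γ • τ : UpperHalfPlane) : ℂ), 0) / U (((γ • τ : UpperHalfPlane) : ℂ), 0)‖ ≤
            K * ‖autom γ τ‖ ^ N := by
        intro τ hτ
        let pt : ℂ → ℂ × (Fin n → ℂ) := fun s =>
          (((γ • τ : UpperHalfPlane) : ℂ), fun _ => s / autom γ τ)
        have hpt : ∀ s, pt s ∈ upper n := fun s => (γ • τ).im_pos
        have hsh : ∀ s, shift lam mu (pt s) = (circlePoint lam mu γ τ s).incl := fun s => rfl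
        have hUne : ∀ s ∈ Metric.closedBall (0 : ℂ) (min δ₁ δ₂), U (pt s) ≠ 0 := by
          intro s hs
          rw [mem_closedBall_zero_iff] at hs
          rcases eq_or_ne s 0 with rfl | hs0
          · have : pt 0 = (((γ • τ : UpperHalfPlane) : ℂ), 0) := by
              refine Prod.ext rfl (funext fun r => ?_)
              simp [pt]
            rw [this]; exact hU0 _
          · have h4 := h₁ τ ((le_max_left _ _).trans hτ) s (norm_pos_iff.2 hs0)
              (hs.trans (min_le_left _ _))
            rw [← hsh, hfac _ (hpt s)] at h4
            exact right_ne_zero_of_mul h4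
        have hpta : ∀ s, AnalyticAt ℂ pt s := fun s =>
          analyticAt_const.prod (AnalyticAt.pi fun _ => analyticAt_id.div_const)
        have hdiff : DifferentiableOn ℂ (fun s => H (pt s) / U (pt s))
            (Metric.closedBall 0 (min δ₁ δ₂)) := by
          intro s hs
          refine DifferentiableAt.differentiableWithinAt (DifferentiableAt.div ?_ ?_ (hUne s hs))
          · exact (AnalyticAt.comp (g := H) (hH _ (hpt s)) (hpta s)).differentiableAt
          · exact (AnalyticAt.comp (g := U) (hU _ (hpt s)) (hpta s)).differentiableAt
        -- the value at the torsion point is bounded by the values at the points `circlePoint`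
        have hmax := Complex.norm_le_of_forall_mem_frontier_norm_le
          (C := K * ‖autom γ τ‖ ^ N) Metric.isBounded_ball
          (hdiff.diffContOnCl_ball subset_rfl) ?_ (subset_closure (Metric.mem_ball_self hε))
        · have : pt 0 = (((γ • τ : UpperHalfPlane) : ℂ), 0) := by
            refine Prod.ext rfl (funext fun r => ?_)
            simp [pt]
          rwa [this] at hmax
        · intro s hs
          rw [frontier_ball (0 : ℂ) hε.ne', mem_sphere_zero_iff_norm] at hs
          have h4 := h₁ τ ((le_max_left _ _).trans hτ) s (by rw [hs]; exact hε)
            (by rw [hs]; exact min_le_left _ _)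
          have h5 := h₃ τ ((le_max_right _ _).trans hτ) s hs
          rwa [hquot _ h4, ← hsh, shift_neg_shift] at h5
      have hO : (fun y : ℝ => ‖autom γ (UpperHalfPlane.ofComplex
          ((x : ℂ) + (y : ℂ) * Complex.I))‖ ^ N) =O[atTop] fun y : ℝ => Real.exp (C * y) :=
        ((autom_isBigO γ x).norm_left.pow N).trans
          (isLittleO_pow_exp_pos_mul_atTop N hC).isBigO
      refine Asymptotics.IsBigO.trans (Asymptotics.IsBigO.of_bound K ?_) hO
      filter_upwards [eventually_ge_atTop (max 1 (max Y₁ Y₂))] with y hy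
      have hy1 : 1 ≤ y := (le_max_left _ _).trans hy
      have hpos : 0 < ((x : ℂ) + (y : ℂ) * Complex.I).im := by simp; linarith
      have him : (UpperHalfPlane.ofComplex ((x : ℂ) + (y : ℂ) * Complex.I)).im = y := by
        rw [UpperHalfPlane.ofComplex_apply_of_im_pos hpos]
        simp [UpperHalfPlane.im]
      have h6 := key (UpperHalfPlane.ofComplex ((x : ℂ) + (y : ℂ) * Complex.I))
        (by rw [him]; exact (le_max_right _ _).trans hy)
      rwa [norm_pow, norm_norm]
    · have hmem : shift (-lam) (-mu) (Dom.incl (τ, torsionPoint lam mu τ)) ∈ upper n := τ.im_pos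
      refine ⟨fun x => H (shift (-lam) (-mu) x) / U (shift (-lam) (-mu) x), ?_, ?_,
        _, isOpen_ne_zero hDan, hdense, Eventually.of_forall fun x hx => hquot x hx⟩
      · refine AnalyticAt.div ?_ ?_ (by rw [hp']; exact hU0 τ)
        · exact AnalyticAt.comp (g := H) (hH _ hmem) (analyticAt_shift _ _ _)
        · exact AnalyticAt.comp (g := U) (hU _ hmem) (analyticAt_shift _ _ _)
      · simp only [hp']
  · left
    -- a holomorphic extension `f` of `φ` would make `formProd Ls` divide the numerator near the point
    refine hnot.mono fun τ hτ => ?_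
    rintro ⟨v, f, hf, -, S, -, hS, hfS⟩
    refine hτ ⟨fun x => U x * f (shift lam mu x), ?_, ?_⟩
    · refine (hU _ τ.im_pos).mul (AnalyticAt.comp (g := f) ?_ (analyticAt_shift _ _ _))
      rw [hp]; exact hf
    · have hS' : Dense (S ∩ {p : Dom n | thetaProd D p.incl ≠ 0}) :=
        hS.inter_of_isOpen_right hdense (isOpen_ne_zero hDan)
      have h1 := eventually_eq_of_dense (p := (τ, torsionPoint lam mu τ))
        (hG _ (incl_mem_upper _)) (hf.mul (hDan _ (incl_mem_upper _))) hS' (by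
          filter_upwards [hfS] with x hx hxS
          rw [← hφG x hxS.2, hx hxS.1]
          rfl)
      rw [eventually_nhds_incl (P := fun x => G x = (f * thetaProd D) x), ← hp] at h1
      have h2 := (analyticAt_shift lam mu ((τ : ℂ), (0 : Fin n → ℂ))).continuousAt.eventually h1
      have hmem : ((τ : ℂ), (0 : Fin n → ℂ)) ∈ upper n := τ.im_pos
      filter_upwards [h2, (isOpen_upper n).mem_nhds hmem] with x hx hxu
      rw [hx, Pi.mul_apply, hfac x hxu]
      ring

/-! ### Growth of the solutions of the deformed recursion -/

lemma norm_thetaCoef_le (τ : UpperHalfPlane) (z : ℂ) (r : ℕ) {C : ℝ}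
    (h : ‖thetaD r τ z‖ ≤ r.factorial * C) : ‖thetaCoef τ z r‖ ≤ C := by
  have hr : (0 : ℝ) < r.factorial := by exact_mod_cast r.factorial_pos
  rw [thetaCoef, norm_mul, norm_div, norm_pow, norm_neg, norm_one, one_pow, Complex.norm_natCast,
    one_div, inv_mul_le_iff₀ hr]
  exact h

lemma norm_expTheta_le {τ : UpperHalfPlane} {Z L : ℕ → ℂ} {m : ℕ} {C l : ℝ}
    (h : ∀ r, ‖thetaCoef τ (Z m) r‖ ≤ C) (hL : ‖L m‖ ≤ l) (r : ℕ) :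
    ‖expTheta τ Z L r m‖ ≤ C * ∑ i ∈ Finset.range (r + 1), l ^ i := by
  have hC : 0 ≤ C := (norm_nonneg _).trans (h 0)
  rw [expTheta, Finset.mul_sum]
  refine (norm_sum_le _ _).trans (Finset.sum_le_sum fun i _ => ?_)
  have hi : (1 : ℝ) ≤ i.factorial := by exact_mod_cast i.factorial_pos
  simp only [Algebra.algebraMap_self, RingHom.id_apply]
  rw [norm_mul, norm_mul, norm_pow, norm_div, norm_one, Complex.norm_natCast]
  refine mul_le_mul ?_ (pow_le_pow_left₀ (norm_nonneg _) hL i) (by positivity) hC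
  calc 1 / (i.factorial : ℝ) * ‖thetaCoef τ (Z m) (r - i)‖ ≤ 1 * ‖thetaCoef τ (Z m) (r - i)‖ := by
        refine mul_le_mul_of_nonneg_right ?_ (norm_nonneg _)
        rw [div_le_one (by linarith)]; exact hi
    _ ≤ C := by rw [one_mul]; exact h _

/-- For bounded deformation parameters `L`, the solution of the deformed recursion near the line of
the torsion points `A n * τ + B n` decays like `q ^ (A n ^ 2 / 2)`. This holds because each product
`θ(Z m) v m` is bounded by the coefficients for `m = 0`, which decay like `q ^ (1 / 8)`. -/
theorem exists_norm_deformedV_le (n : ℕ) (A B : ℕ → ℝ) (κ : ℕ → ℕ) (hκ : ∀ m, m ≠ 0 → m ≤ n → κ m ≠ 0)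
    (hA : A 0 = 0) (hB : B 0 = 0) (hκ0 : κ 0 = 0) :
    ∃ δ : ℝ, 0 < δ ∧ ∀ ε, 0 < ε → ε ≤ δ → ∀ l : ℝ, 0 ≤ l → ∃ K Y : ℝ, 0 ≤ K ∧
      ∀ τ : UpperHalfPlane, Y ≤ τ.im → ∀ s : ℂ, ‖s‖ = ε →
        (∀ m, m ≠ 0 → m ≤ n → theta τ ((A m : ℂ) * τ + B m + κ m * s) ≠ 0) ∧
        (n ≠ 0 → ∀ L : ℕ → ℂ, (∀ m < n, ‖L m‖ ≤ l) →
          ‖deformedV τ (fun m => (A m : ℂ) * τ + B m + κ m * s) L n‖ ≤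
            K * Real.exp (-(2 * Real.pi * (A n ^ 2 / 2 * τ.im)))) := by
  choose δ hδ Y h1 h2 using fun m => exists_theta_bound (A m) (B m)
  -- a radius `d` that is admissible for all partial sums
  have hev : ∀ᶠ d : ℝ in 𝓝[>] 0, ∀ m ∈ Finset.range (n + 1), κ m * d ≤ δ m := by
    rw [Finset.eventually_all]
    intro m _
    have : Tendsto (fun d : ℝ => κ m * d) (𝓝[>] 0) (𝓝 (κ m * 0)) :=
      ((continuous_const.mul continuous_id).tendsto 0).mono_left nhdsWithin_le_nhds
    rw [mul_zero] at this
    exact this.eventually (Iic_mem_nhds (hδ m))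
  obtain ⟨d, hd, hd0⟩ := (hev.and self_mem_nhdsWithin).exists
  refine ⟨d, hd0, fun ε hε hεd l hl => ?_⟩
  have hκε : ∀ m, m ≠ 0 → m ≤ n → 0 < κ m * ε ∧ κ m * ε ≤ δ m := by
    intro m hm hmn
    have : (0 : ℝ) < κ m := by exact_mod_cast Nat.pos_of_ne_zero (hκ m hm hmn)
    exact ⟨by positivity, (mul_le_mul_of_nonneg_left hεd this.le).trans
      (hd m (Finset.mem_range.2 (by omega)))⟩
  choose! c C hc hC h3 using fun (m : ℕ) (hm : m ≠ 0 ∧ m ≤ n) =>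
    h2 m (κ m * ε) (hκε m hm.1 hm.2).1 (hκε m hm.1 hm.2).2
  obtain ⟨C₀, hC₀, h4⟩ := exists_thetaD_zero_bound
  obtain ⟨y, hy20, hyY⟩ : ∃ y : ℝ, 20 ≤ y ∧ ∀ m ∈ Finset.range (n + 1), Y m ≤ y := by
    have : ∀ᶠ y : ℝ in atTop, ∀ m ∈ Finset.range (n + 1), Y m ≤ y := by
      rw [Finset.eventually_all]
      exact fun m _ => eventually_ge_atTop _
    exact ((eventually_ge_atTop 20).and this).exists
  have hnorm : ∀ m, ∀ s : ℂ, ‖s‖ = ε → ‖(κ m : ℂ) * s‖ = κ m * ε := by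
    intro m s hs
    rw [norm_mul, Complex.norm_natCast, hs]
  have hne : ∀ τ : UpperHalfPlane, y ≤ τ.im → ∀ s : ℂ, ‖s‖ = ε → ∀ m, m ≠ 0 → m ≤ n →
      theta τ ((A m : ℂ) * τ + B m + κ m * s) ≠ 0 := by
    intro τ hτ s hs m hm hmn
    refine h1 m τ ((hyY m (Finset.mem_range.2 (by omega))).trans hτ) _ ?_ ?_
    · rw [hnorm m s hs]; exact (hκε m hm hmn).1
    · rw [hnorm m s hs]; exact (hκε m hm hmn).2
  -- the bound for the products `θ(Z m) v m`, by induction on `m`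
  have key : ∀ m, m ≠ 0 → m ≤ n → ∃ K : ℝ, 0 ≤ K ∧ ∀ τ : UpperHalfPlane, y ≤ τ.im →
      ∀ s : ℂ, ‖s‖ = ε → ∀ L : ℕ → ℂ, (∀ m < n, ‖L m‖ ≤ l) →
        ‖theta τ ((A m : ℂ) * τ + B m + κ m * s) *
          deformedV τ (fun m => (A m : ℂ) * τ + B m + κ m * s) L m‖ ≤
            K * Real.exp (-(2 * Real.pi * (τ.im / 8))) := by
    intro m
    induction m using Nat.strong_induction_on with
    | _ m ih =>
      intro hm hmn
      choose! K hK0 hK using ih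
      let K' : ℕ → ℝ := fun j => if j = 0 then C₀ * ∑ i ∈ Finset.range (m + 1), l ^ i else
        C j * (∑ i ∈ Finset.range (m - j + 1), l ^ i) * K j
      have hgeom : ∀ k, 0 ≤ ∑ i ∈ Finset.range k, l ^ i := fun k =>
        Finset.sum_nonneg fun i _ => pow_nonneg hl i
      refine ⟨∑ j ∈ Finset.range m, K' j, Finset.sum_nonneg fun j hj => ?_,
        fun τ hτ s hs L hL => ?_⟩
      · have hj' := Finset.mem_range.1 hj
        by_cases hj0 : j = 0
        · simp only [K', if_pos hj0]
          exact mul_nonneg hC₀.le (hgeom _)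
        · simp only [K', if_neg hj0]
          exact mul_nonneg (mul_nonneg (hC j ⟨hj0, by omega⟩).le (hgeom _))
            (hK0 j hj' hj0 (by omega))
      · rw [deformedV, recSol_of_ne_zero hm]
        simp only [Algebra.algebraMap_self, RingHom.id_apply]
        rw [mul_comm, mul_assoc, inv_mul_cancel₀ (hne τ hτ s hs m hm hmn), mul_one, norm_neg,
          Finset.sum_mul]
        refine (norm_sum_le _ _).trans (Finset.sum_le_sum fun j hj => ?_)
        have hj' := Finset.mem_range.1 hj
        rw [norm_mul]
        by_cases hj0 : j = 0
        · subst hj0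
          simp only [K', if_true, recSol_zero, norm_one, mul_one, Nat.sub_zero]
          have h5 : ∀ r, ‖thetaCoef τ ((A 0 : ℂ) * τ + B 0 + κ 0 * s) r‖ ≤
              C₀ * Real.exp (-(2 * Real.pi * (τ.im / 8))) := by
            intro r
            rw [hA, hB, hκ0]
            simp only [Complex.ofReal_zero, zero_mul, add_zero, Nat.cast_zero]
            exact norm_thetaCoef_le τ 0 r (h4 τ (hy20.trans hτ) r)
          refine (norm_expTheta_le (Z := fun m => (A m : ℂ) * τ + B m + κ m * s) h5
            (hL 0 (by omega)) m).trans (le_of_eq ?_)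
          ring
        · simp only [K', if_neg hj0]
          have hjn : j ≠ 0 ∧ j ≤ n := ⟨hj0, by omega⟩
          have h5 : ∀ r, ‖thetaCoef τ ((A j : ℂ) * τ + B j + κ j * s) r‖ ≤
              C j * ‖theta τ ((A j : ℂ) * τ + B j + κ j * s)‖ := fun r =>
            norm_thetaCoef_le τ _ r (norm_thetaD_le r τ _ fun t ht =>
              (h3 j hjn τ ((hyY j (Finset.mem_range.2 (by omega))).trans hτ) _
                (hnorm j s hs)).2 t ht)
          have h6 := norm_expTheta_le (Z := fun m => (A m : ℂ) * τ + B m + κ m * s) h5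
            (hL j (by omega)) (m - j)
          have h7 := hK j hj' hj0 hjn.2 τ hτ s hs L hL
          rw [norm_mul, deformedV] at h7
          have h8 := mul_le_mul_of_nonneg_left h7
            (mul_nonneg (hC j hjn).le (hgeom (m - j + 1)))
          refine (mul_le_mul_of_nonneg_right h6 (norm_nonneg _)).trans ?_
          simp only [Algebra.algebraMap_self, RingHom.id_apply] at h8 ⊢
          linarith
  by_cases hn : n = 0
  · exact ⟨0, y, le_rfl, fun τ hτ s hs => ⟨hne τ hτ s hs, fun h => absurd hn h⟩⟩
  obtain ⟨K, hK0, hK⟩ := key n hn le_rfl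
  have hcn := hc n ⟨hn, le_rfl⟩
  refine ⟨K / c n, y, by positivity, fun τ hτ s hs => ⟨hne τ hτ s hs, fun _ L hL => ?_⟩⟩
  have h5 := hK τ hτ s hs L hL
  have h6 := (h3 n ⟨hn, le_rfl⟩ τ ((hyY n (Finset.mem_range.2 (by omega))).trans hτ) _
    (hnorm n s hs)).1
  rw [norm_mul] at h5
  have h7 := (mul_le_mul_of_nonneg_right h6 (norm_nonneg
    (deformedV τ (fun m => (A m : ℂ) * τ + B m + κ m * s) L n))).trans h5
  have h8 : Real.exp (-(2 * Real.pi * (τ.im / 8))) =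
      Real.exp (-(2 * Real.pi * ((1 / 8 - A n ^ 2 / 2) * τ.im))) *
        Real.exp (-(2 * Real.pi * (A n ^ 2 / 2 * τ.im))) := by
    rw [← Real.exp_add]
    congr 1
    ring
  rw [h8] at h7
  have hpos := Real.exp_pos (-(2 * Real.pi * ((1 / 8 - A n ^ 2 / 2) * τ.im)))
  rw [div_mul_eq_mul_div, le_div_iff₀ hcn]
  refine le_of_mul_le_mul_left ?_ hpos
  linarith

/-! ### The deformed recursion and the space `Merₙ` -/

lemma thetaProd_append {n : ℕ} (D D' : List (Finset (Fin n) × ℝ × ℝ)) (x : ℂ × (Fin n → ℂ)) :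
    thetaProd (D ++ D') x = thetaProd D x * thetaProd D' x := by
  simp [thetaProd]

lemma isThetaQuotient_of_analytic {n : ℕ} {f : ℂ × (Fin n → ℂ) → ℂ}
    (hf : AnalyticOnNhd ℂ f (upper n)) : IsThetaQuotient fun p : Dom n => f p.incl :=
  ⟨[], by simp, f, hf, fun p _ => by simp [thetaProd]⟩

lemma IsThetaQuotient.add {n : ℕ} {φ ψ : Dom n → ℂ} (hφ : IsThetaQuotient φ)
    (hψ : IsThetaQuotient ψ) : IsThetaQuotient fun p => φ p + ψ p := by
  obtain ⟨D, hD, G, hG, h⟩ := hφ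
  obtain ⟨D', hD', G', hG', h'⟩ := hψ
  refine ⟨D ++ D', fun d hd => (List.mem_append.1 hd).elim (hD d) (hD' d),
    fun x => G x * thetaProd D' x + G' x * thetaProd D x, fun x hx =>
      ((hG x hx).mul (analyticOnNhd_thetaProd D' x hx)).add
        ((hG' x hx).mul (analyticOnNhd_thetaProd D x hx)), fun p hp => ?_⟩
  rw [thetaProd_append] at hp ⊢
  change (φ p + ψ p) * _ = G p.incl * _ + G' p.incl * _
  rw [← h p (left_ne_zero_of_mul hp), ← h' p (right_ne_zero_of_mul hp)]
  ring

lemma IsThetaQuotient.mul {n : ℕ} {φ ψ : Dom n → ℂ} (hφ : IsThetaQuotient φ)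
    (hψ : IsThetaQuotient ψ) : IsThetaQuotient fun p => φ p * ψ p := by
  obtain ⟨D, hD, G, hG, h⟩ := hφ
  obtain ⟨D', hD', G', hG', h'⟩ := hψ
  refine ⟨D ++ D', fun d hd => (List.mem_append.1 hd).elim (hD d) (hD' d),
    fun x => G x * G' x, fun x hx => (hG x hx).mul (hG' x hx), fun p hp => ?_⟩
  rw [thetaProd_append] at hp ⊢
  change (φ p * ψ p) * _ = G p.incl * G' p.incl
  rw [← h p (left_ne_zero_of_mul hp), ← h' p (right_ne_zero_of_mul hp)]
  ring

lemma IsThetaQuotient.sum {n : ℕ} {ι : Type*} (s : Finset ι) {φ : ι → Dom n → ℂ}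
    (h : ∀ i ∈ s, IsThetaQuotient (φ i)) : IsThetaQuotient fun p => ∑ i ∈ s, φ i p := by
  classical
  induction s using Finset.induction_on with
  | empty => simpa using isThetaQuotient_of_analytic (n := n) (f := fun _ => 0) analyticOnNhd_const
  | insert i s hi ih =>
    simp only [Finset.sum_insert hi]
    exact (h i (by simp)).add (ih fun j hj => h j (by simp [hj]))

lemma isThetaQuotient_inv {n : ℕ} {S : Finset (Fin n)} (hS : S.Nonempty) (a b : ℝ) :
    IsThetaQuotient fun p : Dom n => (theta p.1 (sumForm S p.incl + ((a : ℂ) * p.1 + b)))⁻¹ := by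
  refine ⟨[(S, a, b)], by simpa using hS, fun _ => 1, analyticOnNhd_const, fun p hp => ?_⟩
  have h : thetaProd [(S, a, b)] p.incl = theta p.1 (sumForm S p.incl + ((a : ℂ) * p.1 + b)) := by
    rw [theta_eq_thetaC]
    simp [thetaProd, Dom.incl]
  rw [h] at hp ⊢
  exact inv_mul_cancel₀ hp

lemma isThetaQuotient_thetaCoef {n : ℕ} (S : Finset (Fin n)) (a b : ℝ) (r : ℕ) :
    IsThetaQuotient fun p : Dom n =>
      thetaCoef p.1 (sumForm S p.incl + ((a : ℂ) * p.1 + b)) r := by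
  have h := isThetaQuotient_of_analytic (n := n) (f := fun x => (-1) ^ r / r.factorial *
    thetaCD r x.1 (sumForm S x + ((a : ℂ) * x.1 + b))) (fun x hx => by
      refine analyticAt_const.mul (AnalyticAt.comp (g := fun y : ℂ × ℂ => thetaCD r y.1 y.2)
        (f := fun x : ℂ × (Fin n → ℂ) => (x.1, sumForm S x + ((a : ℂ) * x.1 + b)))
        (analyticAt_thetaCD r hx _) (analyticAt_fst.prod ?_))
      exact ((sumForm S).analyticAt x).add
        ((analyticAt_const.mul analyticAt_fst).add analyticAt_const))
  simp only [thetaCoef, thetaD_eq_thetaCD]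
  exact h

/-- The solution of the deformed recursion along a chain of sets of elliptic variables is a theta
quotient. -/
theorem isThetaQuotient_deformedV {n : ℕ} (S : ℕ → Finset (Fin n)) (a b : ℕ → ℝ) (L : ℕ → ℂ)
    {N : ℕ} (hS : ∀ m, m ≠ 0 → m ≤ N → (S m).Nonempty) : IsThetaQuotient fun p : Dom n =>
      deformedV p.1 (fun m => sumForm (S m) p.incl + ((a m : ℂ) * p.1 + b m)) L N := by
  simp only [deformedV]
  induction N using Nat.strong_induction_on with
  | _ N ih =>
    rcases eq_or_ne N 0 with rfl | hN
    · simpa using isThetaQuotient_of_analytic (n := n) (f := fun _ => 1) analyticOnNhd_const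
    · simp only [recSol_of_ne_zero hN, neg_mul, Finset.sum_mul]
      have h : IsThetaQuotient fun p : Dom n => (-1 : ℂ) * ∑ m ∈ Finset.range N,
          expTheta p.1 (fun m => sumForm (S m) p.incl + ((a m : ℂ) * p.1 + b m)) L (N - m) m *
            recSol (expTheta p.1 (fun m => sumForm (S m) p.incl + ((a m : ℂ) * p.1 + b m)) L)
              (fun m => algebraMap ℂ ℂ
                (theta p.1 (sumForm (S m) p.incl + ((a m : ℂ) * p.1 + b m)))⁻¹) m *
            algebraMap ℂ ℂ (theta p.1 (sumForm (S N) p.incl + ((a N : ℂ) * p.1 + b N)))⁻¹ := by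
        refine (isThetaQuotient_of_analytic (f := fun _ => (-1 : ℂ)) analyticOnNhd_const).mul
          (IsThetaQuotient.sum _ fun m hm => ?_)
        have hm' := Finset.mem_range.1 hm
        refine IsThetaQuotient.mul (IsThetaQuotient.mul ?_
          (ih m hm' fun k hk hkm => hS k hk (hkm.trans hm'.le)))
          (isThetaQuotient_inv (hS N hN le_rfl) (a N) (b N))
        simp only [expTheta]
        refine IsThetaQuotient.sum _ fun i _ => ?_
        refine IsThetaQuotient.mul ?_
          (isThetaQuotient_of_analytic (f := fun _ => L m ^ i) analyticOnNhd_const)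
        exact (isThetaQuotient_of_analytic (f := fun _ => 1 / (i.factorial : ℂ))
          analyticOnNhd_const).mul (isThetaQuotient_thetaCoef (S m) (a m) (b m) (N - m - i))
      simpa only [neg_mul, one_mul] using h

lemma HasModerateGrowth.const_mul {n N : ℕ} {φ : Dom n → ℂ} (h : HasModerateGrowth N φ) (a : ℂ) :
    HasModerateGrowth N fun p => a * φ p := by
  intro lam mu γ
  obtain ⟨δ, hδ, h⟩ := h lam mu γ
  refine ⟨δ, hδ, fun ε hε hεδ => ?_⟩
  obtain ⟨K, Y, hK⟩ := h ε hε hεδ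
  refine ⟨‖a‖ * K, Y, fun τ hτ s hs => ?_⟩
  rw [norm_mul, mul_assoc]
  exact mul_le_mul_of_nonneg_left (hK τ hτ s hs) (norm_nonneg a)

lemma HasModerateGrowth.sum {n N : ℕ} {ι : Type*} (s : Finset ι) {φ : ι → Dom n → ℂ}
    (h : ∀ i ∈ s, HasModerateGrowth N (φ i)) : HasModerateGrowth N fun p => ∑ i ∈ s, φ i p := by
  classical
  induction s using Finset.induction_on with
  | empty =>
    exact fun lam mu γ => ⟨1, one_pos, fun ε _ _ => ⟨0, 0, fun τ _ s _ => by simp⟩⟩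
  | insert i s hi ih =>
    intro lam mu γ
    obtain ⟨δ, hδ, h1⟩ := h i (by simp) lam mu γ
    obtain ⟨δ', hδ', h2⟩ := ih (fun j hj => h j (by simp [hj])) lam mu γ
    refine ⟨min δ δ', lt_min hδ hδ', fun ε hε hεδ => ?_⟩
    obtain ⟨K, Y, hK⟩ := h1 ε hε (hεδ.trans (min_le_left _ _))
    obtain ⟨K', Y', hK'⟩ := h2 ε hε (hεδ.trans (min_le_right _ _))
    refine ⟨K + K', max Y Y', fun τ hτ s hs => ?_⟩
    simp only [Finset.sum_insert hi]
    refine (norm_add_le _ _).trans ?_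
    rw [add_mul]
    exact add_le_add (hK τ ((le_max_left _ _).trans hτ) s hs)
      (hK' τ ((le_max_right _ _).trans hτ) s hs)

lemma one_le_norm_autom (γ : SL(2, ℤ)) {τ : UpperHalfPlane} (hτ : 1 ≤ τ.im) :
    1 ≤ ‖autom γ τ‖ := by
  by_cases hc : γ 1 0 = 0
  · have h := det_eq_one γ
    rw [hc] at h
    have h1 : (γ 0 0) * (γ 1 1) = 1 := by
      simp only [Int.cast_zero, mul_zero, sub_zero] at h
      exact_mod_cast h
    have h2 : autom γ τ = (γ 1 1 : ℂ) := by simp [autom, hc]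
    rw [h2, Complex.norm_intCast]
    rcases Int.eq_one_or_neg_one_of_mul_eq_one' h1 with ⟨-, h⟩ | ⟨-, h⟩ <;> simp [h]
  · refine le_trans ?_ (Complex.abs_im_le_norm _)
    have h1 : (autom γ τ).im = γ 1 0 * τ.im := by simp [autom]
    have h2 : (1 : ℝ) ≤ |(γ 1 0 : ℝ)| := by exact_mod_cast Int.one_le_abs hc
    rw [h1, abs_mul, abs_of_pos τ.im_pos]
    nlinarith

lemma bil_indexF (n : ℕ) (z w : Fin n → ℂ) :
    bil (indexF n) z w = -(1 / 2) * (∑ r, z r) * ∑ r, w r := by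
  rw [bil, mul_assoc, Finset.sum_mul_sum, Finset.mul_sum]
  refine Finset.sum_congr rfl fun r _ => ?_
  rw [Finset.mul_sum]
  refine Finset.sum_congr rfl fun s _ => ?_
  simp [indexF]
  ring

/-- The function of `(τ, z)` obtained by solving the deformed recursion along a chain `S` of sets of
elliptic variables, with constant deformation parameters. -/
noncomputable def chainV {n : ℕ} (S : ℕ → Finset (Fin n)) (L : ℕ → ℂ) (p : Dom n) : ℂ :=
  deformedV p.1 (fun m => sumForm (S m) p.incl) L n

lemma incl_add_torsionPoint {n : ℕ} (lam mu : Fin n → ℝ) (p : Dom n) :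
    Dom.incl (p.1, p.2 + torsionPoint lam mu p.1) = shift lam mu p.incl := rfl

lemma isThetaQuotient_slashEll_chainV {n : ℕ} {S : ℕ → Finset (Fin n)}
    (hS : ∀ m, m ≠ 0 → m ≤ n → (S m).Nonempty) (L : ℕ → ℂ) (M : Matrix (Fin n) (Fin n) ℚ)
    (lam mu : Fin n → ℝ) : IsThetaQuotient (slashEll M (chainV S L) lam mu) := by
  refine IsThetaQuotient.mul (IsThetaQuotient.mul ?_ ?_) ?_
  · exact isThetaQuotient_of_analytic (f := fun _ => e (bil M (fun r => (lam r : ℂ) + (mu r : ℂ))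
      (fun r => (lam r : ℂ) + (mu r : ℂ)))) analyticOnNhd_const
  · refine isThetaQuotient_of_analytic (f := fun x => e (bil M (fun r => (lam r : ℂ))
      (fun r => (lam r : ℂ) * x.1 + 2 * x.2 r))) fun x hx => AnalyticAt.e_comp ?_
    exact analyticAt_bil M (fun r => analyticAt_const) fun r =>
      (analyticAt_const.mul analyticAt_fst).add (analyticAt_const.mul (analyticAt_coord r x))
  · simp only [chainV, incl_add_torsionPoint, sumForm_shift]
    exact isThetaQuotient_deformedV S _ _ L hS

/-- The growth of the slash transforms of `chainV`. By modularity the function is evaluated at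
`τ` instead of `γτ`; the exponential factors combine to `e(Λ² γτ / 2)` with `Λ = ∑ lam r`, up to a
bounded factor. -/
theorem hasModerateGrowth_slashEll_chainV {n : ℕ} (hn : n ≠ 0) {S : ℕ → Finset (Fin n)}
    (hS : ∀ m, m ≠ 0 → m ≤ n → (S m).Nonempty) (hS0 : S 0 = ∅) (hSn : S n = Finset.univ)
    (L : ℕ → ℂ) (lam₀ mu₀ : Fin n → ℝ) :
    HasModerateGrowth n (slashEll (indexF n) (chainV S L) lam₀ mu₀) := by
  intro lam mu γ
  let P : ℕ → ℝ := fun m => ∑ r ∈ S m, (lam r + lam₀ r)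
  let Q : ℕ → ℝ := fun m => ∑ r ∈ S m, (mu r + mu₀ r)
  let A : ℕ → ℝ := fun m => P m * γ 0 0 + Q m * γ 1 0
  let B : ℕ → ℝ := fun m => P m * γ 0 1 + Q m * γ 1 1
  have hP0 : P 0 = 0 := by simp [P, hS0]
  have hQ0 : Q 0 = 0 := by simp [Q, hS0]
  obtain ⟨δ, hδ, h⟩ := exists_norm_deformedV_le n A B (fun m => (S m).card)
    (fun m hm hmn => (hS m hm hmn).card_pos.ne') (by simp [A, hP0, hQ0]) (by simp [B, hP0, hQ0])
    (by simp [hS0])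
  refine ⟨δ, hδ, fun ε hε hεδ => ?_⟩
  set l : ℝ := ∑ m ∈ Finset.range n, (‖L m‖ + |A m| + |P m| + |(γ 1 0 : ℝ)| * (S m).card * ε)
    with hl
  have hlterm : ∀ m, 0 ≤ ‖L m‖ + |A m| + |P m| + |(γ 1 0 : ℝ)| * (S m).card * ε := fun m => by
    positivity
  obtain ⟨K, Y, hK0, hK⟩ := h ε hε hεδ l (Finset.sum_nonneg fun m _ => hlterm m)
  set b : ℝ := (|A n| + |P n|) * n * ε + |(γ 1 0 : ℝ)| * n ^ 2 * ε ^ 2 +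
    |∑ r, lam₀ r| * n * ε with hb
  refine ⟨Real.exp (2 * Real.pi * b) * K, max Y 1, fun τ hτ s hs => ?_⟩
  have hτY := (le_max_left _ _).trans hτ
  have hJ1 := one_le_norm_autom γ ((le_max_right _ _).trans hτ)
  have hJ0 := autom_ne_zero γ τ
  obtain ⟨hne, hbound⟩ := hK τ hτY s hs
  set J := autom γ τ with hJ
  have hJinv : ∀ x : ℂ, ‖x / J‖ ≤ ‖x‖ := fun x => by
    rw [norm_div]; exact div_le_self (norm_nonneg _) hJ1
  set c : ℂ := (γ 1 0 : ℂ) with hc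
  have hcn : ‖c‖ = |(γ 1 0 : ℝ)| := by rw [hc, Complex.norm_intCast]
  have hdet := det_eq_one γ
  -- the partial sums at the given point
  have hsum : ∀ m, sumForm (S m) (shift lam₀ mu₀ (circlePoint lam mu γ τ s).incl) =
      ((A m : ℂ) * τ + B m + (S m).card * s) / J := by
    intro m
    have h1 := lattice_smul γ τ (P m) (Q m)
    rw [sumForm_shift, add_div, ← h1, sumForm_apply]
    simp only [circlePoint, Dom.incl, Finset.sum_add_distrib, Finset.sum_const, nsmul_eq_mul,
      ← Finset.sum_mul, P, Q]
    push_cast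
    ring
  have hcA : ∀ m, c * ((A m : ℂ) * τ + B m) = A m * J - P m := by
    intro m
    simp only [A, B, hJ, autom, hc]
    push_cast
    linear_combination (-(P m : ℂ)) * hdet
  have hLbound : ∀ m < n,
      ‖(L m - c * ((A m : ℂ) * τ + B m + (S m).card * s)) / J‖ ≤ l := by
    intro m hm
    have h1 : (L m - c * ((A m : ℂ) * τ + B m + (S m).card * s)) / J =
        L m / J - A m + P m / J - c * (S m).card * s / J := by
      field_simp
      linear_combination -hcA m
    rw [h1]
    refine le_trans ?_ (Finset.single_le_sum (fun m _ => hlterm m) (Finset.mem_range.2 hm))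
    refine (norm_sub_le _ _).trans (add_le_add ((norm_add_le _ _).trans (add_le_add
      ((norm_sub_le _ _).trans (add_le_add (hJinv _) ?_)) ?_)) ?_)
    · simp
    · refine (hJinv _).trans ?_; simp
    · refine (hJinv _).trans ?_
      rw [norm_mul, norm_mul, hs, hcn, Complex.norm_natCast]
  have hV := hbound hn _ hLbound
  have hmod := deformedV_modular γ τ (fun m => (A m : ℂ) * τ + B m + (S m).card * s) L
    (by simp [A, B, hP0, hQ0, hS0]) (n := n) hne
  simp only [← hJ, ← hc] at hmod
  have hcard : (S n).card = n := by rw [hSn]; simp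
  -- the exponential factors, collected in the exponent `E` of `hval`
  set Z : ℂ := (A n : ℂ) * τ + B n + (S n).card * s with hZ
  have hval : slashEll (indexF n) (chainV S L) lam₀ mu₀ (circlePoint lam mu γ τ s) =
      e (bil (indexF n) (fun r => (lam₀ r : ℂ) + (mu₀ r : ℂ))
        (fun r => (lam₀ r : ℂ) + (mu₀ r : ℂ)) +
        bil (indexF n) (fun r => (lam₀ r : ℂ)) (fun r => (lam₀ r : ℂ) *
          ((γ • τ : UpperHalfPlane) : ℂ) + 2 * (circlePoint lam mu γ τ s).2 r) +
        -c * Z ^ 2 / (2 * J)) * (J ^ n * deformedV τ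
          (fun m => (A m : ℂ) * τ + B m + (S m).card * s)
          (fun m => (L m - c * ((A m : ℂ) * τ + B m + (S m).card * s)) / J) n) := by
    rw [slashEll, chainV]
    simp only [incl_add_torsionPoint, hsum]
    change e _ * e (bil (indexF n) (fun r => (lam₀ r : ℂ)) (fun r => (lam₀ r : ℂ) *
      ((γ • τ : UpperHalfPlane) : ℂ) + 2 * (circlePoint lam mu γ τ s).2 r)) *
      deformedV (γ • τ) _ _ _ = _
    rw [hmod, e_add, e_add]
    ring
  have hexp : ∃ x : ℝ, ∃ y : ℂ, ‖y‖ ≤ b ∧ bil (indexF n) (fun r => (lam₀ r : ℂ) + (mu₀ r : ℂ))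
        (fun r => (lam₀ r : ℂ) + (mu₀ r : ℂ)) +
        bil (indexF n) (fun r => (lam₀ r : ℂ)) (fun r => (lam₀ r : ℂ) *
          ((γ • τ : UpperHalfPlane) : ℂ) + 2 * (circlePoint lam mu γ τ s).2 r) +
        -c * Z ^ 2 / (2 * J) + (A n : ℂ) ^ 2 / 2 * τ =
      ((∑ r, lam r : ℝ) : ℂ) ^ 2 / 2 * ((γ • τ : UpperHalfPlane) : ℂ) + x + y := by
    set Λ₀ : ℝ := ∑ r, lam₀ r with hΛ₀
    set Λ : ℝ := ∑ r, lam r with hΛ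
    set M₀ : ℝ := ∑ r, mu₀ r with hM₀
    set M : ℝ := ∑ r, mu r with hM
    have hPn : P n = Λ + Λ₀ := by simp [P, hSn, Finset.sum_add_distrib, hΛ, hΛ₀]
    have hQn : Q n = M + M₀ := by simp [Q, hSn, Finset.sum_add_distrib, hM, hM₀]
    refine ⟨-(1 / 2) * (Λ₀ + M₀) ^ 2 - Λ₀ * M - (A n * B n - P n * Q n) / 2,
      -(A n - P n / J) * (n * s) - c * n ^ 2 * s ^ 2 / (2 * J) - Λ₀ * n * s / J, ?_, ?_⟩
    · refine (norm_sub_le _ _).trans (add_le_add ((norm_sub_le _ _).trans (add_le_add ?_ ?_)) ?_)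
      · rw [norm_mul, norm_neg, norm_mul, hs, Complex.norm_natCast, ← mul_assoc]
        refine mul_le_mul_of_nonneg_right (mul_le_mul_of_nonneg_right ?_ (Nat.cast_nonneg n)) hε.le
        refine (norm_sub_le _ _).trans (add_le_add (by simp) ((hJinv _).trans (by simp)))
      · rw [← div_div]
        refine (hJinv _).trans ?_
        rw [norm_div, norm_mul, norm_mul, norm_pow, norm_pow, hs, hcn, Complex.norm_natCast]
        refine div_le_self (by positivity) (by simp)
      · refine (hJinv _).trans (le_of_eq ?_)
        rw [norm_mul, norm_mul, hs, Complex.norm_natCast, Complex.norm_real, Real.norm_eq_abs]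
    · have hg := lattice_smul γ τ (P n) (Q n)
      have hg' : J * ((P n : ℂ) * ((γ • τ : UpperHalfPlane) : ℂ) + Q n) = (A n : ℂ) * τ + B n := by
        rw [hg, ← hJ, ← mul_div_assoc, mul_div_cancel_left₀ _ hJ0]
      have hs1 : ∑ r, (circlePoint lam mu γ τ s).2 r =
          n * s / J + (Λ * ((γ • τ : UpperHalfPlane) : ℂ) + M) := by
        simp only [circlePoint, Finset.sum_add_distrib, Finset.sum_const, nsmul_eq_mul,
          ← Finset.sum_mul, hΛ, hM, Finset.card_univ, Fintype.card_fin]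
        push_cast
        ring
      have hcZ : -c * Z ^ 2 / (2 * J) = -(A n : ℂ) ^ 2 / 2 * τ - A n * B n / 2 +
          P n * ((P n : ℂ) * ((γ • τ : UpperHalfPlane) : ℂ) + Q n) / 2 -
          (A n - P n / J) * (n * s) - c * n ^ 2 * s ^ 2 / (2 * J) := by
        have h1 := hcA n
        have h2 : (P n : ℂ) * ((γ • τ : UpperHalfPlane) : ℂ) + Q n = ((A n : ℂ) * τ + B n) / J := by
          rw [← hg']; field_simp
        rw [h2, hZ, hcard]
        field_simp
        linear_combination (-((A n : ℂ) * τ + B n) - 2 * n * s) * h1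
      rw [bil_indexF, bil_indexF, hcZ]
      simp only [Finset.sum_add_distrib, ← Finset.mul_sum, ← Finset.sum_mul, hs1]
      simp only [← Complex.ofReal_sum]
      rw [← hΛ₀, ← hM₀, hPn, hQn]
      push_cast
      ring
  obtain ⟨x, y, hy, hxy⟩ := hexp
  rw [hval]
  generalize bil (indexF n) (fun r => (lam₀ r : ℂ) + (mu₀ r : ℂ))
    (fun r => (lam₀ r : ℂ) + (mu₀ r : ℂ)) +
    bil (indexF n) (fun r => (lam₀ r : ℂ)) (fun r => (lam₀ r : ℂ) *
      ((γ • τ : UpperHalfPlane) : ℂ) + 2 * (circlePoint lam mu γ τ s).2 r) +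
    -c * Z ^ 2 / (2 * J) = E at hxy ⊢
  have hEim : ‖e E‖ * Real.exp (-(2 * Real.pi * (A n ^ 2 / 2 * τ.im))) ≤
      Real.exp (2 * Real.pi * b) := by
    rw [norm_e, ← Real.exp_add]
    refine Real.exp_le_exp.2 ?_
    have h1 := congrArg Complex.im hxy
    have e1 : ((A n : ℂ) ^ 2 / 2 * τ).im = A n ^ 2 / 2 * τ.im := by
      rw [show (A n : ℂ) ^ 2 / 2 = ((A n ^ 2 / 2 : ℝ) : ℂ) by push_cast; ring,
        Complex.im_ofReal_mul]
      rfl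
    have e2 : (((∑ r, lam r : ℝ) : ℂ) ^ 2 / 2 * ((γ • τ : UpperHalfPlane) : ℂ)).im =
        (∑ r, lam r) ^ 2 / 2 * (γ • τ).im := by
      rw [show ((∑ r, lam r : ℝ) : ℂ) ^ 2 / 2 = (((∑ r, lam r) ^ 2 / 2 : ℝ) : ℂ) by push_cast; ring,
        Complex.im_ofReal_mul]
      rfl
    rw [Complex.add_im, Complex.add_im, Complex.add_im, e1, e2, Complex.ofReal_im] at h1
    have h2 := (Complex.abs_im_le_norm y).trans hy
    have h3 := (abs_le.1 h2).1
    have h4 : 0 ≤ (∑ r, lam r) ^ 2 / 2 * (γ • τ).im :=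
      mul_nonneg (by positivity) (γ • τ).im_pos.le
    have h5 : -(E.im + A n ^ 2 / 2 * τ.im) ≤ b := by linarith
    have h6 := mul_le_mul_of_nonneg_left h5 (by positivity : 0 ≤ 2 * Real.pi)
    linarith
  rw [norm_mul, norm_mul, norm_pow]
  calc _ ≤ ‖e E‖ * (‖J‖ ^ n * (K * Real.exp (-(2 * Real.pi * (A n ^ 2 / 2 * τ.im))))) := by
        gcongr
    _ = (‖e E‖ * Real.exp (-(2 * Real.pi * (A n ^ 2 / 2 * τ.im)))) * (K * ‖J‖ ^ n) := by ring
    _ ≤ Real.exp (2 * Real.pi * b) * (K * ‖J‖ ^ n) :=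
        mul_le_mul_of_nonneg_right hEim (by positivity)
    _ = _ := by ring

/-! ### The completed `n`-point function -/

/-- The first `m` terms of the sequence `σ 0, σ 1, …`, as a set. -/
def prefixSet {n : ℕ} (σ : Equiv.Perm (Fin n)) (m : ℕ) : Finset (Fin n) :=
  Finset.univ.filter fun r => ((σ.symm r : Fin n) : ℕ) < m

lemma mem_prefixSet {n : ℕ} {σ : Equiv.Perm (Fin n)} {m : ℕ} {r : Fin n} :
    r ∈ prefixSet σ m ↔ ((σ.symm r : Fin n) : ℕ) < m := by
  simp [prefixSet]

lemma prefixSet_zero {n : ℕ} (σ : Equiv.Perm (Fin n)) : prefixSet σ 0 = ∅ := by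
  simp [prefixSet]

lemma prefixSet_self {n : ℕ} (σ : Equiv.Perm (Fin n)) : prefixSet σ n = Finset.univ := by
  simp [prefixSet]

lemma prefixSet_nonempty {n : ℕ} (σ : Equiv.Perm (Fin n)) {m : ℕ} (hm : m ≠ 0) (hmn : m ≤ n) :
    (prefixSet σ m).Nonempty :=
  ⟨σ ⟨0, by omega⟩, by rw [mem_prefixSet, Equiv.symm_apply_apply]; exact Nat.pos_of_ne_zero hm⟩

lemma prefixSet_succ {n : ℕ} (σ : Equiv.Perm (Fin n)) {j : ℕ} (hj : j < n) :
    prefixSet σ (j + 1) = insert (σ ⟨j, hj⟩) (prefixSet σ j) := by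
  ext r
  rw [Finset.mem_insert, mem_prefixSet, mem_prefixSet, Nat.lt_succ_iff_lt_or_eq, or_comm,
    ← Equiv.symm_apply_eq, Fin.ext_iff]

lemma sum_prefixSet_succ {n : ℕ} {A : Type*} [AddCommMonoid A] (σ : Equiv.Perm (Fin n)) {j : ℕ}
    (hj : j < n) (f : Fin n → A) :
    ∑ r ∈ prefixSet σ (j + 1), f r = ∑ r ∈ prefixSet σ j, f r + f (σ ⟨j, hj⟩) := by
  rw [prefixSet_succ σ hj, Finset.sum_insert, add_comm]
  simp [mem_prefixSet]

/-- The completion of `Fₙ` at the point `p`, as a polynomial in `ξ(τ, z₁), …, ξ(τ, zₙ)`: the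
summand belonging to `σ` is the solution of the recursion deformed by the parameters
`-(ξ(z_{σ(1)}) + ⋯ + ξ(z_{σ(m)}))`. -/
noncomputable def polyF {n : ℕ} (p : Dom n) : MvPolynomial (Fin n) ℂ :=
  ∑ σ : Equiv.Perm (Fin n), deformedV p.1 (fun m => sumForm (prefixSet σ m) p.incl)
    (fun m => -∑ r ∈ prefixSet σ m, MvPolynomial.X r) n

lemma eval_polyF {n : ℕ} (p : Dom n) (x : Fin n → ℂ) :
    MvPolynomial.eval x (polyF p) = ∑ σ : Equiv.Perm (Fin n),
      chainV (prefixSet σ) (fun m => -∑ r ∈ prefixSet σ m, x r) p := by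
  rw [polyF, map_sum]
  refine Finset.sum_congr rfl fun σ _ => ?_
  have h := map_deformedV (MvPolynomial.aeval x) p.1 (fun m => sumForm (prefixSet σ m) p.incl)
    (fun m => -∑ r ∈ prefixSet σ m, (MvPolynomial.X r : MvPolynomial (Fin n) ℂ)) n
  rw [← MvPolynomial.coe_aeval_eq_eval]
  refine h.trans ?_
  simp [chainV]

lemma totalDegree_deformedV_le {n : ℕ} (τ : UpperHalfPlane) (Z : ℕ → ℂ)
    {L : ℕ → MvPolynomial (Fin n) ℂ} (hL : ∀ m, (L m).totalDegree ≤ 1) (N : ℕ) :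
    (deformedV τ Z L N).totalDegree ≤ N := by
  rw [deformedV]
  induction N using Nat.strong_induction_on with
  | _ N ih =>
    rcases eq_or_ne N 0 with rfl | hN
    · simp
    · rw [recSol_of_ne_zero hN]
      refine (MvPolynomial.totalDegree_mul _ _).trans ?_
      rw [MvPolynomial.algebraMap_eq, MvPolynomial.totalDegree_C, add_zero,
        MvPolynomial.totalDegree_neg]
      refine MvPolynomial.totalDegree_finsetSum_le fun m hm => ?_
      have hm' := Finset.mem_range.1 hm
      refine (MvPolynomial.totalDegree_mul _ _).trans ?_
      have h1 : (expTheta τ Z L (N - m) m).totalDegree ≤ N - m := by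
        refine MvPolynomial.totalDegree_finsetSum_le fun i hi => ?_
        refine (MvPolynomial.totalDegree_mul _ _).trans ?_
        rw [MvPolynomial.algebraMap_eq, MvPolynomial.totalDegree_C, zero_add]
        refine (MvPolynomial.totalDegree_pow _ _).trans ?_
        have := Finset.mem_range.1 hi
        calc i * (L m).totalDegree ≤ i * 1 := Nat.mul_le_mul_left _ (hL m)
          _ ≤ N - m := by omega
      have h2 := ih m hm'
      simp only [MvPolynomial.algebraMap_eq] at h1 h2 ⊢
      omega

lemma totalDegree_polyF_le {n : ℕ} (p : Dom n) : (polyF p).totalDegree ≤ n := by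
  refine MvPolynomial.totalDegree_finsetSum_le fun σ _ => totalDegree_deformedV_le _ _ (fun m => ?_) n
  rw [MvPolynomial.totalDegree_neg]
  exact MvPolynomial.totalDegree_finsetSum_le fun r _ => (MvPolynomial.totalDegree_X r).le

/-- Interpolation: a coefficient of a polynomial of bounded degree is a linear combination of
finitely many of its values. -/
lemma exists_coeff_eq_sum_eval {σ : Type*} [Finite σ] (N : ℕ) (j : σ →₀ ℕ) :
    ∃ a : (σ → ℂ) →₀ ℂ, ∀ P : MvPolynomial σ ℂ, P.totalDegree ≤ N →
      P.coeff j = a.sum fun x b => b * MvPolynomial.eval x P := by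
  let E := MvPolynomial.restrictTotalDegree σ ℂ N
  let Lx : (σ → ℂ) → E →ₗ[ℂ] ℂ := fun x =>
    (MvPolynomial.aeval x : MvPolynomial σ ℂ →ₐ[ℂ] ℂ).toLinearMap.comp E.subtype
  let K : E →ₗ[ℂ] ℂ := (MvPolynomial.lcoeff ℂ j).comp E.subtype
  have h : K ∈ Submodule.span ℂ (Set.range Lx) := by
    refine FiniteDimensional.mem_span_of_iInf_ker_le_ker fun P hP => ?_
    rw [Submodule.mem_iInf] at hP
    have h0 : (P : MvPolynomial σ ℂ) = 0 := MvPolynomial.funext fun x => by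
      have := hP x
      rw [LinearMap.mem_ker] at this
      simpa [Lx, MvPolynomial.coe_aeval_eq_eval] using this
    rw [LinearMap.mem_ker]
    simp [K, h0]
  obtain ⟨a, ha⟩ := Finsupp.mem_span_range_iff_exists_finsupp.1 h
  refine ⟨a, fun P hP => ?_⟩
  have h1 := LinearMap.congr_fun ha ⟨P, (MvPolynomial.mem_restrictTotalDegree _ _ _).2 hP⟩
  rw [Finsupp.sum, LinearMap.sum_apply] at h1
  simpa [Lx, K, Finsupp.sum, MvPolynomial.coe_aeval_eq_eval] using h1.symm

lemma slashEll_sum {n : ℕ} (M : Matrix (Fin n) (Fin n) ℚ) {ι : Type*} (s : Finset ι) (b : ι → ℂ)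
    (φ : ι → Dom n → ℂ) (lam mu : Fin n → ℝ) :
    slashEll M (fun p => ∑ i ∈ s, b i * φ i p) lam mu =
      fun p => ∑ i ∈ s, b i * slashEll M (φ i) lam mu p := by
  funext p
  simp only [slashEll, Finset.mul_sum]
  exact Finset.sum_congr rfl fun i _ => by ring

lemma slashEll_zero {n : ℕ} (M : Matrix (Fin n) (Fin n) ℚ) (φ : Dom n → ℂ) :
    slashEll M φ 0 0 = φ := by
  funext p
  have h1 : torsionPoint (0 : Fin n → ℝ) 0 p.1 = 0 := by funext r; simp [torsionPoint]
  simp [slashEll, h1, bil]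

/-- Linear combinations of the functions `chainV` belong to `Merₙ^M` for the index of `Fₙ`. -/
lemma merIdx_of_sum {n : ℕ} (hn : n ≠ 0) {ι : Type*} (s : Finset ι) (b : ι → ℂ)
    (S : ι → ℕ → Finset (Fin n)) (L : ι → ℕ → ℂ)
    (hS : ∀ i ∈ s, ∀ m, m ≠ 0 → m ≤ n → (S i m).Nonempty) (hS0 : ∀ i ∈ s, S i 0 = ∅)
    (hSn : ∀ i ∈ s, S i n = Finset.univ) :
    MerIdx (indexF n) fun p => ∑ i ∈ s, b i * chainV (S i) (L i) p := by
  have h : ∀ lam mu : Fin n → ℝ,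
      Mer (slashEll (indexF n) (fun p => ∑ i ∈ s, b i * chainV (S i) (L i) p) lam mu) := by
    intro lam mu
    rw [slashEll_sum]
    refine mer_of_isThetaQuotient (N := n) ?_ ?_
    · exact IsThetaQuotient.sum _ fun i hi => IsThetaQuotient.mul
        (isThetaQuotient_of_analytic (f := fun _ => b i) analyticOnNhd_const)
        (isThetaQuotient_slashEll_chainV (hS i hi) _ _ _ _)
    · exact HasModerateGrowth.sum _ fun i hi => HasModerateGrowth.const_mul
        (hasModerateGrowth_slashEll_chainV hn (hS i hi) (hS0 i hi) (hSn i hi) _ _ _) _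
  refine ⟨?_, fun lam mu => h _ _⟩
  have := h 0 0
  rwa [slashEll_zero] at this

lemma merIdx_coeff_polyF {n : ℕ} (hn : n ≠ 0) (j : Fin n →₀ ℕ) :
    MerIdx (indexF n) fun p => (polyF p).coeff j := by
  obtain ⟨a, ha⟩ := exists_coeff_eq_sum_eval n j
  have h := merIdx_of_sum hn (a.support ×ˢ (Finset.univ : Finset (Equiv.Perm (Fin n))))
    (fun i => a i.1) (fun i => prefixSet i.2) (fun i m => -∑ r ∈ prefixSet i.2 m, i.1 r)
    (fun i _ m => prefixSet_nonempty i.2) (fun i _ => prefixSet_zero i.2)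
    (fun i _ => prefixSet_self i.2)
  convert h using 2 with p
  rw [ha _ (totalDegree_polyF_le p), Finset.sum_product, Finsupp.sum]
  refine Finset.sum_congr rfl fun x _ => ?_
  rw [eval_polyF, Finset.mul_sum]

lemma merIdx_zero {n : ℕ} (hn : n ≠ 0) : MerIdx (indexF n) (0 : Dom n → ℂ) := by
  have h := merIdx_of_sum (n := n) hn (∅ : Finset Unit) (fun _ => 0) (fun _ _ => ∅) (fun _ _ => 0)
    (by simp) (by simp) (by simp)
  simp only [Finset.sum_empty] at h
  exact h

lemma mem_Iic_of_coeff_polyF_ne_zero {n : ℕ} {p : Dom n} {j : Fin n →₀ ℕ}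
    (h : (polyF p).coeff j ≠ 0) : j ∈ Finset.Iic (Finsupp.equivFunOnFinite.symm fun _ => n) := by
  rw [Finset.mem_Iic]
  intro r
  have h1 := (MvPolynomial.le_totalDegree (MvPolynomial.mem_support_iff.2 h)).trans
    (totalDegree_polyF_le p)
  refine le_trans ?_ h1
  rw [Finsupp.sum_fintype _ _ (by simp)]
  exact Finset.single_le_sum (f := fun i => j i) (fun _ _ => Nat.zero_le _) (Finset.mem_univ r)

/-- The coefficients of the completion of `Fₙ`, as a family of functions. Powers of `ν` do not
occur. -/
noncomputable def familyF (n : ℕ) : Family n :=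
  Finsupp.onFinset ({0} ×ˢ Finset.Iic (Finsupp.equivFunOnFinite.symm fun _ => n))
    (fun ij => if ij.1 = 0 then fun p => (polyF p).coeff ij.2 else 0) fun ij h => by
      rw [Finset.mem_product, Finset.mem_singleton]
      split_ifs at h with h0
      · obtain ⟨p, hp⟩ := Function.ne_iff.1 h
        exact ⟨h0, mem_Iic_of_coeff_polyF_ne_zero hp⟩
      · exact absurd rfl h

lemma familyF_of_ne_zero {n i : ℕ} (hi : i ≠ 0) (j : Fin n →₀ ℕ) : familyF n (i, j) = 0 :=
  if_neg hi

lemma merIdx_familyF {n : ℕ} (hn : n ≠ 0) (ij : ℕ × (Fin n →₀ ℕ)) :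
    MerIdx (indexF n) (familyF n ij) := by
  obtain ⟨i, j⟩ := ij
  rcases eq_or_ne i 0 with rfl | hi
  · exact merIdx_coeff_polyF hn j
  · rw [familyF_of_ne_zero hi]
    exact merIdx_zero hn

lemma toFun_familyF {n : ℕ} (p : Dom n) :
    (familyF n).toFun p = MvPolynomial.eval (fun r => xi p.1 (p.2 r)) (polyF p) := by
  rw [Family.toFun, familyF, Finsupp.onFinset_sum _ (by simp), Finset.sum_product,
    Finset.sum_singleton, MvPolynomial.eval_eq']
  simp only [if_true, pow_zero, mul_one]
  symm
  refine Finset.sum_subset (fun j hj =>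
    mem_Iic_of_coeff_polyF_ne_zero (MvPolynomial.mem_support_iff.1 hj)) fun j _ hj => ?_
  rw [MvPolynomial.notMem_support_iff.1 hj, zero_mul]

/-! ### Invariance of the completion -/

/-- Without deformation the recursion is the one defining `V`. Where a theta function in a denominator
vanishes, the conventions for division by zero agree. -/
lemma V_eq_deformedV (τ : UpperHalfPlane) (n : ℕ) (z : Fin n → ℂ) (Z : ℕ → ℂ) (hZ0 : Z 0 = 0)
    (hZ : ∀ j (hj : j < n), Z (j + 1) = Z j + z ⟨j, hj⟩) : V τ n z = deformedV τ Z 0 n := by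
  have hsum : ∀ m (hm : m ≤ n), ∑ k : Fin m, z (k.castLE hm) = Z m := by
    intro m
    induction m with
    | zero => intro _; simp [hZ0]
    | succ m ih =>
      intro hm
      rw [Fin.sum_univ_castSucc, hZ m hm, ← ih (by omega)]
      rfl
  have hcoef : ∀ r m, expTheta τ Z (0 : ℕ → ℂ) r m = thetaCoef τ (Z m) r := by
    intro r m
    rw [expTheta, Finset.sum_eq_single 0]
    · simp
    · intro i _ hi; simp [hi]
    · simp
  induction n using Nat.strong_induction_on with
  | _ n ih =>
    rcases eq_or_ne n 0 with rfl | hn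
    · rw [V_zero]; simp [deformedV]
    · rw [V, if_neg hn, deformedV, recSol_of_ne_zero hn, div_eq_mul_inv]
      have h1 := hsum n le_rfl
      simp only [Fin.castLE_rfl, id] at h1
      rw [h1, Finset.sum_range]
      refine congrArg₂ _ (congrArg _ (Finset.sum_congr rfl fun m _ => ?_)) rfl
      rw [hsum m m.isLt.le, hcoef, thetaCoef, ← deformedV]
      refine congrArg₂ _ rfl ?_
      exact ih m m.isLt (fun k => z (k.castLE m.isLt.le)) (fun j hj => hZ j (hj.trans m.isLt))
        fun k hk => hsum k (hk.trans m.isLt.le)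

lemma coeff_zero_polyF {n : ℕ} (p : Dom n) : (polyF p).coeff 0 = F n p := by
  rw [← MvPolynomial.constantCoeff_eq, ← MvPolynomial.eval_zero, eval_polyF, F]
  refine Finset.sum_congr rfl fun σ _ => ?_
  rw [chainV, V_eq_deformedV p.1 n (fun k => p.2 (σ k))
    (fun m => sumForm (prefixSet σ m) p.incl)]
  · congr 1
    funext m
    simp
  · simp [prefixSet_zero]
  · intro j hj
    simp only [sumForm_apply]
    exact sum_prefixSet_succ σ hj _

/-- The points at which none of the theta functions in the denominators of the recursion
vanishes. -/
def goodSet (n : ℕ) : Set (Dom n) :=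
  {p | ∀ S : Finset (Fin n), S.Nonempty → theta p.1 (∑ r ∈ S, p.2 r) ≠ 0}

lemma goodSet_eq (n : ℕ) : goodSet n = {p : Dom n | thetaProd
    (((Finset.univ.filter fun S : Finset (Fin n) => S.Nonempty).toList).map fun S => (S, 0, 0))
    p.incl ≠ 0} := by
  ext p
  simp only [goodSet, thetaProd, Set.mem_ofPred_eq, List.map_map, ne_eq, List.prod_eq_zero_iff,
    List.mem_map, Finset.mem_toList, Finset.mem_filter, Finset.mem_univ, true_and, not_exists,
    not_and, Function.comp_apply, sumForm_apply, Complex.ofReal_zero, zero_mul, add_zero,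
    theta_eq_thetaC]
  rfl

lemma isOpen_goodSet (n : ℕ) : IsOpen (goodSet n) := by
  rw [goodSet_eq]
  exact isOpen_ne_zero (analyticOnNhd_thetaProd _)

lemma dense_goodSet (n : ℕ) : Dense (goodSet n) := by
  rw [goodSet_eq]
  refine dense_ne_zero (analyticOnNhd_thetaProd _) (exists_mem_upper_thetaProd_ne_zero _ ?_)
  simp

/-- Invariance of one summand of the completion: the transformation laws of `ξ` compensate the change
of the deformation parameters in `deformedV_modular` and `deformedV_elliptic`. -/
lemma slash_chainV {n : ℕ} {p : Dom n} (hp : p ∈ goodSet n)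
    (σ : Equiv.Perm (Fin n)) (γ : SL(2, ℤ)) (lam mu : Fin n → ℤ) :
    slashEll (indexF n) (slashSL n (indexF n) (fun q : Dom n => chainV (prefixSet σ)
      (fun m => -∑ r ∈ prefixSet σ m, xi q.1 (q.2 r)) q) γ) (fun r => (lam r : ℝ))
      (fun r => (mu r : ℝ)) p =
    chainV (prefixSet σ) (fun m => -∑ r ∈ prefixSet σ m, xi p.1 (p.2 r)) p := by
  obtain ⟨τ, z⟩ := p
  have hJ := autom_ne_zero γ τ
  set J := autom γ τ with hJdef
  set c : ℂ := (γ 1 0 : ℂ) with hc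
  set l : ℕ → ℤ := fun m => ∑ r ∈ prefixSet σ m, lam r with hl
  set k : ℕ → ℤ := fun m => ∑ r ∈ prefixSet σ m, mu r with hk
  set Z : ℕ → ℂ := fun m => ∑ r ∈ prefixSet σ m, z r with hZ
  set Ξ : ℕ → ℂ := fun m => -∑ r ∈ prefixSet σ m, xi τ (z r) with hΞ
  set w : Fin n → ℂ := z + torsionPoint (fun r => (lam r : ℝ)) (fun r => (mu r : ℝ)) τ with hw
  have hZ0 : Z 0 = 0 := by simp [hZ, prefixSet_zero]
  have hl0 : l 0 = 0 := by simp [hl, prefixSet_zero]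
  have hk0 : k 0 = 0 := by simp [hk, prefixSet_zero]
  have hne : ∀ m, m ≠ 0 → m ≤ n → theta τ (Z m) ≠ 0 := fun m hm hmn =>
    hp _ (prefixSet_nonempty σ hm hmn)
  have hsumw : ∀ m, ∑ r ∈ prefixSet σ m, w r = Z m + (l m * τ + k m) := by
    intro m
    simp only [hw, hZ, hl, hk, Pi.add_apply, torsionPoint, Finset.sum_add_distrib]
    push_cast
    rw [Finset.sum_mul]
  have hxiw : ∀ r, xi τ (w r) = xi τ (z r) + lam r := by
    intro r
    have hy := τ.im_ne_zero
    simp only [xi, hw, Pi.add_apply, torsionPoint]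
    have h1 : (z r + (((lam r : ℝ) : ℂ) * τ + ((mu r : ℝ) : ℂ))).im =
        (z r).im + lam r * τ.im := by
      simp
    rw [h1, add_div, mul_div_cancel_right₀ _ hy]
    push_cast
    ring
  have hne' : ∀ m, m ≠ 0 → m ≤ n → theta τ (Z m + (l m * τ + k m)) ≠ 0 := fun m hm hmn => by
    rw [theta_add_lattice]
    exact mul_ne_zero (mul_ne_zero (zpow_ne_zero _ (by norm_num)) (e_ne_zero _)) (hne m hm hmn)
  have hmod := deformedV_modular γ τ (fun m => Z m + (l m * τ + k m))
    (fun m => -∑ r ∈ prefixSet σ m, xi (γ • τ) (w r / J)) (by simp [hZ0, hl0, hk0]) hne'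
  have hL : (fun m => (-∑ r ∈ prefixSet σ m, xi (γ • τ) (w r / J) -
      c * (Z m + (l m * τ + k m))) / J) = fun m => Ξ m - l m := by
    funext m
    rw [div_eq_iff hJ]
    simp only [hJdef, xi_div_autom, Finset.sum_sub_distrib, ← Finset.mul_sum, hsumw, hxiw,
      Finset.sum_add_distrib, hΞ, hl]
    push_cast
    ring
  rw [← hJdef, ← hc, hL] at hmod
  have hell := deformedV_elliptic τ Z (fun m => Ξ m - l m) l k hZ0 hl0 hk0 hne
  rw [hell] at hmod
  simp only [sub_add_cancel] at hmod
  have hlhs : chainV (prefixSet σ) (fun m => -∑ r ∈ prefixSet σ m, xi (γ • τ) (w r / J))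
      (γ • τ, fun r => w r / J) = deformedV (γ • τ) (fun m => (Z m + (l m * τ + k m)) / J)
      (fun m => -∑ r ∈ prefixSet σ m, xi (γ • τ) (w r / J)) n := by
    rw [chainV]
    congr 1
    funext m
    simp only [sumForm_apply, Dom.incl, ← Finset.sum_div, hsumw]
  have hrhs : chainV (prefixSet σ) (fun m => -∑ r ∈ prefixSet σ m, xi τ (z r)) (τ, z) =
      deformedV τ Z Ξ n := by
    rw [chainV]
    congr 1
    funext m
    simp only [sumForm_apply, Dom.incl, hZ]
  rw [slashEll, slashSL]
  change e _ * e _ * (J ^ (-(n : ℤ)) * e (-c * bil (indexF n) w w / J) *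
    chainV (prefixSet σ) (fun m => -∑ r ∈ prefixSet σ m, xi (γ • τ) (w r / J))
      (γ • τ, fun r => w r / J)) = chainV (prefixSet σ) _ (τ, z)
  rw [hlhs, hrhs, hmod]
  have hJn : J ^ (-(n : ℤ)) * J ^ n = 1 := by
    rw [zpow_neg, zpow_natCast, inv_mul_cancel₀ (pow_ne_zero _ hJ)]
  have hs1 : ∑ r, w r = Z n + (l n * τ + k n) := by
    rw [← hsumw, prefixSet_self]
  have hs2 : ∑ r, (lam r : ℂ) = l n := by simp [hl, prefixSet_self]
  have hs3 : ∑ r, (mu r : ℂ) = k n := by simp [hk, prefixSet_self]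
  have hs4 : ∑ r, z r = Z n := by simp [hZ, prefixSet_self]
  have hexp : e (bil (indexF n) (fun r => ((lam r : ℝ) : ℂ) + ((mu r : ℝ) : ℂ))
        (fun r => ((lam r : ℝ) : ℂ) + ((mu r : ℝ) : ℂ))) *
      e (bil (indexF n) (fun r => ((lam r : ℝ) : ℂ))
        (fun r => ((lam r : ℝ) : ℂ) * (τ : ℂ) + 2 * z r)) *
      e (-c * bil (indexF n) w w / J) * e (-c * (Z n + (l n * τ + k n)) ^ 2 / (2 * J)) *
      ((-1) ^ (l n + k n) * e ((l n : ℂ) ^ 2 * τ / 2 + l n * Z n)) = 1 := by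
    rw [← e_half_int]
    simp only [← e_add, bil_indexF, Complex.ofReal_intCast, Finset.sum_add_distrib,
      ← Finset.sum_mul, ← Finset.mul_sum, hs1, hs2, hs3, hs4]
    -- what remains is `e(-j(j - 1)/2)` with `j = l n + k n`, and `j(j - 1)` is even
    obtain ⟨a, ha⟩ := Int.even_mul_pred_self (l n + k n)
    have ha' : ((l n : ℂ) + k n) * ((l n : ℂ) + k n - 1) = a + a := by exact_mod_cast ha
    refine Eq.trans (congrArg e ?_) (e_int (-a))
    push_cast
    field_simp
    linear_combination -ha' * J
  linear_combination (J ^ (-(n : ℤ)) * J ^ n * deformedV τ Z Ξ n) * hexp + deformedV τ Z Ξ n * hJn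

theorem isAlmostJacobi_familyF {n : ℕ} (hn : n ≠ 0) :
    IsAlmostJacobi n (indexF n) (familyF n) := by
  refine ⟨merIdx_familyF hn, fun γ lam mu => ?_⟩
  refine (dense_goodSet n).mono (interior_maximal (fun p hp => ?_) (isOpen_goodSet n))
  rw [Set.mem_ofPred_eq]
  have h : (familyF n).toFun = fun p => ∑ σ : Equiv.Perm (Fin n), (1 : ℂ) * chainV (prefixSet σ)
      (fun m => -∑ r ∈ prefixSet σ m, xi p.1 (p.2 r)) p := by
    funext q
    simp only [toFun_familyF, eval_polyF, one_mul]
  have h2 : slashSL n (indexF n) (familyF n).toFun γ = fun p => ∑ σ : Equiv.Perm (Fin n), (1 : ℂ) *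
      slashSL n (indexF n) (fun q : Dom n => chainV (prefixSet σ)
      (fun m => -∑ r ∈ prefixSet σ m, xi q.1 (q.2 r)) q) γ p := by
    funext q
    simp only [h, slashSL, Finset.mul_sum, one_mul]
  rw [h2, slashEll_sum, h]
  simp only [one_mul]
  exact Finset.sum_congr rfl fun σ _ => slash_chainV hp σ γ lam mu

/-! ### The linear coefficients of the completion -/

lemma derivation_expTheta {R : Type*} [CommRing R] [Algebra ℂ R] (D : Derivation ℂ R R)
    (τ : UpperHalfPlane) (Z : ℕ → ℂ) (L : ℕ → R) (r m : ℕ) :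
    D (expTheta τ Z L (r + 1) m) = D (L m) * expTheta τ Z L r m := by
  rw [expTheta, expTheta, map_sum, Finset.sum_range_succ', Finset.mul_sum]
  have h0 : D (algebraMap ℂ R (1 / (Nat.factorial 0 : ℂ) * thetaCoef τ (Z m) (r + 1 - 0)) *
      L m ^ 0) = 0 := by
    rw [pow_zero, mul_one, Derivation.map_algebraMap]
  rw [h0, add_zero]
  refine Finset.sum_congr rfl fun i _ => ?_
  rw [Derivation.leibniz, Derivation.map_algebraMap, Derivation.leibniz_pow, Nat.add_sub_cancel,
    Nat.add_sub_add_right]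
  have h1 : algebraMap ℂ R (1 / ((i + 1).factorial : ℂ) * thetaCoef τ (Z m) (r - i)) * (i + 1 : ℕ) =
      algebraMap ℂ R (1 / (i.factorial : ℂ) * thetaCoef τ (Z m) (r - i)) := by
    rw [← map_natCast (algebraMap ℂ R), ← map_mul]
    congr 1
    have h2 : (i.factorial : ℂ) ≠ 0 := by exact_mod_cast i.factorial_ne_zero
    have h3 : ((i : ℂ) + 1) ≠ 0 := by exact_mod_cast Nat.succ_ne_zero i
    rw [Nat.factorial_succ]
    push_cast
    field_simp
  simp only [smul_eq_mul, nsmul_eq_mul, mul_zero, add_zero]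
  rw [← h1]
  ring

/-- Differentiation of the deformed recursion with respect to its parameters merges two
neighbouring variables. -/
lemma derivation_deformedV {R : Type*} [CommRing R] [Algebra ℂ R] (D : Derivation ℂ R R)
    {τ : UpperHalfPlane} {Z : ℕ → ℂ} {L : ℕ → R} (hL : L 0 = 0) {n : ℕ}
    (hne : ∀ m, m ≠ 0 → m ≤ n → theta τ (Z m) ≠ 0) :
    D (deformedV τ Z L n) = ∑ k ∈ Finset.range (n - 1), (D (L k) - D (L (k + 1))) *
      deformedV τ (fun m => Z (skip (k + 1) m)) (fun m => L (skip (k + 1) m)) (n - 1) := by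
  rw [deformedV, derivation_recSol D (N := n) (fun m hm hmn => expTheta_diag (hne m hm hmn))
    (fun m => D (L m)) (by simp [hL])
    (fun m => by rw [expTheta_zero_left, Derivation.map_algebraMap])
    (derivation_expTheta D τ Z L) le_rfl, ← Finset.sum_neg_distrib]
  refine Finset.sum_congr rfl fun k _ => ?_
  rw [← neg_mul, neg_sub]
  rfl

/-- The permutation with value `b` at `a` which is given by `τ` on the complements of `a` and
`b`. -/
def insertPerm {m : ℕ} (a b : Fin (m + 1)) (τ : Equiv.Perm (Fin m)) : Equiv.Perm (Fin (m + 1)) :=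
  (finSuccEquiv' a).trans ((Equiv.optionCongr τ).trans (finSuccEquiv' b).symm)

@[simp] lemma insertPerm_self {m : ℕ} (a b : Fin (m + 1)) (τ : Equiv.Perm (Fin m)) :
    insertPerm a b τ a = b := by
  simp [insertPerm]

@[simp] lemma insertPerm_succAbove {m : ℕ} (a b : Fin (m + 1)) (τ : Equiv.Perm (Fin m))
    (j : Fin m) : insertPerm a b τ (a.succAbove j) = b.succAbove (τ j) := by
  simp [insertPerm]

lemma bijective_insertPerm {m : ℕ} (a : Fin (m + 1)) :
    Function.Bijective fun x : Fin (m + 1) × Equiv.Perm (Fin m) => insertPerm a x.1 x.2 := by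
  rw [Fintype.bijective_iff_injective_and_card]
  refine ⟨?_, by simp [Fintype.card_perm, Nat.factorial_succ]⟩
  rintro ⟨b, τ⟩ ⟨b', τ'⟩ h
  have hb : b = b' := by
    have := congrArg (fun σ : Equiv.Perm (Fin (m + 1)) => σ a) h
    simpa using this
  subst hb
  refine Prod.ext rfl (Equiv.ext fun j => ?_)
  have := congrArg (fun σ : Equiv.Perm (Fin (m + 1)) => σ (a.succAbove j)) h
  simpa using this

/-- Summation over the permutations with `σ k = 0`, sorted by the value `σ (k + 1) = i + 1`. -/
lemma sum_perm_ite {m : ℕ} (k : Fin m) (f : Equiv.Perm (Fin (m + 1)) → ℂ) :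
    ∑ σ : Equiv.Perm (Fin (m + 1)), (if σ k.castSucc = 0 then f σ else 0) =
      ∑ i : Fin m, ∑ τ : Equiv.Perm (Fin m),
        if (τ k : ℕ) = 0 then f (insertPerm k.succ i.succ τ) else 0 := by
  have hk : k.castSucc = k.succ.succAbove k :=
    (Fin.succAbove_of_castSucc_lt _ _ (Fin.castSucc_lt_succ)).symm
  rw [← (bijective_insertPerm k.succ).sum_comp, Fintype.sum_prod_type, Fin.sum_univ_succ]
  simp only [hk, insertPerm_succAbove]
  -- the value `0` is not taken at `k + 1`, since it is taken at `k`
  rw [Finset.sum_eq_zero fun τ _ => if_neg (Fin.succAbove_ne 0 _), zero_add]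
  refine Finset.sum_congr rfl fun i _ => Finset.sum_congr rfl fun τ _ => ?_
  congr 1
  obtain ⟨m, rfl⟩ : ∃ m', m = m' + 1 := ⟨m - 1, by have := k.isLt; omega⟩
  rw [Fin.succAbove_eq_zero_iff (Fin.succ_ne_zero i), Fin.ext_iff]
  rfl

/-- The partial sums along `insertPerm (k + 1) (i + 1) τ`, with the `(k + 1)`-st one omitted, are the
partial sums of the vector in which the variables `0` and `i + 1` are merged. -/
lemma V_mergeFirst {m : ℕ} (p : Dom (m + 1)) (k i : Fin m) (τ : Equiv.Perm (Fin m))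
    (hτ : (τ k : ℕ) = 0) :
    V p.1 m (fun j => mergeFirst p.2 i (τ j)) = deformedV p.1
      (fun j => sumForm (prefixSet (insertPerm k.succ i.succ τ) (skip (k + 1) j)) p.incl) 0 m := by
  refine V_eq_deformedV _ _ _ _ (by simp [skip, prefixSet_zero]) fun j hj => ?_
  set σ := insertPerm k.succ i.succ τ with hσ
  simp only [sumForm_apply, Dom.incl]
  have hne : ∀ j : Fin m, j ≠ k → (τ j : ℕ) ≠ 0 := fun j hjk h =>
    hjk (τ.injective (Fin.ext (h.trans hτ.symm)))
  have hsucc : ∀ j : Fin m, σ (k.succ.succAbove j) = i.succ.succAbove (τ j) := fun j =>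
    insertPerm_succAbove _ _ _ _
  rcases lt_trichotomy j k with h | h | h
  -- the step from `j` to `j + 1` adds one variable, except for `j = k` where it adds two
  · have h1 : k.succ.succAbove ⟨j, hj⟩ = ⟨j, by omega⟩ := by
      rw [Fin.succAbove_of_castSucc_lt]
      · rfl
      · rw [Fin.lt_def]; simp; omega
    rw [skip, skip, if_pos (by omega), if_pos (by omega), sum_prefixSet_succ σ (by omega),
      ← h1, hsucc, mergeFirst, if_neg (hne _ (by rw [Ne, Fin.ext_iff]; simp; omega))]
  · subst h
    have h1 : k.succ.succAbove k = ⟨k, by omega⟩ :=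
      Fin.succAbove_of_castSucc_lt _ _ Fin.castSucc_lt_succ
    have h2 : σ ⟨k + 1, by omega⟩ = i.succ := insertPerm_self _ _ _
    have h3 : i.succ.succAbove (τ k) = 0 := by
      rw [Fin.succAbove_of_castSucc_lt]
      · exact Fin.ext hτ
      · rw [Fin.lt_def]; simp [hτ]
    rw [skip, skip, if_neg (by omega), if_pos (by omega), sum_prefixSet_succ σ (by omega),
      sum_prefixSet_succ σ (by omega), h2, ← h1, hsucc, h3, mergeFirst, if_pos hτ, add_assoc]
  · have h1 : k.succ.succAbove ⟨j, hj⟩ = ⟨j + 1, by omega⟩ := by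
      rw [Fin.succAbove_of_le_castSucc]
      · rfl
      · rw [Fin.le_def]; simp; omega
    rw [skip, skip, if_neg (by omega), if_neg (by omega), sum_prefixSet_succ σ (by omega),
      ← h1, hsucc, mergeFirst, if_neg (hne _ (by rw [Ne, Fin.ext_iff]; simp; omega))]

/-- The derivative with respect to `ξ(τ, z₁)` only sees the position `k` at which `σ` takes the value
`0`. -/
lemma constantCoeff_pderiv_deformedV {m : ℕ} {p : Dom (m + 1)} (hp : p ∈ goodSet (m + 1))
    (σ : Equiv.Perm (Fin (m + 1))) :
    MvPolynomial.constantCoeff (MvPolynomial.pderiv 0 (deformedV p.1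
      (fun j => sumForm (prefixSet σ j) p.incl)
      (fun j => -∑ r ∈ prefixSet σ j, (MvPolynomial.X r : MvPolynomial (Fin (m + 1)) ℂ)) (m + 1))) =
    ∑ k : Fin m, if σ k.castSucc = 0 then
      deformedV p.1 (fun j => sumForm (prefixSet σ (skip (k + 1) j)) p.incl) 0 m else 0 := by
  rw [derivation_deformedV _ (by simp [prefixSet_zero]) (fun j hj hjm => by
    rw [sumForm_apply]; exact hp _ (prefixSet_nonempty σ hj hjm)), Nat.add_sub_cancel,
    Finset.sum_range, map_sum]
  refine Finset.sum_congr rfl fun k _ => ?_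
  have h1 : MvPolynomial.pderiv 0
      (-∑ r ∈ prefixSet σ k, (MvPolynomial.X r : MvPolynomial (Fin (m + 1)) ℂ)) -
      MvPolynomial.pderiv 0 (-∑ r ∈ prefixSet σ (k + 1), MvPolynomial.X r) =
      if σ k.castSucc = 0 then 1 else 0 := by
    have hk : (k : ℕ) < m + 1 := by omega
    rw [sum_prefixSet_succ σ hk, ← map_sub, neg_sub_neg, add_sub_cancel_left,
      MvPolynomial.pderiv_X]
    simp only [Pi.single_apply]
    rfl
  rw [h1, map_mul]
  have h2 := map_deformedV (MvPolynomial.aeval (0 : Fin (m + 1) → ℂ)) p.1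
    (fun j => sumForm (prefixSet σ (skip (k + 1) j)) p.incl) (fun j => -∑ r ∈
      prefixSet σ (skip (k + 1) j), (MvPolynomial.X r : MvPolynomial (Fin (m + 1)) ℂ)) m
  have h3 : (fun j => MvPolynomial.aeval (0 : Fin (m + 1) → ℂ) (-∑ r ∈
      prefixSet σ (skip (k + 1) j), (MvPolynomial.X r : MvPolynomial (Fin (m + 1)) ℂ))) = 0 := by
    funext j; simp
  rw [h3] at h2
  have h4 : ∀ P : MvPolynomial (Fin (m + 1)) ℂ,
      MvPolynomial.constantCoeff P = MvPolynomial.aeval (0 : Fin (m + 1) → ℂ) P := fun P => by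
    rw [← MvPolynomial.eval_zero, ← MvPolynomial.coe_aeval_eq_eval]
    rfl
  rw [h4 (deformedV _ _ _ _), h2]
  split_ifs <;> simp

/-- The coefficient of `ξ(τ, z₁)` in the completion of `Fₙ`. -/
theorem coeff_single_polyF {m : ℕ} {p : Dom (m + 1)} (hp : p ∈ goodSet (m + 1)) :
    (polyF p).coeff (Finsupp.single 0 1) = mergedSum m p := by
  have h0 : (polyF p).coeff (Finsupp.single 0 1) =
      MvPolynomial.constantCoeff (MvPolynomial.pderiv 0 (polyF p)) := by
    rw [MvPolynomial.constantCoeff_eq, MvPolynomial.coeff_pderiv]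
    simp
  rw [h0, polyF, map_sum, map_sum]
  simp only [constantCoeff_pderiv_deformedV hp]
  rw [Finset.sum_comm]
  simp only [sum_perm_ite]
  rw [Finset.sum_comm, mergedSum]
  refine Finset.sum_congr rfl fun i _ => ?_
  rw [Finset.sum_comm, F]
  refine Finset.sum_congr rfl fun τ _ => ?_
  rw [Finset.sum_eq_single (τ.symm ⟨0, i.pos⟩)]
  · rw [if_pos (by simp)]
    exact (V_mergeFirst p _ i τ (by simp)).symm
  · intro k _ hk
    refine if_neg fun h => hk ?_
    rw [Equiv.eq_symm_apply]
    exact Fin.ext h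
  · simp

/-! ### The expansion of the `n`-point function -/

lemma GenEq.trans {n : ℕ} {φ ψ χ : Dom n → ℂ} (h : GenEq φ ψ) (h' : GenEq ψ χ) : GenEq φ χ := by
  refine (Dense.inter_of_isOpen_left h h' isOpen_interior).mono
    (interior_maximal (fun p hp => ?_) (isOpen_interior.inter isOpen_interior))
  exact Eq.trans (interior_subset (s := {p | φ p = ψ p}) hp.1)
    (interior_subset (s := {p | ψ p = χ p}) hp.2)

lemma GenEq.symm {n : ℕ} {φ ψ : Dom n → ℂ} (h : GenEq φ ψ) : GenEq ψ φ := by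
  simpa only [GenEq, eq_comm] using h

lemma genEq_of_forall {n : ℕ} {φ ψ : Dom n → ℂ} (h : ∀ p, φ p = ψ p) : GenEq φ ψ := by
  simp [GenEq, h]

lemma genEq_familyF_single (m : ℕ) :
    GenEq (familyF (m + 1) (0, Finsupp.single 0 1)) (mergedSum m) :=
  (dense_goodSet (m + 1)).mono
    (interior_maximal (fun _ hp => coeff_single_polyF hp) (isOpen_goodSet (m + 1)))

/-- The coefficients of the completion of `Fₙ` are an expansion of `Fₙ`. -/
theorem isExpansionOf_familyF (m : ℕ) :
    IsExpansionOf ((m : ℤ) + 1) (indexF (m + 1)) (familyF (m + 1)) (F (m + 1)) := by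
  refine ⟨?_, genEq_of_forall coeff_zero_polyF⟩
  have h := isAlmostJacobi_familyF (Nat.succ_ne_zero m)
  push_cast at h
  exact h

lemma F_permAct {n : ℕ} (σ : Equiv.Perm (Fin n)) (p : Dom n) : F n (permAct σ p) = F n p := by
  rw [F, F, ← Equiv.sum_comp (Equiv.mulLeft σ) fun τ => V p.1 n fun k => p.2 (τ k)]
  rfl

lemma IsExpansionOf.genEq_familyF {m : ℕ} {c : Family (m + 1)}
    (h : IsExpansionOf ((m : ℤ) + 1) (indexF (m + 1)) c (F (m + 1))) (ij : ℕ × (Fin (m + 1) →₀ ℕ)) :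
    GenEq (c ij) (familyF (m + 1) ij) :=
  genEq_of_constant_term h.1 (isExpansionOf_familyF m).1
    (h.2.trans (isExpansionOf_familyF m).2.symm) ij

lemma residual_symm_of_isSymm {n : ℕ} {φ ψ : Dom n → ℂ} (hφ : IsSymm φ) (h : GenEq ψ φ)
    (σ : Equiv.Perm (Fin n)) : ∀ᶠ p in residual (Dom n), ψ (permAct σ p) = ψ p := by
  filter_upwards [(hφ σ).residual, h.residual,
    (tendsto_permAct_residual σ).eventually h.residual] with p h1 h2 h3
  rw [h2, h3]
  exact h1

theorem deltaTauEq_F (m : ℕ) :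
    DeltaTauEq ((m : ℤ) + 1) (indexF (m + 1)) (F (m + 1)) 0 :=
  ⟨⟨_, isExpansionOf_familyF m⟩, fun _ hc => (hc.genEq_familyF (1, 0)).trans
    (genEq_of_forall fun _ => by rw [familyF_of_ne_zero one_ne_zero])⟩

theorem deltaZEq_F (m : ℕ) :
    DeltaZEq ((m : ℤ) + 1) (indexF (m + 1)) 0 (F (m + 1)) (mergedSum m) :=
  ⟨⟨_, isExpansionOf_familyF m⟩, fun _ hc => (hc.genEq_familyF (0, Finsupp.single 0 1)).trans
    (genEq_familyF_single m)⟩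

end BlochOkounkov

open BlochOkounkov
theorem mainTheorem10 (m : ℕ) :
    DeltaTauEq ((m : ℤ) + 1) (indexF (m + 1)) (F (m + 1)) 0 ∧
    DeltaZEq ((m : ℤ) + 1) (indexF (m + 1)) 0 (F (m + 1)) (mergedSum m) ∧
    ∀ φ : Dom (m + 1) → ℂ, IsSymm φ →
      DeltaTauEq ((m : ℤ) + 1) (indexF (m + 1)) φ 0 →
      DeltaZEq ((m : ℤ) + 1) (indexF (m + 1)) 0 φ (mergedSum m) →
      ∀ c cF : Family (m + 1),
        IsExpansionOf ((m : ℤ) + 1) (indexF (m + 1)) c φ →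
        IsExpansionOf ((m : ℤ) + 1) (indexF (m + 1)) cF (F (m + 1)) →
        ∀ ij : ℕ × (Fin (m + 1) →₀ ℕ), ij ≠ (0, 0) → GenEq (c ij) (cF ij) := by
  refine ⟨deltaTauEq_F m, deltaZEq_F m, fun φ hφ hτ hz c cF hc hcF ij hij => ?_⟩
  refine genEq_of_linear_terms (fun _ _ _ => rfl) hc.1 hcF.1
    (residual_symm_of_isSymm hφ hc.2)
    (residual_symm_of_isSymm (fun σ => genEq_of_forall (F_permAct σ)) hcF.2) ?_ ?_ hij
  · exact ((hτ.2 c hc).trans ((deltaTauEq_F m).2 cF hcF).symm).residual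
  · exact ((hz.2 c hc).trans ((deltaZEq_F m).2 cF hcF).symm).residual
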